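/- Let $k$ be an algebraically closed field. A variety over $k$ is an integral scheme of finite type over $k$. Let $X$ be a proper variety over $k$. For $i\ge 0$ let $\Omega_X^i=\bigwedge^i\Omega_{X/k}$ be the sheaf of differential forms of degree $i$. For an $\mathcal O_X$-module $M$ let $M_{\mathrm{tors}}$ be its torsion, that is, the kernel of $M\to M\otimes_{\mathcal O_X}k(X)$, where $k(X)$ is the function field of $X$. Let $M(x)=M_x\otimes_{\mathcal O_{X,x}}\kappa(x)$ be the fibre of $M$ at $x$, and for $s\in\Gamma(X,M)$ let $s(x)\in M(x)$ be the value of $s$. For an integer $n>0$, we say that $\Gamma(X,M)$ separates $n$ general points if there is a dense open subset $U\subseteq X$ such that for all distinct closed points $x_1,\dots,x_n\in U$ there is $s\in\Gamma(X,M)$ with $s(x_1)=\dots=s(x_{n-1})=0$ and $s(x_n)\neq 0$. A variety is ruled if it is birationally equivalent over $k$ to $Y\times_k\mathbb P^1_k$ for some variety $Y$ over $k$. Let $\operatorname{snr}(X)$, the separable degree of nonruledness of $X$, be the smallest natural number $d$ such that there is a dominant rational map $X\dashrightarrow W$ over $k$ to a ruled variety $W$ for which the extension of function fields $k(X)/k(W)$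 is finite separable of degree $d$ (with $\operatorname{snr}(X)=\infty$ if there is no such $d$). **Proposition.** Let $X$ be a proper variety over $k$ and let $Q$ be an invertible sheaf on $X$. Suppose that for some integer $i>0$ there is an injective homomorphism of $\mathcal O_X$-modules $$Q\hookrightarrow \Omega_X^i/(\Omega_X^i)_{\mathrm{tors}}.$$ Let $n$ be a positive integer. If $\Gamma(X,Q)$ separates $n$ general points, then $\operatorname{snr}(X)>\lfloor n/2\rfloor$. -/

import Mathlib

universe u

open CategoryTheory Opposite TopologicalSpace AlgebraicGeometry
open scoped TensorProduct

noncomputable section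

namespace SepRuled

/-! ### Differential forms as sheaves of modules -/

section ExteriorPower

variable {A B D M N P : Type u} [CommRing A] [CommRing B] [CommRing D] [AddCommGroup M]
  [AddCommGroup N] [AddCommGroup P] [Module A M] [Module B N] [Module D P]

/-- For a ring homomorphism `ρ : A → B` and a `ρ`-semilinear map `f : M → N`, the `ρ`-semilinear
map `⋀ⁱ M → ⋀ⁱ N`, `m₁ ∧ ⋯ ∧ mᵢ ↦ f m₁ ∧ ⋯ ∧ f mᵢ`. -/
def exteriorPowerMap {ρ : A →+* B} (f : M →ₛₗ[ρ] N) (i : ℕ) : ⋀[A]^i M →ₛₗ[ρ] ⋀[B]^i N :=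
  letI : Module A (⋀[B]^i N) := Module.compHom _ ρ
  let g : ⋀[A]^i M →ₗ[A] ⋀[B]^i N := exteriorPower.alternatingMapLinearEquiv
    { toFun := fun m ↦ exteriorPower.ιMulti B i (f ∘ m)
      map_update_add' := fun m j a b ↦ by
        simp only [Function.comp_update, map_add, AlternatingMap.map_update_add]
      map_update_smul' := fun m j c a ↦ by
        simp only [Function.comp_update, map_smulₛₗ, AlternatingMap.map_update_smul]
        rfl
      map_eq_zero_of_eq' := fun m j l h hjl ↦
        AlternatingMap.map_eq_zero_of_eq _ _ (congrArg f h) hjl }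
  { toFun := g
    map_add' := g.map_add
    map_smul' := g.map_smul }

lemma exteriorPowerMap_ιMulti {ρ : A →+* B} (f : M →ₛₗ[ρ] N) (i : ℕ) (m : Fin i → M) :
    exteriorPowerMap f i (exteriorPower.ιMulti A i m) = exteriorPower.ιMulti B i (f ∘ m) :=
  letI : Module A (⋀[B]^i N) := Module.compHom _ ρ
  exteriorPower.alternatingMapLinearEquiv_apply_ιMulti _ _

lemma exteriorPowerMap_ext {ρ : A →+* B} {i : ℕ} {f g : ⋀[A]^i M →ₛₗ[ρ] N}
    (h : ∀ m, f (exteriorPower.ιMulti A i m) = g (exteriorPower.ιMulti A i m)) (x : ⋀[A]^i M) :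
    f x = g x := by
  have hx : x ∈ Submodule.span A (Set.range (exteriorPower.ιMulti A i (M := M))) := by
    rw [exteriorPower.ιMulti_span]
    trivial
  induction hx using Submodule.span_induction with
  | mem x hx => obtain ⟨m, rfl⟩ := hx; exact h m
  | zero => rw [map_zero, map_zero]
  | add x y _ _ hx hy => rw [map_add, map_add, hx, hy]
  | smul a x _ hx => rw [map_smulₛₗ, map_smulₛₗ, hx]

lemma exteriorPowerMap_id {ρ : A →+* A} (hρ : ρ = RingHom.id A) (f : M →ₛₗ[ρ] M)
    (hf : ∀ m, f m = m) (i : ℕ) (x : ⋀[A]^i M) : exteriorPowerMap f i x = x := by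
  subst hρ
  refine exteriorPowerMap_ext (g := LinearMap.id) (fun m ↦ ?_) x
  rw [exteriorPowerMap_ιMulti]
  exact congrArg _ (funext fun j ↦ hf (m j))

lemma exteriorPowerMap_comp {ρ : A →+* B} {σ : B →+* D} {τ : A →+* D} (hτ : τ = σ.comp ρ)
    (f : M →ₛₗ[ρ] N) (g : N →ₛₗ[σ] P) (h : M →ₛₗ[τ] P) (hh : ∀ m, h m = g (f m)) (i : ℕ)
    (x : ⋀[A]^i M) :
    exteriorPowerMap h i x = exteriorPowerMap g i (exteriorPowerMap f i x) := by
  have : RingHomCompTriple ρ σ τ := ⟨hτ.symm⟩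
  refine exteriorPowerMap_ext (g := (exteriorPowerMap g i).comp (exteriorPowerMap f i))
    (fun m ↦ ?_) x
  rw [LinearMap.comp_apply, exteriorPowerMap_ιMulti, exteriorPowerMap_ιMulti,
    exteriorPowerMap_ιMulti]
  exact congrArg _ (funext fun j ↦ hh (m j))

variable {C : Type u} [Category.{u} C] {R : Cᵒᵖ ⥤ CommRingCat.{u}}

/-- The restriction map of a presheaf of modules, as a semilinear map over the commutative
rings `R(U)`, `R(V)`. -/
def restr (M : PresheafOfModules.{u} (R ⋙ forget₂ CommRingCat.{u} RingCat.{u})) {U V : Cᵒᵖ}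
    (f : U ⟶ V) : M.obj U →ₛₗ[(R.map f).hom] M.obj V :=
  M.restrictₛₗ f

/-- The `i`-th exterior power `U ↦ ⋀ⁱ M(U)` of a presheaf of modules. -/
def presheafExteriorPower (M : PresheafOfModules.{u} (R ⋙ forget₂ CommRingCat.{u} RingCat.{u})) (i : ℕ) :
    PresheafOfModules.{u} (R ⋙ forget₂ CommRingCat.{u} RingCat.{u}) where
  obj U := ModuleCat.of (R.obj U) (⋀[R.obj U]^i (M.obj U))
  map {U V} f := ModuleCat.semilinearMapAddEquiv (R.map f).hom
    (ModuleCat.of (R.obj U) (⋀[R.obj U]^i (M.obj U)))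
    (ModuleCat.of (R.obj V) (⋀[R.obj V]^i (M.obj V))) (exteriorPowerMap (restr M f) i)
  map_id U := by
    apply ModuleCat.hom_ext
    refine LinearMap.ext fun x ↦ ?_
    have hf (m) : restr M (𝟙 U) m = m := ConcreteCategory.congr_hom (M.map_id U) m
    exact exteriorPowerMap_id (congrArg CommRingCat.Hom.hom (R.map_id U)) (restr M (𝟙 U)) hf i x
  map_comp {U V W} f g := by
    apply ModuleCat.hom_ext
    refine LinearMap.ext fun x ↦ ?_
    have hf (m) : restr M (f ≫ g) m = restr M g (restr M f m) :=
      M.map_comp_apply f g m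
    exact exteriorPowerMap_comp (congrArg CommRingCat.Hom.hom (R.map_comp f g)) _ _ _ hf i x

end ExteriorPower

section Modules

variable {k : Type u} [Field k] {X : Scheme.{u}}

/-- The structure homomorphisms `k → Γ(X, U)` of a scheme over `k`. -/
def baseToSections (sX : X ⟶ Spec (CommRingCat.of k)) :
    (Functor.const (Opens X)ᵒᵖ).obj (CommRingCat.of k) ⟶ X.presheaf where
  app U := (Scheme.ΓSpecIso (CommRingCat.of k)).inv ≫ sX.appTop ≫
    X.presheaf.map (homOfLE le_top : U.unop ⟶ ⊤).op
  naturality U V f := by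
    simp only [Functor.const_obj_obj, Functor.const_obj_map, Category.id_comp, Category.assoc,
      ← Functor.map_comp]
    rfl

/-- The sheaf `Ωⁱ_X` of differential forms of degree `i` on a scheme `X` over `k`: the sheaf of
`𝒪_X`-modules associated with the presheaf `U ↦ ⋀ⁱ Ω_{Γ(X, U)/k}`. -/
def differentialForms (sX : X ⟶ Spec (CommRingCat.of k)) (i : ℕ) : X.Modules :=
  (PresheafOfModules.sheafification (𝟙 X.ringCatSheaf.obj)).obj
    (presheafExteriorPower
      (PresheafOfModules.DifferentialsConstruction.relativeDifferentials' (baseToSections sX)) i)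

/-- The stalk of an `𝒪_X`-module at a point. -/
abbrev stalk (M : X.Modules) (x : X) : Ab.{u} := TopCat.Presheaf.stalk M.presheaf x

/-- The stalk of an `𝒪_X`-module at `x` is a module over the local ring of `X` at `x`. -/
instance stalkModule (M : X.Modules) (x : X) : Module (X.presheaf.stalk x) (stalk M x) :=
  PresheafOfModules.instModuleCarrierStalkCommRingCatCarrierAbPresheafOpensCarrier
    (R := X.presheaf) M.val x

lemma germ_smul (M : X.Modules) (x : X) (U : X.Opens) (hx : x ∈ U) (r : Γ(X, U)) (s : Γ(M, U)) :
    (M.presheaf.germ U x hx (r • s) : stalk M x) =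
      X.presheaf.germ U x hx r • (M.presheaf.germ U x hx s : stalk M x) :=
  PresheafOfModules.germ_smul (R := X.presheaf) M.val x U hx r s

/-- The sections over `U` of the torsion of `M`, the kernel of `M → M ⊗ k(X)`: those `s` whose
image in the stalk `M_x ⊗ k(X)` of `M ⊗ k(X)` vanishes for every `x ∈ U`. -/
def torsionSections [IsIntegral X] (M : X.Modules) (U : X.Opens) : Submodule Γ(X, U) Γ(M, U) where
  carrier := {s | ∀ x (hx : x ∈ U),
    (1 : X.functionField) ⊗ₜ[X.presheaf.stalk x] (M.presheaf.germ U x hx s : stalk M x) = 0}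
  add_mem' {a b} ha hb x hx := by
    rw [map_add, TensorProduct.tmul_add, ha x hx, hb x hx, add_zero]
  zero_mem' x hx := by rw [map_zero, TensorProduct.tmul_zero]
  smul_mem' r s hs x hx := by
    rw [germ_smul, TensorProduct.tmul_smul, hs x hx, smul_zero]

/-- The torsion `M_tors ⊆ M` of an `𝒪_X`-module on an integral scheme. -/
def torsion [IsIntegral X] (M : X.Modules) : M.val.Submodule where
  obj U := torsionSections M U.unop
  map {_ _} f s hs x hx :=
    (congrArg ((1 : X.functionField) ⊗ₜ[X.presheaf.stalk x] ·)
      (M.presheaf.germ_res_apply f.unop x hx s)).trans (hs x (f.unop.le hx))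

/-- The quotient sheaf `M / M_tors`, i.e. the sheaf associated with `U ↦ M(U) / M_tors(U)`. -/
def modTorsion [IsIntegral X] (M : X.Modules) : X.Modules :=
  (PresheafOfModules.sheafification (𝟙 X.ringCatSheaf.obj)).obj
    (Limits.cokernel (torsion M).ι)

/-- An `𝒪_X`-module is invertible if it is locally isomorphic to `𝒪_X`. -/
def IsInvertible (M : X.Modules) : Prop :=
  ∀ x : X, ∃ U : X.Opens, x ∈ U ∧
    Nonempty (M.restrict U.ι ≅ (SheafOfModules.unit U.toScheme.ringCatSheaf : U.toScheme.Modules))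

/-- The value `s(x)` of a global section `s` of `M` in the fibre `M(x) = κ(x) ⊗ M_x`. -/
def valueAt (M : X.Modules) (x : X) (s : Γ(M, ⊤)) :
    IsLocalRing.ResidueField (X.presheaf.stalk x) ⊗[X.presheaf.stalk x] stalk M x :=
  1 ⊗ₜ (M.presheaf.germ ⊤ x trivial s : stalk M x)

/-- `Γ(X, M)` separates `n` general points: there is a dense open `U ⊆ X` such that for all
distinct closed points `x₁, …, xₙ ∈ U` some global section of `M` vanishes at `x₁, …, xₙ₋₁` but
not at `xₙ`. The last index is written `l`. -/
def SeparatesGeneralPoints (M : X.Modules) (n : ℕ) : Prop :=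
  ∃ U : X.Opens, Dense (U : Set X) ∧
    ∀ x : Fin n → X, Function.Injective x → (∀ j, x j ∈ U ∧ IsClosed {x j}) →
      ∀ l : Fin n, (l : ℕ) + 1 = n →
        ∃ s : Γ(M, ⊤), (∀ j, j ≠ l → valueAt M (x j) s = 0) ∧ valueAt M (x l) s ≠ 0

end Modules

/-! ### Rational maps and their degrees -/

section RationalMaps

variable {X W : Scheme.{u}}

/-- A dominant rational map sends the generic point to the generic point. -/
lemma fromFunctionField_closedPoint [IrreducibleSpace X] [IrreducibleSpace W] (f : X ⤏ W)
    [f.IsDominant] :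
    f.fromFunctionField (IsLocalRing.closedPoint X.functionField) = genericPoint W := by
  obtain ⟨g, rfl⟩ := f.exists_rep
  have hg : IsDominant g.hom := (g.isDominant_toRationalMap_iff).mp inferInstance
  have hη : genericPoint X ∈ g.domain :=
    (genericPoint_specializes _).mem_open g.domain.2 g.dense_domain.nonempty.choose_spec
  have h1 : g.domain.fromSpecStalkOfMem (genericPoint X) hη
      (IsLocalRing.closedPoint X.functionField) = ⟨genericPoint X, hη⟩ := by
    apply Subtype.ext
    have h2 := g.domain.fromSpecStalkOfMem_ι (genericPoint X) hη
    change (g.domain.fromSpecStalkOfMem _ hη ≫ g.domain.ι) _ = _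
    rw [h2]
    exact Scheme.fromSpecStalk_closedPoint
  have h3 : IsGenericPoint (⟨genericPoint X, hη⟩ : g.domain) Set.univ := by
    refine isGenericPoint_iff_specializes.mpr fun y ↦ iff_of_true ?_ trivial
    exact g.domain.ι.isOpenEmbedding.isInducing.specializes_iff.mp (genericPoint_specializes _)
  have h4 : IsGenericPoint (g.hom ⟨genericPoint X, hη⟩) Set.univ := by
    have h := h3.image g.hom.continuous
    have e : closure (g.hom '' Set.univ) = Set.univ := by
      refine (congrArg closure Set.image_univ).trans g.hom.denseRange.closure_eq
    exact e ▸ h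
  exact (congrArg g.hom h1).trans (h4.eq (genericPoint_spec W))

/-- The extension of function fields `f^* : k(W) → k(X)` of a dominant rational map `f`. -/
def functionFieldMap [IrreducibleSpace X] [IrreducibleSpace W] (f : X ⤏ W) [f.IsDominant] :
    W.functionField ⟶ X.functionField :=
  W.presheaf.stalkSpecializes (specializes_of_eq (fromFunctionField_closedPoint f)) ≫
    Scheme.stalkClosedPointTo f.fromFunctionField

/-- The dominant rational map `f` is generically finite of degree `d` and separable, i.e.
`k(X)` is a finite separable extension of `k(W)`, of degree `d`. -/
def IsSeparableOfDegree [IsIntegral X] [IsIntegral W] (f : X ⤏ W) [f.IsDominant] (d : ℕ) : Prop :=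
  letI : Algebra W.functionField X.functionField := (functionFieldMap f).hom.toAlgebra
  FiniteDimensional W.functionField X.functionField ∧
    Algebra.IsSeparable W.functionField X.functionField ∧
    Module.finrank W.functionField X.functionField = d

end RationalMaps

/-! ### Ruled varieties -/

section Ruled

variable {k : Type u} [Field k]

/-- A variety over (the algebraically closed field) `k` is an integral scheme of finite type. -/
structure IsVariety {X : Scheme.{u}} (sX : X ⟶ Spec (CommRingCat.of k)) : Prop where
  isIntegral : IsIntegral X
  locallyOfFiniteType : LocallyOfFiniteType sX
  quasiCompact : QuasiCompact sX

attribute [local instance] MvPolynomial.gradedAlgebra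

/-- The projective line `Proj k[T₀, T₁]`. -/
def projectiveLine (k : Type u) [Field k] : Scheme.{u} :=
  Proj (MvPolynomial.homogeneousSubmodule (Fin 2) k)

/-- The structure morphism of the projective line. -/
def projectiveLineToSpec (k : Type u) [Field k] :
    projectiveLine k ⟶ Spec (CommRingCat.of k) :=
  Proj.toSpecZero (MvPolynomial.homogeneousSubmodule (Fin 2) k) ≫
    Spec.map (CommRingCat.ofHom
      (algebraMap k (MvPolynomial.homogeneousSubmodule (Fin 2) k 0)))

/-- `W` is ruled if it is birationally equivalent over `k` to `Y × ℙ¹` for some variety `Y`. -/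
def IsRuled {W : Scheme.{u}} (sW : W ⟶ Spec (CommRingCat.of k)) : Prop :=
  ∃ (Y : Scheme.{u}) (sY : Y ⟶ Spec (CommRingCat.of k)), IsVariety sY ∧
    Scheme.BirationalOver sW (Limits.pullback.fst sY (projectiveLineToSpec k) ≫ sY)

/-- There is a separable dominant rational map over `k` of degree `d` from `X` to a ruled
variety. -/
def HasSeparableMapToRuled {X : Scheme.{u}} [IsIntegral X] (sX : X ⟶ Spec (CommRingCat.of k))
    (d : ℕ) : Prop :=
  ∃ (W : Scheme.{u}) (sW : W ⟶ Spec (CommRingCat.of k)) (_ : IsIntegral W) (f : X ⤏ W)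
    (_ : f.IsDominant), IsVariety sW ∧ IsRuled sW ∧
      f.compHom sW = sX.toRationalMap ∧ IsSeparableOfDegree f d

/-- The separable degree of nonruledness `snr(X)`: the smallest degree of a separable dominant
rational map from `X` to a ruled variety (`⊤` if there is none, as for a point). -/
def snr {X : Scheme.{u}} [IsIntegral X] (sX : X ⟶ Spec (CommRingCat.of k)) : ℕ∞ :=
  ⨅ (d : ℕ) (_ : HasSeparableMapToRuled sX d), (d : ℕ∞)

end Ruled

end SepRuled

end

/-! Let `X ⇢ W` be separable of degree `d` with `W` ruled. Put `L = k(X)` and `F = k(W) = K(t)`,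
where `K` is the function field of the base of the ruling. The heart of the matter is that traces of
regular forms from `L` to `F` are regular along the lines of the ruling, and a line, being a
projective line, carries few regular forms.

A separating transcendence basis `y` of `K / k`, together with `t`, is a separating transcendence
basis of `L / k`; let `D` be the dual derivations. A section of `Q` gives a form regular at every
point of `X`. By the valuative criterion its coefficients, that is its values on `i` of the `D`, lie
in the span of such values over every valuation ring of `L / k`, and so over the integral closure
`B` of `K[t]` in `L`. By `trace_jac_mem` their traces then lie in `K[t]`. With `t⁻¹` in place of `t`
they lie in `K[t⁻¹]` as well, hence in `K` (`exists_trace_eq_algebraMap`). Fix a local generator `e`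
of `Q` with some coefficient `c ≠ 0`. Then `Tr(a c) ∈ K` for every global section `s = a e`
(`exists_coefficient_of_ruling`).

Two general points of one line of the ruling have `2 d` distinct preimages in all. At each of the
two points the value of `Tr(a c)` is a sum of the values of `a` at the `d` preimages, with non-zero
weights, and the two sums are equal (`exists_points_over_fibres`). If `n ≥ 2 d`, a section that
vanishes at all but one of these `2 d` points contradicts this equality. So `n < 2 d`
(`lt_two_mul_finrank`).

Regularity of the trace is checked at each maximal ideal `m` of `B`, and only the `m` at which the
`D` have denominators matter. In characteristic zero, differentials near `m` are generated by those
of `K` and that of a uniformiser `u`. A Jacobian is then a multiple of `∂u/∂t`, and `Tr(b ∂u/∂t)` is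
regular because a commutator of matrices has trace zero. In characteristic `p` the residue field may
be inseparable over `K`, but its transcendence degree is smaller than the number of coordinates. The
differentials of the entries are therefore dependent at `m`, which reduces to Jacobians with an
entry in `m`. A high power of this entry absorbs the denominators, and the Cartier operator, which
commutes with the trace, removes the power again. -/

namespace SepRuled

/-! ### Differentials and derivations from a separating transcendence basis. -/

section DifferentialBasis

open IntermediateField algebraAdjoinAdjoin

/-- A separating transcendence basis `z` of `L / k` gives the basis `dz` of `Ω[L⁄k]`. -/
theorem exists_kaehlerDifferential_basis {k L ι : Type*} [Field k] [Field L] [Algebra k L]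
    {z : ι → L} (hz : AlgebraicIndependent k z)
    (hsep : Algebra.IsSeparable (adjoin k (Set.range z)) L) :
    ∃ b : Module.Basis ι L (Ω[L⁄k]), ∀ i, b i = KaehlerDifferential.D k L (z i) := by
  let R := MvPolynomial ι k
  let A := Algebra.adjoin k (Set.range z)
  let E := adjoin k (Set.range z)
  let e : R ≃ₐ[k] A := hz.aevalEquiv
  let _ : Algebra R L := (MvPolynomial.aeval z).toRingHom.toAlgebra
  let _ : Algebra R A := e.toRingEquiv.toRingHom.toAlgebra
  let _ : Algebra R E := ((algebraMap A E).comp (algebraMap R A)).toAlgebra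
  have : IsScalarTower R A E := IsScalarTower.of_algebraMap_eq' rfl
  have he (r : R) : ((e r : A) : L) = MvPolynomial.aeval z r :=
    hz.algebraMap_aevalEquiv r
  have : IsScalarTower R E L := IsScalarTower.of_algebraMap_eq fun r ↦ (he r).symm
  have : IsScalarTower k R L := IsScalarTower.of_algebraMap_eq fun r ↦ by
    change _ = MvPolynomial.aeval z (MvPolynomial.C r)
    simp
  have h0 : IsFractionRing (Algebra.adjoin k (Set.range z)) (adjoin k (Set.range z)) :=
    inferInstance
  have : IsFractionRing R E :=
    (IsFractionRing.isFractionRing_iff_of_base_ringEquiv E e.symm.toRingEquiv).mp h0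
  -- `k[z] → k(z) → L` is a localization followed by a separable extension, hence formally étale, so
  -- the differentials of `L` are the base change of those of `k[z]`.
  have h1 : Algebra.FormallyEtale R E := .of_isLocalization (nonZeroDivisors R)
  have h2 : Algebra.FormallyEtale E L := .of_isSeparable _ _
  have h3 : Algebra.FormallyEtale R L := .comp R E L
  let b := ((KaehlerDifferential.mvPolynomialBasis k ι).baseChange L).map
    (KaehlerDifferential.tensorKaehlerEquivOfFormallyEtale k R L)
  refine ⟨b, fun i ↦ ?_⟩
  have h4 : (KaehlerDifferential.mvPolynomialBasis k ι).baseChange L i =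
      1 ⊗ₜ[R] KaehlerDifferential.D k R (MvPolynomial.X i) := by
    rw [Module.Basis.baseChange_apply, KaehlerDifferential.mvPolynomialBasis_apply]
  have h5 : b i = KaehlerDifferential.mapBaseChange k R L
      (1 ⊗ₜ[R] KaehlerDifferential.D k R (MvPolynomial.X i))  :=
    congrArg (KaehlerDifferential.mapBaseChange k R L) h4
  rw [h5, KaehlerDifferential.mapBaseChange_tmul, KaehlerDifferential.map_D, one_smul]
  exact congrArg _ (MvPolynomial.aeval_X z i)

theorem derivation_eq_of_separating {k L ι M : Type*} [Field k] [Field L] [Algebra k L]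
    [AddCommGroup M] [Module L M] [Module k M] [IsScalarTower k L M]
    {z : ι → L} (hz : AlgebraicIndependent k z)
    (hsep : Algebra.IsSeparable (adjoin k (Set.range z)) L) (d d' : Derivation k L M)
    (h : ∀ i, d (z i) = d' (z i)) : d = d' := by
  obtain ⟨b, hb⟩ := exists_kaehlerDifferential_basis hz hsep
  have : d.liftKaehlerDifferential = d'.liftKaehlerDifferential :=
    b.ext fun i ↦ by simp [hb, h]
  rw [← d.liftKaehlerDifferential_comp, this, d'.liftKaehlerDifferential_comp]

theorem exists_derivation_of_separating {k L ι : Type*} [Field k] [Field L] [Algebra k L]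
    {z : ι → L} (hz : AlgebraicIndependent k z)
    (hsep : Algebra.IsSeparable (adjoin k (Set.range z)) L) (m : ι → L) :
    ∃ d : Derivation k L L, ∀ i, d (z i) = m i := by
  obtain ⟨b, hb⟩ := exists_kaehlerDifferential_basis hz hsep
  refine ⟨(b.constr ℤ m).compDer (KaehlerDifferential.D k L), fun i ↦ ?_⟩
  have := b.constr_basis ℤ m i
  rw [hb] at this
  simpa using this

end DifferentialBasis

end SepRuled

namespace SepRuled

/-! ### Jacobian determinants and divergences. -/

section Determinants

variable {R L ι : Type*} [CommRing R] [CommRing L] [Algebra R L] [Fintype ι] [DecidableEq ι]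

omit [Fintype ι] in
theorem derivation_prod (D : Derivation R L L) (s : Finset ι) (f : ι → L) :
    D (∏ i ∈ s, f i) = ∑ i ∈ s, (∏ j ∈ s.erase i, f j) * D (f i) := by
  induction s using Finset.induction_on with
  | empty => simp
  | insert a s ha ih =>
    rw [Finset.prod_insert ha, D.leibniz, ih, Finset.sum_insert ha, Finset.erase_insert ha,
      add_comm, smul_eq_mul, smul_eq_mul, Finset.mul_sum]
    refine congrArg _ (Finset.sum_congr rfl fun i hi ↦ ?_)
    have hia : a ≠ i := fun h ↦ ha (h ▸ hi)
    rw [Finset.erase_insert_of_ne hia, Finset.prod_insert (by simp [ha]), mul_assoc]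

theorem derivation_det (D : Derivation R L L) (M : Matrix ι ι L) :
    D M.det = ∑ r, (M.updateRow r fun l ↦ D (M r l)).det := by
  simp only [Matrix.det_apply]
  rw [Finset.sum_comm, map_sum]
  refine Finset.sum_congr rfl fun σ _ ↦ ?_
  rw [← Finset.smul_sum, ← Equiv.sum_comp σ]
  have h : D (∏ i, M (σ i) i) = ∑ i, ∏ j, (M.updateRow (σ i) fun l ↦ D (M (σ i) l)) (σ j) j := by
    rw [derivation_prod]
    refine Finset.sum_congr rfl fun i _ ↦ ?_
    rw [← Finset.prod_erase_mul _ _ (Finset.mem_univ i), Matrix.updateRow_self]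
    refine congrArg (· * _) (Finset.prod_congr rfl fun j hj ↦ ?_)
    rw [Matrix.updateRow_ne]
    exact fun h ↦ (Finset.ne_of_mem_erase hj) (σ.injective h)
  rw [← h]
  rcases Int.units_eq_one_or (Equiv.Perm.sign σ) with hs | hs <;> simp [hs]

theorem det_updateRow_eq_sum (M : Matrix ι ι L) (r : ι) (v : ι → L) :
    (M.updateRow r v).det = ∑ j, v j * (M.updateRow r (Pi.single j 1)).det := by
  have h : v = ∑ l, v l • (Pi.single l 1 : ι → L) := by
    ext l
    simp [Finset.sum_apply, Pi.single_apply]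
  conv_lhs => rw [h]
  exact (map_sum ((Matrix.detRowAlternating (R := L) (n := ι)).toMultilinearMap.toLinearMap
    M r) _ _).trans (Finset.sum_congr rfl fun l _ ↦ Matrix.det_updateRow_smul _ _ _ _)

variable (D : ι → Derivation R L L)

/-- The Jacobian determinant of a family `b` with respect to the derivations `D`. -/
def jac (b : ι → L) : L := (Matrix.of fun r j ↦ D j (b r)).det

/-- Cofactors of a closed family of rows are divergence free. -/
theorem divergence_cofactor (M : Matrix ι ι L) (r : ι)
    (hM : ∀ i, i ≠ r → ∀ j l, D j (M i l) = D l (M i j)) :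
    ∑ j, D j (M.updateRow r (Pi.single j 1)).det = 0 := by
  -- Differentiating row `i ≠ r` gives a double sum over `(j, l)` of a factor that is symmetric by
  -- closedness times a minor that changes sign when `j` and `l` are exchanged. The terms cancel in
  -- pairs.
  have key (i : ι) (hi : i ≠ r) :
      ∑ j, ((M.updateRow r (Pi.single j 1)).updateRow i fun l ↦ D j (M i l)).det = 0 := by
    have h1 (j : ι) : ((M.updateRow r (Pi.single j 1)).updateRow i fun l ↦ D j (M i l)).det =
        ∑ l, D j (M i l) *
          ((M.updateRow r (Pi.single j 1)).updateRow i (Pi.single l 1)).det := by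
      exact det_updateRow_eq_sum _ _ _
    rw [Finset.sum_congr rfl fun j _ ↦ h1 j]
    have h3 (j l : ι) :
        ((M.updateRow r (Pi.single j 1)).updateRow i (Pi.single l (1 : L))).det =
          -((M.updateRow r (Pi.single l 1)).updateRow i (Pi.single j (1 : L))).det := by
      refine Eq.trans (congrArg Matrix.det ?_) (AlternatingMap.map_swap
        (Matrix.detRowAlternating (R := L) (n := ι))
        ((M.updateRow r (Pi.single l 1)).updateRow i (Pi.single j (1 : L))) hi)
      ext x y
      change _ = ((M.updateRow r (Pi.single l 1)).updateRow i (Pi.single j (1 : L)))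
        (Equiv.swap i r x) y
      simp only [Matrix.updateRow_apply, Equiv.swap_apply_def]
      split_ifs <;> simp_all
    rw [← Fintype.sum_prod_type']
    refine Finset.sum_involution (fun x _ ↦ x.swap) (fun x _ ↦ ?_) (fun x _ hx h ↦ hx ?_)
      (fun _ _ ↦ Finset.mem_univ _) (fun _ _ ↦ Prod.swap_swap _)
    · rw [Prod.fst_swap, Prod.snd_swap, h3 x.2 x.1, hM i hi x.2 x.1]
      ring
    · have h4 : x.2 = x.1 := congrArg Prod.fst h
      rw [h4, Matrix.det_zero_of_row_eq hi, mul_zero]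
      simp [hi.symm]
  simp only [derivation_det]
  rw [Finset.sum_comm]
  refine Finset.sum_eq_zero fun i _ ↦ ?_
  obtain rfl | hi := eq_or_ne i r
  · refine Finset.sum_eq_zero fun j _ ↦ Matrix.det_eq_zero_of_row_eq_zero i fun l ↦ ?_
    rw [Matrix.updateRow_self, Matrix.updateRow_self]
    obtain rfl | h := eq_or_ne l j
    · simp
    · simp [h]
  · simpa only [Matrix.updateRow_ne hi] using key i hi

/-- A determinant of closed rows, one of which is exact, is a divergence. -/
theorem det_updateRow_exact (M : Matrix ι ι L) (r : ι)
    (hM : ∀ i, i ≠ r → ∀ j l, D j (M i l) = D l (M i j)) (w : L) :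
    (M.updateRow r fun l ↦ D l w).det =
      ∑ j, D j (w * (M.updateRow r (Pi.single j 1)).det) := by
  simp only [(D _).leibniz, smul_eq_mul]
  rw [Finset.sum_add_distrib, ← Finset.mul_sum, divergence_cofactor D M r hM, mul_zero, zero_add,
    det_updateRow_eq_sum]
  exact Finset.sum_congr rfl fun j _ ↦ mul_comm _ _

end Determinants

end SepRuled

namespace SepRuled

/-! ### Characteristic `p`: Cartier's formula and the Cartier operator. -/

section Frobenius

variable {R L : Type*} [CommRing R] [Field L] [Algebra R L] (p : ℕ) [hp : Fact p.Prime]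
  [CharP L p]

omit hp in
theorem derivation_pow_char (D : Derivation R L L) (x : L) : D (x ^ p) = 0 := by
  rw [D.leibniz_pow, ← Nat.cast_smul_eq_nsmul L, CharP.cast_eq_zero, zero_smul]

theorem derivation_iterate_mul {R L : Type*} [CommRing R] [CommRing L] [Algebra R L]
    (D : Derivation R L L) (n : ℕ) (a b : L) :
    D^[n] (a * b) =
      ∑ ij ∈ Finset.HasAntidiagonal.antidiagonal n, n.choose ij.1 • (D^[ij.1] a * D^[ij.2] b) := by
  induction n with
  | zero => simp
  | succ n ih =>
    rw [Finset.sum_antidiagonal_choose_succ_nsmul (fun i j ↦ D^[i] a * D^[j] b) n,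
      Function.iterate_succ_apply', ih, map_sum, ← Finset.sum_add_distrib]
    refine Finset.sum_congr rfl fun ij hij ↦ ?_
    rw [map_nsmul, D.leibniz, Nat.choose_symm_of_eq_add (Finset.HasAntidiagonal.mem_antidiagonal.mp hij).symm,
      ← nsmul_add, Function.iterate_succ_apply', Function.iterate_succ_apply']
    simp only [smul_eq_mul]
    ring

/-- The `p`-th iterate of a derivation in characteristic `p` satisfies the Leibniz rule. -/
theorem derivation_iterate_char_mul (D : Derivation R L L) (a b : L) :
    D^[p] (a * b) = a * D^[p] b + b * D^[p] a := by
  rw [derivation_iterate_mul]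
  have h0 : (0, p) ∈ Finset.HasAntidiagonal.antidiagonal p := by simp
  have h1 : (p, 0) ∈ (Finset.HasAntidiagonal.antidiagonal p).erase (0, p) := by
    simp [hp.out.ne_zero]
  rw [← Finset.add_sum_erase _ _ h0, ← Finset.add_sum_erase _ _ h1, Finset.sum_eq_zero]
  · simp [mul_comm]
  · rintro ⟨i, j⟩ hij
    simp only [Finset.mem_erase, Finset.HasAntidiagonal.mem_antidiagonal, ne_eq, Prod.mk.injEq, not_and] at hij
    rw [← Nat.cast_smul_eq_nsmul L, (CharP.cast_eq_zero_iff L p _).mpr, zero_smul]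
    exact hp.out.dvd_choose_self (by omega) (by omega)

/-- `(a + b)ᵖ⁻¹ d(a + b) - aᵖ⁻¹ da - bᵖ⁻¹ db` is exact in characteristic `p`. -/
theorem exists_add_pow_derivation (a b : L) : ∃ w : L, ∀ D : Derivation R L L,
    (a + b) ^ (p - 1) * D (a + b) = a ^ (p - 1) * D a + b ^ (p - 1) * D b + D w := by
  obtain ⟨N, rfl⟩ : ∃ N, p = N + 1 := ⟨p - 1, by have := hp.out.pos; omega⟩
  have hcast (i : ℕ) (hi : i < N) : ((i + 1 : ℕ) : L) ≠ 0 := by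
    rw [Ne, CharP.cast_eq_zero_iff L (N + 1)]
    exact Nat.not_dvd_of_pos_of_lt (by omega) (by omega)
  -- `c i` is `binom(p, i + 1) / p`, written with denominators `i + 1 < p` that are invertible in
  -- `L`. Thus `w` is the polynomial `((a + b)ᵖ - aᵖ - bᵖ) / p`.
  let c (i : ℕ) : L := (N.choose i : L) / ((i + 1 : ℕ) : L)
  have hc1 (i : ℕ) (hi : i < N) : c i * ((i + 1 : ℕ) : L) = N.choose i :=
    div_mul_cancel₀ _ (hcast i hi)
  have hc2 (i : ℕ) (hi : i < N) : c i * ((N - i : ℕ) : L) = N.choose (i + 1) := by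
    rw [div_mul_eq_mul_div, div_eq_iff (hcast i hi)]
    rw [← Nat.cast_mul, ← Nat.cast_mul, Nat.choose_succ_right_eq N i]
  have hc (D : Derivation R L L) (i : ℕ) : D (c i) = 0 := by
    simp [c, D.leibniz_div]
  refine ⟨∑ i ∈ Finset.range N, c i * (a ^ (i + 1) * b ^ (N - i)), fun D ↦ ?_⟩
  have h1 : (a + b) ^ N = a ^ N + ∑ i ∈ Finset.range N, a ^ i * b ^ (N - i) * N.choose i := by
    rw [add_pow, Finset.sum_range_succ, add_comm]
    simp
  have h2 : (a + b) ^ N =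
      b ^ N + ∑ i ∈ Finset.range N, a ^ (i + 1) * b ^ (N - (i + 1)) * N.choose (i + 1) := by
    rw [add_pow, Finset.sum_range_succ', add_comm]
    simp
  have h3 : D (∑ i ∈ Finset.range N, c i * (a ^ (i + 1) * b ^ (N - i))) =
      (∑ i ∈ Finset.range N, a ^ i * b ^ (N - i) * N.choose i) * D a +
      (∑ i ∈ Finset.range N, a ^ (i + 1) * b ^ (N - (i + 1)) * N.choose (i + 1)) * D b := by
    rw [map_sum, Finset.sum_mul, Finset.sum_mul, ← Finset.sum_add_distrib]
    refine Finset.sum_congr rfl fun i hi ↦ ?_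
    have hi' := Finset.mem_range.mp hi
    rw [← hc1 i hi', ← hc2 i hi']
    simp only [D.leibniz, D.leibniz_pow, hc, smul_eq_mul, nsmul_eq_mul]
    rw [Nat.sub_sub, Nat.add_sub_cancel]
    ring
  rw [h3, map_add, mul_add, Nat.add_sub_cancel]
  nth_rewrite 1 [h1]
  rw [h2]
  ring

variable {ι : Type*} [DecidableEq ι] {D : ι → Derivation R L L} {z : ι → L}

/-- Cartier's formula: `bᵖ⁻¹ db` is cohomologous to `∑ₗ zₗᵖ⁻¹ (∂ₗ b)ᵖ dzₗ`. -/
theorem exists_pow_mul_derivation_eq (hDz : ∀ i j, D i (z j) = if i = j then 1 else 0)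
    (hgen : ∀ S : Subfield L, (∀ x, x ^ p ∈ S) → (∀ i, z i ∈ S) → S = ⊤) (b : L) :
    ∃ w, ∀ l, b ^ (p - 1) * D l b = D l w + z l ^ (p - 1) * (D l b) ^ p := by
  have hpos := hp.out.pos
  have hpow (x : L) : x ^ p = x ^ (p - 1) * x := by
    rw [← pow_succ, Nat.sub_add_cancel hpos]
  -- The `b` satisfying the formula form a subfield. It contains the `p`-th powers, where both sides
  -- vanish, and the coordinates, where `w = 0` works; by `hgen` it is everything.
  let P (b : L) := ∃ w, ∀ l, b ^ (p - 1) * D l b = D l w + z l ^ (p - 1) * (D l b) ^ p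
  have hconst (c : L) (h : ∀ l, D l c = 0) : P c :=
    ⟨0, fun l ↦ by simp [h, hp.out.ne_zero]⟩
  have hmul {a b : L} (ha : P a) (hb : P b) : P (a * b) := by
    obtain ⟨u, hu⟩ := ha
    obtain ⟨v, hv⟩ := hb
    refine ⟨a ^ p * v + b ^ p * u, fun l ↦ ?_⟩
    simp only [map_add, (D l).leibniz, derivation_pow_char p, smul_eq_mul, mul_zero, add_zero]
    rw [add_pow_char, mul_pow, mul_pow, mul_pow]
    have e1 : a ^ (p - 1) * b ^ (p - 1) * (a * D l b + b * D l a) =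
        a ^ p * (b ^ (p - 1) * D l b) + b ^ p * (a ^ (p - 1) * D l a) := by
      rw [hpow a, hpow b]
      ring
    rw [e1, hu, hv]
    ring
  have hadd {a b : L} (ha : P a) (hb : P b) : P (a + b) := by
    obtain ⟨u, hu⟩ := ha
    obtain ⟨v, hv⟩ := hb
    obtain ⟨w, hw⟩ := exists_add_pow_derivation (R := R) p a b
    refine ⟨u + v + w, fun l ↦ ?_⟩
    rw [hw, hu, hv, map_add, map_add, map_add, add_pow_char]
    ring
  let S : Subfield L :=
    { carrier := {b | P b}
      mul_mem' := hmul
      add_mem' := hadd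
      one_mem' := hconst 1 fun l ↦ (D l).map_one_eq_zero
      zero_mem' := hconst 0 fun l ↦ map_zero _
      neg_mem' := fun {x} hx ↦ by
        rw [← neg_one_mul]
        exact hmul (hconst _ fun l ↦ by simp) hx
      inv_mem' := fun x hx ↦ by
        obtain rfl | h := eq_or_ne x 0
        · simpa using hx
        have hpx (n : ℕ) : P (x ^ n) := by
          induction n with
          | zero => simpa using hconst 1 fun l ↦ (D l).map_one_eq_zero
          | succ n ih => rw [pow_succ]; exact hmul ih hx
        -- An inverse is a power times a `p`-th power, so closure under products suffices.
        have : x⁻¹ = x ^ (p - 1) * (x⁻¹) ^ p := by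
          rw [inv_pow, hpow x]
          field_simp
        rw [this]
        exact hmul (hpx _) (hconst _ fun l ↦ derivation_pow_char p _ _) }
  have hS : S = ⊤ := hgen S (fun x ↦ hconst _ fun l ↦ derivation_pow_char p _ _) fun i ↦
    ⟨0, fun l ↦ by
      obtain rfl | h := eq_or_ne l i
      · simp [hDz]
      · simp [hDz, h, hp.out.ne_zero]⟩
  have : b ∈ S := hS ▸ Subfield.mem_top b
  exact this

/-- `∂ⱼᵖ` is again a derivation, so its kernel is a subfield. It contains the `p`-th powers, and
also the coordinates, which `∂ⱼ` maps to constants. -/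
theorem iterate_char_eq_zero (hDz : ∀ i j, D i (z j) = if i = j then 1 else 0)
    (hgen : ∀ S : Subfield L, (∀ x, x ^ p ∈ S) → (∀ i, z i ∈ S) → S = ⊤) (j : ι) (b : L) :
    (D j)^[p] b = 0 := by
  have hconst (c : L) (h : D j c = 0) : (D j)^[p] c = 0 := by
    obtain ⟨N, hN⟩ : ∃ N, p = N + 1 := ⟨p - 1, by have := hp.out.pos; omega⟩
    rw [hN, Function.iterate_succ_apply, h, iterate_map_zero]
  let S : Subfield L :=
    { carrier := {b | (D j)^[p] b = 0}
      mul_mem' := fun {a b} ha hb ↦ by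
        simp only [Set.mem_ofPred_eq] at ha hb ⊢
        rw [derivation_iterate_char_mul, ha, hb]
        simp
      add_mem' := fun {a b} ha hb ↦ by
        simp only [Set.mem_ofPred_eq] at ha hb ⊢
        rw [iterate_map_add, ha, hb, add_zero]
      one_mem' := hconst 1 (D j).map_one_eq_zero
      zero_mem' := hconst 0 (map_zero _)
      neg_mem' := fun {x} hx ↦ by
        simp only [Set.mem_ofPred_eq] at hx ⊢
        rw [iterate_map_neg, hx, neg_zero]
      inv_mem' := fun x hx ↦ by
        simp only [Set.mem_ofPred_eq] at hx ⊢
        obtain rfl | h := eq_or_ne x 0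
        · simp
        have h1 : (D j)^[p] (x * x⁻¹) = 0 := by
          rw [mul_inv_cancel₀ h]
          exact hconst 1 (D j).map_one_eq_zero
        rw [derivation_iterate_char_mul, hx, mul_zero, add_zero] at h1
        exact (mul_eq_zero.mp h1).resolve_left h }
  have hS : S = ⊤ := hgen S (fun x ↦ hconst _ (derivation_pow_char p _ _)) fun i ↦ by
    obtain ⟨N, hN⟩ : ∃ N, p = N + 2 := ⟨p - 2, by have := hp.out.two_le; omega⟩
    change (D j)^[p] (z i) = 0
    rw [hN, Function.iterate_succ_apply, Function.iterate_succ_apply, hDz]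
    split_ifs <;> simp [iterate_map_zero]
  have : b ∈ S := hS ▸ Subfield.mem_top b
  exact this

variable [Fintype ι]

omit hp [CharP L p] [DecidableEq ι] [Fintype ι] in
theorem iterate_derivation_pow_mul (D : Derivation R L L) {y c : L} (hy : D y = 1) (hc : D c = 0)
    (n m : ℕ) : D^[n] (y ^ (m + n) * c) = ((m + n).descFactorial n : L) * (y ^ m * c) := by
  induction n generalizing m c with
  | zero => simp
  | succ n ih =>
    rw [Function.iterate_succ_apply, D.leibniz, hc, D.leibniz_pow, hy]
    have h1 : D^[n] (y ^ (m + n) * (((m + n + 1 : ℕ) : L) * c)) = _ :=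
      ih (c := ((m + n + 1 : ℕ) : L) * c) (by simp [D.leibniz, hc]) m
    refine Eq.trans (congrArg _ ?_) (h1.trans ?_)
    · simp only [nsmul_eq_mul, smul_eq_mul, mul_one, ← add_assoc, Nat.add_sub_cancel]
      ring
    · rw [← add_assoc, Nat.succ_descFactorial_succ]
      push_cast
      ring

/-- The composition of the operators `∂ⱼᵖ⁻¹`, an avatar of the Cartier operator. -/
def cartierOp (p : ℕ) (D : ι → Derivation R L L) (l : List ι) : Module.End R L :=
  (l.map fun j ↦ (D j : Module.End R L) ^ (p - 1)).prod

omit hp [CharP L p] [DecidableEq ι] [Fintype ι] in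
theorem cartierOp_cons (j : ι) (l : List ι) (x : L) :
    cartierOp p D (j :: l) x = (D j)^[p - 1] (cartierOp p D l x) := by
  rw [cartierOp, List.map_cons, List.prod_cons, Module.End.mul_apply, Module.End.pow_apply]
  rfl

omit hp [CharP L p] [DecidableEq ι] [Fintype ι] in
theorem cartierOp_mem {S : Set L} (hS : ∀ j, ∀ x ∈ S, D j x ∈ S) (l : List ι) {x : L}
    (hx : x ∈ S) : cartierOp p D l x ∈ S := by
  induction l with
  | nil => exact hx
  | cons j l ih =>
    rw [cartierOp_cons]
    generalize p - 1 = n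
    generalize cartierOp p D l x = y at ih
    induction n with
    | zero => exact ih
    | succ n h => rw [Function.iterate_succ_apply']; exact hS _ _ h

omit hp [CharP L p] [DecidableEq ι] [Fintype ι] in
theorem cartierOp_comm (E : L →+ L) (hE : ∀ j x, E (D j x) = D j (E x)) (l : List ι) (x : L) :
    E (cartierOp p D l x) = cartierOp p D l (E x) := by
  induction l with
  | nil => rfl
  | cons j l ih =>
    rw [cartierOp_cons, cartierOp_cons, ← ih]
    generalize p - 1 = n
    induction n with
    | zero => rfl
    | succ n h => rw [Function.iterate_succ_apply', Function.iterate_succ_apply', hE, h]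

omit hp [CharP L p] [DecidableEq ι] [Fintype ι] in
theorem cartierOp_const_mul {c : L} (hc : ∀ j, D j c = 0) (l : List ι) (x : L) :
    cartierOp p D l (c * x) = c * cartierOp p D l x :=
  (cartierOp_comm p (AddMonoidHom.mulLeft c)
    (fun j x ↦ by simp [(D j).leibniz, hc]) l x).symm

omit [DecidableEq ι] [Fintype ι] [CharP L p] in
-- The factor `∂ⱼᵖ⁻¹` turns `∂ⱼ x` into `∂ⱼᵖ`, which is zero, and the other factors commute with
-- `∂ⱼ`. So the operator kills divergences.
theorem cartierOp_derivation (hcomm : ∀ i j x, D i (D j x) = D j (D i x))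
    (hnil : ∀ j x, (D j)^[p] x = 0) {l : List ι} {j : ι} (hj : j ∈ l) (x : L) :
    cartierOp p D l (D j x) = 0 := by
  induction l with
  | nil => simp at hj
  | cons i l ih =>
    rw [cartierOp_cons]
    obtain rfl | hj := List.mem_cons.mp hj
    · have h : D j (cartierOp p D l x) = cartierOp p D l (D j x) :=
        cartierOp_comm p (D j).toLinearMap.toAddMonoidHom (fun i x ↦ hcomm j i x) l x
      rw [← h, ← Function.iterate_succ_apply, Nat.succ_eq_add_one, Nat.sub_add_cancel hp.out.pos, hnil]
    · rw [ih hj, iterate_map_zero]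

omit [Fintype ι] in
-- Wilson's theorem: `∂ᵖ⁻¹ zᵖ⁻¹ = (p - 1)! = -1`, once for each coordinate.
theorem cartierOp_prod (hDz : ∀ i j, D i (z j) = if i = j then 1 else 0) {l : List ι}
    (hl : l.Nodup) {c : L} (hc : ∀ j ∈ l, D j c = 0) :
    cartierOp p D l ((l.map fun j ↦ z j ^ (p - 1)).prod * c) = (-1) ^ l.length * c := by
  induction l generalizing c with
  | nil => simp [cartierOp]
  | cons i l ih =>
    rw [List.nodup_cons] at hl
    have h1 : ∀ j ∈ l, D j (z i ^ (p - 1) * c) = 0 := fun j hj ↦ by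
      have : j ≠ i := fun h ↦ hl.1 (h ▸ hj)
      simp [(D j).leibniz, (D j).leibniz_pow, hDz, this, hc j (List.mem_cons_of_mem _ hj)]
    have h2 : ((p - 1).factorial : L) = -1 := by
      have := congrArg (ZMod.castHom (dvd_refl p) L) (ZMod.wilsons_lemma p)
      rwa [map_natCast, map_neg, map_one] at this
    have h3 := iterate_derivation_pow_mul (D i) (y := z i) (c := (-1) ^ l.length * c)
      (by simp [hDz]) (by simp [(D i).leibniz, (D i).leibniz_pow, hc i List.mem_cons_self])
      (p - 1) 0
    rw [zero_add, pow_zero, one_mul, Nat.descFactorial_self, h2] at h3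
    rw [cartierOp_cons, List.map_cons, List.prod_cons, mul_right_comm, mul_comm (_ * c),
      ih hl.2 h1, mul_left_comm, h3, List.length_cons]
    ring

/-- The Cartier operator maps `b₁ᵖ⁻¹ ⋯ bₙᵖ⁻¹ db₁ ∧ ⋯ ∧ dbₙ` to `db₁ ∧ ⋯ ∧ dbₙ`. -/
theorem cartierOp_jac (hDz : ∀ i j, D i (z j) = if i = j then 1 else 0)
    (hcomm : ∀ i j x, D i (D j x) = D j (D i x))
    (hgen : ∀ S : Subfield L, (∀ x, x ^ p ∈ S) → (∀ i, z i ∈ S) → S = ⊤) (b : ι → L) :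
    cartierOp p D Finset.univ.toList ((∏ i, b i ^ (p - 1)) * jac D b) =
      (-1) ^ Fintype.card ι * jac D b ^ p := by
  choose w hw using exists_pow_mul_derivation_eq (D := D) p hDz hgen
  have hnil := iterate_char_eq_zero (D := D) p hDz hgen
  let v (i l : ι) : L := z l ^ (p - 1) * (D l (b i)) ^ p
  -- In `r ∅` each row `bᵢᵖ⁻¹ dbᵢ` is split by Cartier's formula into an exact part and the closed
  -- row `v i`. The exact parts are removed one row at a time; each removal changes the determinant
  -- by a divergence, which the operator kills.
  let r (s : Finset ι) : Matrix ι ι L := fun i l ↦ if i ∈ s then v i l else D l (w (b i)) + v i l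
  have hv (i j l) : D j (v i l) = D l (v i j) := by
    simp only [v, (D _).leibniz, derivation_pow_char p, smul_eq_mul]
    simp only [(D _).leibniz_pow, hDz]
    obtain rfl | h := eq_or_ne j l
    · rfl
    · simp [h, h.symm]
  have hclosed (s : Finset ι) (i j l) : D j (r s i l) = D l (r s i j) := by
    simp only [r]
    split_ifs
    · exact hv i j l
    · rw [map_add, map_add, hv i j l, hcomm]
  have hstep (s : Finset ι) : cartierOp p D Finset.univ.toList (r s).det =
      cartierOp p D Finset.univ.toList (r ∅).det := by
    induction s using Finset.induction_on with
    | empty => rfl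
    | insert a s ha ih =>
      rw [← ih]
      have h1 : r s = (r (insert a s)).updateRow a
          ((fun l ↦ D l (w (b a))) + (r (insert a s)) a) := by
        ext i l
        rw [Matrix.updateRow_apply]
        split_ifs with h
        · subst h
          simp [r, ha]
        · simp [r, h]
      rw [h1, Matrix.det_updateRow_add, Matrix.updateRow_eq_self,
        det_updateRow_exact D _ a fun i _ ↦ hclosed _ i, map_add, map_sum,
        Finset.sum_eq_zero fun j _ ↦ cartierOp_derivation p hcomm hnil (by simp) _, zero_add]
  have h0 : (r ∅).det = (∏ i, b i ^ (p - 1)) * jac D b := by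
    rw [jac, ← Matrix.det_mul_column]
    congr 1
    ext i l
    simp [r, v, hw]
  have h1 : (r Finset.univ).det = (Finset.univ.toList.map fun j ↦ z j ^ (p - 1)).prod *
      jac D b ^ p := by
    have : jac D b ^ p = (Matrix.of fun i l ↦ (D l (b i)) ^ p).det := by
      rw [jac, ← frobenius_def, RingHom.map_det]
      rfl
    rw [this, Finset.prod_map_toList, ← Matrix.det_mul_row]
    congr 1
    ext i l
    simp [r, v]
  rw [← h0, ← hstep Finset.univ, h1, cartierOp_prod p hDz (Finset.nodup_toList _)
    fun j _ ↦ derivation_pow_char p _ _, Finset.length_toList, Finset.card_univ]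

end Frobenius

end SepRuled

namespace SepRuled

/-! ### Traces of differentials along a finite separable extension. -/

section TraceDerivation

variable {R A F L : Type*} [CommRing R] [CommRing A] [Field F] [Field L] [Algebra R L]
  [Algebra A F] [Algebra A L] [Algebra F L] [IsScalarTower A F L]

/-- In the basis `e`, `D` is `δ` on coordinates plus a matrix `θ`. Hence the matrix of `D b` is the
entrywise derivative of the matrix of `b` plus its commutator with `θ`. Multiplied by the matrix of
`b₀`, which commutes with that of `b`, this commutator has trace zero. -/
theorem trace_mul_derivation {κ : Type*} [Fintype κ] [DecidableEq κ] (e : Module.Basis κ F L)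
    (D : Derivation R L L) (δ : F → F) (hδ : ∀ x, D (algebraMap F L x) = algebraMap F L (δ x))
    (b₀ b : L) : Algebra.trace F L (b₀ * D b) =
      (Algebra.leftMulMatrix e b₀ * (Algebra.leftMulMatrix e b).map δ).trace := by
  let θ : Matrix κ κ F := Matrix.of fun i j ↦ e.repr (D (e j)) i
  have hsmul (x : F) (y : L) : D (x • y) = δ x • y + x • D y := by
    simp only [Algebra.smul_def, D.leibniz, hδ, Algebra.algebraMap_self, RingHom.id_apply]
    ring
  have key : Algebra.leftMulMatrix e (D b) + Algebra.leftMulMatrix e b * θ =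
      (Algebra.leftMulMatrix e b).map δ + θ * Algebra.leftMulMatrix e b := by
    ext i j
    have h1 : b * e j = ∑ l, Algebra.leftMulMatrix e b l j • e l := by
      refine (e.sum_repr (b * e j)).symm.trans (Finset.sum_congr rfl fun l _ ↦ ?_)
      rw [Algebra.leftMulMatrix_eq_repr_mul]
    have h2 : D (b * e j) = ∑ l, (δ (Algebra.leftMulMatrix e b l j) • e l +
        Algebra.leftMulMatrix e b l j • D (e l)) := by
      rw [h1, map_sum]
      refine Finset.sum_congr rfl fun l _ ↦ ?_
      exact hsmul _ _
    have h3 : (Algebra.leftMulMatrix e b * θ) i j = e.repr (b * D (e j)) i := by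
      have := congrFun (Algebra.leftMulMatrix_mulVec_repr e b (D (e j))) i
      rw [← this]
      rfl
    have h4 : e.repr (D (b * e j)) i = δ (Algebra.leftMulMatrix e b i j) +
        (θ * Algebra.leftMulMatrix e b) i j := by
      rw [h2, Finset.sum_add_distrib, map_add, Finsupp.add_apply]
      congr 1
      · simp [Finsupp.single_apply]
      · simp [θ, Matrix.mul_apply, mul_comm, Finsupp.finsetSum_apply]
    rw [Matrix.add_apply, Matrix.add_apply, h3, Matrix.map_apply, ← h4, D.leibniz,
      Algebra.leftMulMatrix_eq_repr_mul, map_add, Finsupp.add_apply, add_comm]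
    simp [mul_comm]
  rw [Algebra.trace_eq_matrix_trace e, map_mul, eq_sub_of_add_eq key, mul_sub, mul_add,
    Matrix.trace_sub, Matrix.trace_add, ← mul_assoc, ← mul_assoc, Matrix.trace_mul_comm _ (Algebra.leftMulMatrix e b),
    ← mul_assoc, ← map_mul, ← map_mul, mul_comm b, add_sub_cancel_right]

/-- The derivations of `L` which preserve `F` commute with the trace. -/
theorem derivation_trace [FiniteDimensional F L] (D : Derivation R L L)
    (hD : ∀ x : F, ∃ y, D (algebraMap F L x) = algebraMap F L y) (b : L) :
    D (algebraMap F L (Algebra.trace F L b)) = algebraMap F L (Algebra.trace F L (D b)) := by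
  choose δ hδ using hD
  have hadd (x y : F) : δ (x + y) = δ x + δ y := by
    apply (algebraMap F L).injective
    simp [← hδ]
  have h := trace_mul_derivation (Module.finBasis F L) D δ hδ 1 b
  rw [one_mul, map_one, one_mul] at h
  rw [h, hδ, Algebra.trace_eq_matrix_trace (Module.finBasis F L)]
  exact congrArg _ (map_sum (AddMonoidHom.mk' δ hadd) _ _)

theorem derivation_fraction [IsDomain A] [IsFractionRing A F] (D : Derivation R L L)
    (hD : ∀ a : A, ∃ a', D (algebraMap A L a) = algebraMap A L a') (x : F) :
    ∃ y, D (algebraMap F L x) = algebraMap F L y := by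
  obtain ⟨a, s, hs, rfl⟩ := IsFractionRing.div_surjective (A := A) x
  obtain ⟨a', ha⟩ := hD a
  obtain ⟨s', hs'⟩ := hD s
  refine ⟨(algebraMap A F s) ^ (-2 : ℤ) * (algebraMap A F s * algebraMap A F a' - algebraMap A F a * algebraMap A F s'), ?_⟩
  rw [map_div₀, Derivation.leibniz_div]
  simp only [← IsScalarTower.algebraMap_apply, ha, hs', smul_eq_mul, map_mul, map_sub, map_zpow₀]
  try field_simp

/-- `Tr(b₀ db)` is regular, for `b₀`, `b` integral. -/
theorem trace_mul_derivation_mem [IsDomain A] [IsPrincipalIdealRing A] [IsFractionRing A F]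
    [FiniteDimensional F L] [Algebra.IsSeparable F L] (D : Derivation R L L)
    (hD : ∀ a : A, ∃ a', D (algebraMap A L a) = algebraMap A L a') {b₀ b : L}
    (hb₀ : IsIntegral A b₀) (hb : IsIntegral A b) :
    ∃ a : A, Algebra.trace F L (b₀ * D b) = algebraMap A F a := by
  let B := integralClosure A L
  have : FaithfulSMul A F := (faithfulSMul_iff_algebraMap_injective A F).mpr
    (IsFractionRing.injective A F)
  have : Module.IsTorsionFree A L := .trans_faithfulSMul A F L
  have : Module.Free A B := IsIntegralClosure.module_free A F L B
  have : Module.Finite A B := IsIntegralClosure.finite A F L B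
  have : IsLocalization (Algebra.algebraMapSubmonoid B (nonZeroDivisors A)) L :=
    IsIntegralClosure.isLocalization A F L B
  -- In an `A`-basis of the integral closure, the matrices of `b₀` and `b`, and the derivative of
  -- the latter, have entries in `A`, although `D b` need not be integral.
  let e := Module.Free.chooseBasis A B
  let e' := e.localizationLocalization F (nonZeroDivisors A) L
  choose δ hδ using derivation_fraction (F := F) D hD
  choose δA hδA using hD
  have hM (b : B) : Algebra.leftMulMatrix e' (b : L) = (Algebra.leftMulMatrix e b).map (algebraMap A F) :=
    (Algebra.map_leftMulMatrix_localization _ _ e b).symm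
  have hδ' (a : A) : δ (algebraMap A F a) = algebraMap A F (δA a) := by
    apply (algebraMap F L).injective
    rw [← hδ, ← IsScalarTower.algebraMap_apply, ← IsScalarTower.algebraMap_apply, hδA]
  have := trace_mul_derivation e' D δ hδ b₀ b
  rw [this, hM ⟨b₀, hb₀⟩, hM ⟨b, hb⟩]
  refine ⟨(Algebra.leftMulMatrix e ⟨b₀, hb₀⟩ * (Algebra.leftMulMatrix e ⟨b, hb⟩).map δA).trace, ?_⟩
  simp [Matrix.trace, Matrix.mul_apply, hδ']

/-- Derivations have bounded denominators on the integral closure. -/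
theorem exists_smul_derivation_isIntegral [IsDomain A] [IsNoetherianRing A] [IsIntegrallyClosed A]
    [IsFractionRing A F] [FiniteDimensional F L] [Algebra.IsSeparable F L] {ι : Type*} [Finite ι]
    (D : ι → Derivation R L L)
    (hD : ∀ j, ∀ a : A, ∃ a', D j (algebraMap A L a) = algebraMap A L a') :
    ∃ d : A, d ≠ 0 ∧ ∀ j b, IsIntegral A b → IsIntegral A (d • D j b) := by
  let B := integralClosure A L
  have : Module.Finite A B := IsIntegralClosure.finite A F L B
  have : Algebra.IsAlgebraic A L :=
    (IsFractionRing.comap_isAlgebraic_iff (A := A) (K := F) (C := L)).mpr inferInstance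
  obtain ⟨s, hs⟩ := (Module.finite_def (R := A) (M := B)).mp inferInstance
  classical
  cases nonempty_fintype ι
  -- `d` clears the denominators of the derivatives of finitely many generators; the Leibniz rule
  -- extends this to their `A`-combinations.
  obtain ⟨d, hd, hd'⟩ := exists_integral_multiples A F
    (Finset.univ.biUnion fun j ↦ s.image fun b : B ↦ D j (b : L))
  refine ⟨d, hd, fun j b hb ↦ ?_⟩
  have hbs : (⟨b, hb⟩ : B) ∈ Submodule.span A (s : Set B) := hs ▸ Submodule.mem_top
  suffices ∀ x : B, x ∈ Submodule.span A (s : Set B) → IsIntegral A (d • D j (x : L)) from this _ hbs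
  intro x hx
  induction hx using Submodule.span_induction with
  | mem x hx => exact hd' _ (Finset.mem_biUnion.mpr ⟨j, by simp, Finset.mem_image_of_mem _ hx⟩)
  | zero => simp [isIntegral_zero]
  | add x y _ _ hx hy => simpa using hx.add hy
  | smul a x _ hx =>
    obtain ⟨a', ha'⟩ := hD j a
    have : D j ((a • x : B) : L) = a • D j (x : L) + a' • (x : L) := by
      rw [Subalgebra.coe_smul]
      simp only [Algebra.smul_def, (D j).leibniz, ha', Algebra.algebraMap_self,
        RingHom.id_apply]
      ring
    rw [this, smul_add, smul_comm d a]
    exact (hx.smul a).add (IsIntegral.smul d (IsIntegral.smul a' x.2))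

end TraceDerivation

/-! ### The trace commutes with the Cartier operator. -/

section TraceCartier

variable {R A F L : Type*} [CommRing R] [CommRing A] [Field F] [Field L] [Algebra R L]
  [Algebra A F] [Algebra A L] [Algebra F L] [IsScalarTower A F L]

/-- The trace is the sum of the conjugates, and Frobenius is additive. -/
theorem trace_pow_char [FiniteDimensional F L] [Algebra.IsSeparable F L] (p : ℕ)
    [Fact p.Prime] [CharP F p] (x : L) :
    Algebra.trace F L (x ^ p) = Algebra.trace F L x ^ p := by
  apply (algebraMap F (AlgebraicClosure F)).injective
  have : CharP (AlgebraicClosure F) p := charP_of_injective_algebraMap (algebraMap F _).injective p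
  rw [map_pow (algebraMap F (AlgebraicClosure F)), trace_eq_sum_embeddings (AlgebraicClosure F),
    trace_eq_sum_embeddings (AlgebraicClosure F), sum_pow_char]
  simp only [map_pow]

/-- Descent on `n`: the Cartier operator sends the form with exponents from `pⁿ⁺¹` to the `p`-th
power of the one with exponents from `pⁿ`, up to sign. It commutes with the trace and preserves `A`,
so the `p`-th power of the next trace lies in `A`, which is integrally closed. -/
theorem trace_jac_mem_of_pow [IsDomain A] [IsIntegrallyClosed A]
    [IsFractionRing A F] [FiniteDimensional F L] [Algebra.IsSeparable F L] {ι : Type*} [Fintype ι]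
    [DecidableEq ι] {D : ι → Derivation R L L} {z : ι → L} (p : ℕ) [hp : Fact p.Prime] [CharP L p]
    (hDz : ∀ i j, D i (z j) = if i = j then 1 else 0)
    (hcomm : ∀ i j x, D i (D j x) = D j (D i x))
    (hgen : ∀ S : Subfield L, (∀ x, x ^ p ∈ S) → (∀ i, z i ∈ S) → S = ⊤)
    (hD : ∀ j, ∀ a : A, ∃ a', D j (algebraMap A L a) = algebraMap A L a')
    (b₀ : L) (b : ι → L) (n : ℕ)
    (h : ∃ a : A, Algebra.trace F L (b₀ ^ p ^ n * (∏ i, b i ^ (p ^ n - 1)) * jac D b) =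
      algebraMap A F a) :
    ∃ a : A, Algebra.trace F L (b₀ * jac D b) = algebraMap A F a := by
  have : CharP F p := (RingHom.charP_iff (algebraMap F L) (algebraMap F L).injective p).mpr ‹_›
  induction n with
  | zero => simpa using h
  | succ n ih =>
    refine ih ?_
    set T := b₀ ^ p ^ n * (∏ i, b i ^ (p ^ n - 1)) * jac D b with hT
    have hpn : p ^ (n + 1) - 1 = (p ^ n - 1) * p + (p - 1) := by
      have h1 := hp.out.pos
      have h2 : 1 ≤ p ^ n := Nat.one_le_pow _ _ h1
      zify [h1, h2, Nat.one_le_pow (n + 1) _ h1]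
      ring
    have h1 : cartierOp p D Finset.univ.toList
        (b₀ ^ p ^ (n + 1) * (∏ i, b i ^ (p ^ (n + 1) - 1)) * jac D b) =
        (-1) ^ Fintype.card ι * T ^ p := by
      have : b₀ ^ p ^ (n + 1) * (∏ i, b i ^ (p ^ (n + 1) - 1)) * jac D b =
          (b₀ ^ p ^ n * ∏ i, b i ^ (p ^ n - 1)) ^ p * ((∏ i, b i ^ (p - 1)) * jac D b) := by
        rw [hpn]
        simp only [pow_add, pow_mul, Finset.prod_mul_distrib, Finset.prod_pow, pow_succ, mul_pow]
        ring
      rw [this, cartierOp_const_mul p fun j ↦ derivation_pow_char p _ _,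
        cartierOp_jac p hDz hcomm hgen, hT]
      ring
    obtain ⟨a, ha⟩ := h
    let E : L →+ L := (algebraMap F L).toAddMonoidHom.comp (Algebra.trace F L).toAddMonoidHom
    have h2 := cartierOp_comm (D := D) p E (fun j x ↦ (derivation_trace (D j)
      (derivation_fraction (D j) (hD j)) x).symm) Finset.univ.toList
      (b₀ ^ p ^ (n + 1) * (∏ i, b i ^ (p ^ (n + 1) - 1)) * jac D b)
    rw [h1] at h2
    have h3 : E (b₀ ^ p ^ (n + 1) * (∏ i, b i ^ (p ^ (n + 1) - 1)) * jac D b) =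
        algebraMap A L a := (congrArg _ ha).trans (IsScalarTower.algebraMap_apply A F L a).symm
    obtain ⟨a', ha'⟩ := cartierOp_mem (p := p) (D := D) (S := Set.range (algebraMap A L))
      (by rintro j _ ⟨x, rfl⟩; exact (hD j x).imp fun _ h ↦ h.symm) Finset.univ.toList ⟨a, rfl⟩
    have h4 : algebraMap A F a' = (-1) ^ Fintype.card ι * Algebra.trace F L T ^ p := by
      apply (algebraMap F L).injective
      rw [← IsScalarTower.algebraMap_apply, ha', ← h3, ← h2, ← trace_pow_char]
      rcases (Fintype.card ι).even_or_odd with h | h <;> simp [h.neg_one_pow, E]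
    have h5 : IsIntegral A (Algebra.trace F L T ^ p) := by
      refine ⟨Polynomial.X - Polynomial.C ((-1) ^ Fintype.card ι * a'), Polynomial.monic_X_sub_C _, ?_⟩
      rw [Polynomial.eval₂_sub, Polynomial.eval₂_X, Polynomial.eval₂_C,
        (algebraMap A F).map_mul, h4, ← mul_assoc, (algebraMap A F).map_pow, map_neg, map_one,
        ← mul_pow, neg_one_mul, neg_neg, one_pow, one_mul, sub_self]
    obtain ⟨c, hc⟩ := IsIntegrallyClosed.isIntegral_iff.mp (IsIntegral.of_pow hp.out.pos h5)
    exact ⟨c, hc.symm⟩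

end TraceCartier

end SepRuled

namespace SepRuled

/-! ### Relations among differentials at a maximal ideal. -/

section PiDerivation

variable {k B L ι : Type*} [CommRing k] [CommRing B] [CommRing L] [Algebra k B] [Algebra k L]
  [Algebra B L] [IsScalarTower k B L]

/-- The derivation `b ↦ (D_j b)_j`. -/
def derivationPi (B : Type*) [CommRing B] [Algebra k B] [Algebra B L] [IsScalarTower k B L]
    (D : ι → Derivation k L L) : Derivation k B (ι → L) where
  toFun b j := D j (algebraMap B L b)
  map_add' _ _ := by ext; simp
  map_smul' c x := by
    ext
    simp [Algebra.smul_def, ← IsScalarTower.algebraMap_apply, Derivation.leibniz]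
  map_one_eq_zero' := by
    ext
    simp
  leibniz' a b := by
    ext
    simp [Derivation.leibniz, Algebra.smul_def]

theorem derivationPi_apply (D : ι → Derivation k L L) (b : B) (j : ι) :
    derivationPi B D b j = D j (algebraMap B L b) := rfl

/-- Conormal sequence `m/m² → Ω_B ⊗ B/m → Ω_{B/m} → 0`: a relation among differentials in the
residue field lifts to one modulo differentials of elements of `m`. The error terms `r dy` with `r ∈
m` are of this kind too, as `r dy = d(r y) - y dr`. -/
theorem exists_sum_smul_derivationPi_mem (D : ι → Derivation k L L) (m : Ideal B) [m.IsMaximal]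
    (b : ι → B) [Fintype ι] (hb : ¬ LinearIndependent (B ⧸ m)
      (fun i ↦ KaehlerDifferential.D k (B ⧸ m) (Ideal.Quotient.mk m (b i)))) :
    ∃ c : ι → B, ∃ i, c i ∉ m ∧ ∑ l, c l • derivationPi B D (b l) ∈
      Submodule.span B (derivationPi B D '' m) := by
  obtain ⟨g, hg, i, hi⟩ := Fintype.not_linearIndependent_iff.mp hb
  choose c hc using fun l ↦ Ideal.Quotient.mk_surjective (g l)
  refine ⟨c, i, fun h ↦ hi (by rw [← hc, Ideal.Quotient.eq_zero_iff_mem.mpr h]), ?_⟩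
  have h1 : ((1 : B ⧸ m) ⊗ₜ[B] ∑ l, c l • KaehlerDifferential.D k B (b l)) ∈
      LinearMap.range (KaehlerDifferential.kerCotangentToTensor k B (B ⧸ m)) := by
    rw [KaehlerDifferential.range_kerCotangentToTensor k B (B ⧸ m) Ideal.Quotient.mk_surjective]
    simp only [Submodule.restrictScalars_mem, LinearMap.mem_ker]
    rw [KaehlerDifferential.mapBaseChange_tmul, one_smul, map_sum, ← hg]
    refine Finset.sum_congr rfl fun l _ ↦ ?_
    rw [map_smul, KaehlerDifferential.map_D, ← hc]
    exact (algebraMap_smul (B ⧸ m) (c l) _).symm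
  obtain ⟨y, hy⟩ := h1
  obtain ⟨x, rfl⟩ := Ideal.toCotangent_surjective _ y
  rw [KaehlerDifferential.kerCotangentToTensor_toCotangent] at hy
  have hx : (x : B) ∈ m := Ideal.Quotient.eq_zero_iff_mem.mp x.2
  have h2 : (∑ l, c l • KaehlerDifferential.D k B (b l)) - KaehlerDifferential.D k B (x : B) ∈
      (m • ⊤ : Submodule B (Ω[B⁄k])) := by
    rw [← Submodule.Quotient.mk_eq_zero]
    have h3 (w : Ω[B⁄k]) : TensorProduct.quotTensorEquivQuotSMul (Ω[B⁄k]) m (1 ⊗ₜ w) =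
        Submodule.Quotient.mk w := by
      have := TensorProduct.quotTensorEquivQuotSMul_mk_tmul m 1 w
      rwa [one_smul] at this
    rw [← h3, TensorProduct.tmul_sub, hy, sub_self, map_zero]
  have h3 (w) (hw : w ∈ (m • ⊤ : Submodule B (Ω[B⁄k]))) :
      (derivationPi B D).liftKaehlerDifferential w ∈
        Submodule.span B (derivationPi B D '' m) := by
    refine Submodule.smul_induction_on hw (fun r hr n _ ↦ ?_) (fun _ _ h h' ↦ ?_)
    · have hn : n ∈ Submodule.span B (Set.range (KaehlerDifferential.D k B)) := by
        rw [KaehlerDifferential.span_range_derivation]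
        trivial
      rw [map_smul]
      induction hn using Submodule.span_induction with
      | mem x hx =>
        obtain ⟨y, rfl⟩ := hx
        rw [Derivation.liftKaehlerDifferential_comp_D]
        have := (derivationPi B D).leibniz r y
        rw [eq_sub_of_add_eq this.symm]
        exact sub_mem (Submodule.subset_span ⟨_, m.mul_mem_right _ hr, rfl⟩)
          (Submodule.smul_mem _ _ (Submodule.subset_span ⟨_, hr, rfl⟩))
      | zero => simp
      | add x y _ _ hx hy => rw [map_add, smul_add]; exact add_mem (hx trivial) (hy trivial)
      | smul a x _ hx => rw [map_smul, smul_comm]; exact Submodule.smul_mem _ _ (hx trivial)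
    · rw [map_add]; exact add_mem h h'
  have h4 := h3 _ h2
  rw [map_sub, map_sum, Derivation.liftKaehlerDifferential_comp_D] at h4
  simp only [map_smul, Derivation.liftKaehlerDifferential_comp_D] at h4
  have h5 := add_mem h4 (Submodule.subset_span (s := derivationPi B D '' m) ⟨_, hx, rfl⟩)
  rwa [sub_add_cancel] at h5

end PiDerivation

/-! ### Local regularity of the trace: absence of denominators, and positive characteristic. -/

section LocalTrace

theorem exists_trace_eq {A F L : Type*} [CommRing A] [IsDomain A] [IsIntegrallyClosed A] [Field F]
    [Field L] [Algebra A F] [Algebra A L] [Algebra F L] [IsScalarTower A F L] [IsFractionRing A F]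
    [FiniteDimensional F L] {x : L} (hx : IsIntegral A x) :
    ∃ a : A, Algebra.trace F L x = algebraMap A F a := by
  obtain ⟨c, hc⟩ := IsIntegrallyClosed.isIntegral_iff.mp (Algebra.isIntegral_trace (L := F) hx)
  exact ⟨c, hc.symm⟩

theorem isIntegral_smul_jac {k A L ι : Type*} [CommRing k] [CommRing A] [CommRing L] [Algebra k L]
    [Algebra A L] [Fintype ι] [DecidableEq ι] {D : ι → Derivation k L L} {d : A}
    (hd : ∀ j b, IsIntegral A b → IsIntegral A (d • D j b)) {b : ι → L}
    (hb : ∀ i, IsIntegral A (b i)) : IsIntegral A (d ^ Fintype.card ι • jac D b) := by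
  have : d ^ Fintype.card ι • jac D b = (Matrix.of fun r j ↦ d • D j (b r)).det := by
    simp only [Algebra.smul_def, map_pow]
    rw [jac, ← Matrix.det_smul]
    rfl
  rw [this]
  exact IsIntegral.det fun r j ↦ hd _ _ (hb _)

/-- Write `(d) = mᵉ I` with `I` not divisible by `m`, and take `c ∈ I` outside `m`. -/
theorem exists_pow_mul_mem_span {B : Type*} [CommRing B] [IsDedekindDomain B] (m : Ideal B) [m.IsMaximal]
    {d : B} (hd : d ≠ 0) (hdm : d ∈ m) : ∃ c ∉ m, ∃ e : ℕ, ∀ x ∈ m, d ∣ (c * x) ^ e := by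
  have hm0 : m ≠ ⊥ := fun h ↦ hd (by simpa [h] using hdm)
  have hprime : Prime m := Ideal.prime_of_isPrime hm0 inferInstance
  have hfin : FiniteMultiplicity m (Ideal.span {d}) :=
    FiniteMultiplicity.of_prime_left hprime (by simpa using hd)
  obtain ⟨I, hI, hmI⟩ := hfin.exists_eq_pow_mul_and_not_dvd
  rw [Ideal.dvd_iff_le, SetLike.not_le_iff_exists] at hmI
  obtain ⟨c, hcI, hcm⟩ := hmI
  refine ⟨c, hcm, multiplicity m (Ideal.span {d}), fun x hx ↦ ?_⟩
  -- `e > 0` because `d ∈ m`; this is needed for `cᵉ ∈ I`.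
  have he : multiplicity m (Ideal.span {d}) ≠ 0 := by
    intro h
    have := multiplicity_eq_zero.mp h
    exact this (Ideal.dvd_iff_le.mpr (by simpa [Ideal.span_le] using hdm))
  rw [← Ideal.mem_span_singleton]
  refine hI.symm.le ?_
  rw [mul_pow, mul_comm (c ^ _)]
  exact Ideal.mul_mem_mul (Ideal.pow_mem_pow hx _) (Ideal.pow_mem_of_mem _ hcI _ (Nat.pos_of_ne_zero he))

variable {k A B F L : Type*} [Field k] [CommRing A] [CommRing B] [Field F] [Field L] [Algebra k B]
  [Algebra k L] [Algebra A B] [Algebra B L] [IsScalarTower k B L] [Algebra A F] [Algebra A L]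
  [Algebra F L] [IsScalarTower A F L] [IsScalarTower A B L] [IsDomain A] [IsPrincipalIdealRing A]
  [IsFractionRing A F] [FiniteDimensional F L] [Algebra.IsSeparable F L] [IsIntegralClosure B A L]
  {ι : Type*} [Fintype ι] [DecidableEq ι]

variable (F) in
omit [Algebra k B] [IsScalarTower k B L] [Algebra.IsSeparable F L] in
-- Where `d` is a unit the derivations have no poles: `d ^ card ι` times the Jacobian is integral,
-- and traces of integral elements lie in `A`.
theorem exists_notMem_trace_of_notMem {D : ι → Derivation k L L} {d : A}
    (hd : ∀ j b, IsIntegral A b → IsIntegral A (d • D j b)) (m : Ideal B) [m.IsMaximal]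
    (hdm : algebraMap A B d ∉ m) (b : ι → B) :
    ∃ c ∉ m, ∀ b₀ : B, ∃ a : A, Algebra.trace F L
      (algebraMap B L c * algebraMap B L b₀ * jac D fun i ↦ algebraMap B L (b i)) =
        algebraMap A F a := by
  have hint (x : B) : IsIntegral A (algebraMap B L x) := IsIntegralClosure.isIntegral A L x |>.algebraMap
  refine ⟨algebraMap A B d ^ Fintype.card ι, fun h ↦ hdm (Ideal.IsPrime.mem_of_pow_mem inferInstance _ h),
    fun b₀ ↦ exists_trace_eq ?_⟩
  have := (hint b₀).mul (isIntegral_smul_jac hd fun i ↦ hint (b i))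
  rw [Algebra.smul_def, map_pow] at this
  rw [map_pow, ← IsScalarTower.algebraMap_apply]
  rwa [mul_left_comm, ← mul_assoc] at this

variable (F) in
-- Dependence at `m` allows row `i` to be replaced, up to a factor outside `m`, by a combination of
-- rows `dx` with `x ∈ m`. For such a Jacobian the exponents `pᴺ - 1` of `trace_jac_mem_of_pow`
-- supply a high power of `x`, which absorbs the denominators of the derivations when `N` is large.
theorem exists_notMem_trace_of_char [IsDedekindDomain B] {D : ι → Derivation k L L} {z : ι → L}
    (p : ℕ) [hp : Fact p.Prime] [CharP L p] (hDz : ∀ i j, D i (z j) = if i = j then 1 else 0)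
    (hcomm : ∀ i j x, D i (D j x) = D j (D i x))
    (hgen : ∀ S : Subfield L, (∀ x, x ^ p ∈ S) → (∀ i, z i ∈ S) → S = ⊤)
    (hD : ∀ j, ∀ a : A, ∃ a', D j (algebraMap A L a) = algebraMap A L a') {d : A} (hd0 : d ≠ 0)
    (hd : ∀ j b, IsIntegral A b → IsIntegral A (d • D j b)) (m : Ideal B) [m.IsMaximal]
    (hdm : algebraMap A B d ∈ m) (b : ι → B) (hb : ¬ LinearIndependent (B ⧸ m)
      (fun i ↦ KaehlerDifferential.D k (B ⧸ m) (Ideal.Quotient.mk m (b i)))) :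
    ∃ c ∉ m, ∀ b₀ : B, ∃ a : A, Algebra.trace F L
      (algebraMap B L c * algebraMap B L b₀ * jac D fun i ↦ algebraMap B L (b i)) =
        algebraMap A F a := by
  have hint (x : B) : IsIntegral A (algebraMap B L x) := IsIntegralClosure.isIntegral A L x |>.algebraMap
  have hAL : Function.Injective (algebraMap A L) := by
    rw [IsScalarTower.algebraMap_eq A F L]
    exact (algebraMap F L).injective.comp (IsFractionRing.injective A F)
  have hdB : algebraMap A B d ≠ 0 := by
    intro h
    apply hd0
    apply hAL
    rw [IsScalarTower.algebraMap_apply A B L, h, map_zero, map_zero]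
  obtain ⟨c, i, hci, hc⟩ := exists_sum_smul_derivationPi_mem D m b hb
  obtain ⟨c₀, hc₀, e, he⟩ := exists_pow_mul_mem_span m hdB hdm
  refine ⟨c₀ * c i, fun h ↦ (Ideal.IsPrime.mem_or_mem inferInstance h).elim hc₀ hci, fun b₀ ↦ ?_⟩
  let bL (i : ι) : L := algebraMap B L (b i)
  -- the Jacobian with one entry in `m`
  have hx (x : B) (hx : x ∈ m) (b₀ : B) : ∃ a : A, Algebra.trace F L (algebraMap B L (c₀ * b₀) *
      jac D (Function.update bL i (algebraMap B L x))) = algebraMap A F a := by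
    -- Each `e` factors `c₀ x` yield one factor `d`, and the Jacobian needs `card ι` of them.
    obtain ⟨N, hN⟩ : ∃ N, e * Fintype.card ι ≤ p ^ N - 1 := by
      obtain ⟨N, hN⟩ := pow_unbounded_of_one_lt (e * Fintype.card ι) hp.out.one_lt
      exact ⟨N, by omega⟩
    refine trace_jac_mem_of_pow p hDz hcomm hgen hD _ _ N (exists_trace_eq ?_)
    obtain ⟨y, hy⟩ := he x hx
    set b' := Function.update bL i (algebraMap B L x)
    have hb' (l) : IsIntegral A (b' l) := by
      by_cases h : l = i
      · subst h; simp only [b', Function.update_self]; exact hint x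
      · simp only [b', Function.update_of_ne h]; exact hint _
    have h1 : algebraMap B L (c₀ * b₀) ^ p ^ N * (∏ l, b' l ^ (p ^ N - 1)) * jac D b' =
        (algebraMap B L (c₀ * b₀) * algebraMap B L b₀ ^ (p ^ N - 1) *
          (∏ l ∈ Finset.univ.erase i, b' l ^ (p ^ N - 1)) *
          algebraMap B L (c₀ * x) ^ (p ^ N - 1 - e * Fintype.card ι) *
          algebraMap B L y ^ Fintype.card ι) * (d ^ Fintype.card ι • jac D b') := by
      have h2 : p ^ N = (p ^ N - 1) + 1 := by
        have := Nat.one_le_pow N p hp.out.pos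
        omega
      have h3 : algebraMap B L (c₀ * x) ^ (p ^ N - 1) =
          algebraMap B L (c₀ * x) ^ (p ^ N - 1 - e * Fintype.card ι) *
          (algebraMap A L d ^ Fintype.card ι * algebraMap B L y ^ Fintype.card ι) := by
        conv_lhs => rw [← Nat.sub_add_cancel hN, pow_add, pow_mul, ← map_pow _ _ e, hy, map_mul _ _ y, mul_pow,
          ← IsScalarTower.algebraMap_apply]
      have h4 : b' i = algebraMap B L x := Function.update_self ..
      have h5 : algebraMap B L (c₀ * b₀) ^ p ^ N = algebraMap B L (c₀ * b₀) *
          algebraMap B L b₀ ^ (p ^ N - 1) * algebraMap B L c₀ ^ (p ^ N - 1) := by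
        conv_lhs => rw [h2, pow_succ]
        simp only [map_mul, mul_pow]
        ring
      rw [← Finset.mul_prod_erase _ _ (Finset.mem_univ i), h4, h5, Algebra.smul_def, map_pow]
      calc _ = algebraMap B L (c₀ * b₀) * algebraMap B L b₀ ^ (p ^ N - 1) *
          (∏ l ∈ Finset.univ.erase i, b' l ^ (p ^ N - 1)) *
            algebraMap B L (c₀ * x) ^ (p ^ N - 1) * jac D b' := by
              rw [map_mul _ c₀ x, mul_pow]; ring
        _ = _ := by rw [h3]; ring
    rw [h1]
    refine IsIntegral.mul (IsIntegral.mul (IsIntegral.mul (IsIntegral.mul (IsIntegral.mul ?_ ?_)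
      ?_) ?_) ?_) (isIntegral_smul_jac hd hb')
    · exact hint _
    · exact (hint _).pow _
    · exact IsIntegral.prod _ fun l _ ↦ (hb' l).pow _
    · exact (hint _).pow _
    · exact (hint _).pow _
  let M : Matrix ι ι L := Matrix.of fun r j ↦ D j (bL r)
  have hM (x : B) : (M.updateRow i (derivationPi B D x)).det =
      jac D (Function.update bL i (algebraMap B L x)) := by
    refine congrArg Matrix.det ?_
    ext r j
    by_cases h : r = i
    · subst h; simp [derivationPi_apply]
    · simp [h, M]
  have hspan (v) (hv : v ∈ Submodule.span B (derivationPi B D '' m)) (b₀ : B) :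
      ∃ a : A, Algebra.trace F L (algebraMap B L (c₀ * b₀) * (M.updateRow i v).det) =
        algebraMap A F a := by
    induction hv using Submodule.span_induction generalizing b₀ with
    | mem v hv =>
      obtain ⟨x, hxm, rfl⟩ := hv
      rw [hM]
      exact hx x hxm b₀
    | zero =>
      refine ⟨0, ?_⟩
      rw [Matrix.det_eq_zero_of_row_eq_zero i (by simp)]
      simp
    | add v w _ _ hv hw =>
      obtain ⟨a, ha⟩ := hv b₀
      obtain ⟨a', ha'⟩ := hw b₀
      exact ⟨a + a', by rw [Matrix.det_updateRow_add, mul_add, map_add, ha, ha', map_add]⟩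
    | smul r v _ hv =>
      obtain ⟨a, ha⟩ := hv (b₀ * r)
      refine ⟨a, ?_⟩
      rw [← ha, ← algebraMap_smul L r v, Matrix.det_updateRow_smul]
      simp only [map_mul]
      congr 1
      ring
  -- The multiples of the other rows do not contribute, so only the coefficient `c i` survives.
  have hdet : (M.updateRow i (∑ l, c l • derivationPi B D (b l))).det =
      algebraMap B L (c i) * jac D bL := by
    have h1 : ∑ l, c l • derivationPi B D (b l) = ∑ l, algebraMap B L (c l) • M l := by
      refine Finset.sum_congr rfl fun l _ ↦ ?_
      rw [algebraMap_smul]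
      rfl
    rw [h1]
    exact Matrix.det_updateRow_sum M i fun l ↦ algebraMap B L (c l)
  obtain ⟨a, ha⟩ := hspan _ hc b₀
  refine ⟨a, ?_⟩
  rw [← ha, hdet, (algebraMap B L).map_mul, (algebraMap B L).map_mul]
  congr 1
  ring

end LocalTrace

end SepRuled

namespace SepRuled

/-! ### Local regularity of the trace: separable residue field. -/

section LocalTraceZero

/-- The chain rule `d f(x) = f'(x) dx`, up to the differentials of the coefficients. -/
theorem aeval_derivationPi_sub_mem {k K B L ι : Type*} [CommRing k] [CommRing K] [CommRing B]
    [CommRing L] [Algebra k B] [Algebra k L] [Algebra B L] [IsScalarTower k B L] [Algebra K B]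
    (D : ι → Derivation k L L) (x : B) (f : Polynomial K) :
    derivationPi B D (Polynomial.aeval x f) -
        Polynomial.aeval x (Polynomial.derivative f) • derivationPi B D x ∈
      Submodule.span B (Set.range fun κ : K ↦ derivationPi B D (algebraMap K B κ)) := by
  induction f using Polynomial.induction_on' with
  | add f g hf hg =>
    have := add_mem hf hg
    convert this using 1
    simp only [map_add, add_smul]
    abel
  | monomial n a =>
    rw [Polynomial.aeval_monomial, Polynomial.derivative_monomial, Polynomial.aeval_monomial,
      Derivation.leibniz, Derivation.leibniz_pow]
    have : algebraMap K B a • n • x ^ (n - 1) • derivationPi B D x +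
        x ^ n • derivationPi B D (algebraMap K B a) -
        (algebraMap K B (a * n) * x ^ (n - 1)) • derivationPi B D x =
        x ^ n • derivationPi B D (algebraMap K B a) := by
      rw [map_mul, map_natCast, mul_assoc, mul_smul, mul_smul, Nat.cast_smul_eq_nsmul]
      abel
    rw [this]
    exact Submodule.smul_mem _ _ (Submodule.subset_span ⟨a, rfl⟩)

/-- The module is contained in `d⁻¹ B^ι`. Finite generation is what Nakayama's lemma requires later.
-/
theorem fg_span_range_derivationPi {k A B L ι : Type*} [Field k] [CommRing A] [CommRing B]
    [Field L] [Algebra k B] [Algebra k L] [Algebra A B] [Algebra B L] [IsScalarTower k B L]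
    [Algebra A L] [IsScalarTower A B L] [IsIntegralClosure B A L] [Finite ι] [IsNoetherianRing B]
    (D : ι → Derivation k L L) {d : A} (hd0 : algebraMap A L d ≠ 0)
    (hd : ∀ j b, IsIntegral A b → IsIntegral A (d • D j b)) :
    (Submodule.span B (Set.range (derivationPi B D))).FG := by
  classical
  cases nonempty_fintype ι
  refine Submodule.FG.of_le (T := Submodule.span B
    (Set.range fun j : ι ↦ (Pi.single j (algebraMap A L d)⁻¹ : ι → L)))
    (Submodule.fg_span (Set.finite_range _)) (Submodule.span_le.mpr ?_)
  rintro _ ⟨b, rfl⟩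
  have hb : IsIntegral A (algebraMap B L b) := (IsIntegralClosure.isIntegral A L b).algebraMap
  choose x hx using fun j ↦ IsIntegralClosure.isIntegral_iff (A := B).mp (hd j _ hb)
  have : derivationPi B D b = ∑ j, x j • (Pi.single j (algebraMap A L d)⁻¹ : ι → L) := by
    ext j
    simp only [Finset.sum_apply, Pi.smul_apply, Pi.single_apply, smul_ite, smul_zero]
    rw [Finset.sum_ite_eq Finset.univ j, if_pos (Finset.mem_univ j), Algebra.smul_def, hx,
      Algebra.smul_def, derivationPi_apply]
    field_simp
  rw [this]
  exact sum_mem fun j _ ↦ Submodule.smul_mem _ _ (Submodule.subset_span ⟨j, rfl⟩)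

/-- For `y ∈ m` write `y = u e + s` with `s ∈ m²`, so that `dy` is a multiple of `du` modulo `m`.
For general `x` let `f` be the minimal polynomial over `K` of its residue: `f(x) ∈ m`, while `f'(x)`
is invertible modulo `m` by separability, so the chain rule expresses `dx`. -/
theorem range_derivationPi_le {k K B L ι : Type*} [Field k] [Field K] [CommRing B]
    [IsDedekindDomain B] [Field L] [Algebra k B] [Algebra k L] [Algebra B L] [IsScalarTower k B L]
    [Algebra K B] (D : ι → Derivation k L L) (m : Ideal B) [m.IsMaximal]
    [Algebra.IsSeparable K (B ⧸ m)] {u : B} (hu : u ∈ m) (hu2 : u ∉ m ^ 2) :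
    Submodule.span B (Set.range (derivationPi B D)) ≤
      (Submodule.span B (Set.range fun κ : K ↦ derivationPi B D (algebraMap K B κ)) ⊔
        Submodule.span B {derivationPi B D u}) ⊔
      m • Submodule.span B (Set.range (derivationPi B D)) := by
  set N := Submodule.span B (Set.range (derivationPi B D))
  set NK := Submodule.span B (Set.range fun κ : K ↦ derivationPi B D (algebraMap K B κ))
  set S := (NK ⊔ Submodule.span B {derivationPi B D u}) ⊔ m • N
  have hN (x) : derivationPi B D x ∈ N := Submodule.subset_span ⟨x, rfl⟩
  have hS (r : B) (hr : r ∈ m) (x : B) : r • derivationPi B D x ∈ S :=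
    Submodule.mem_sup_right (Submodule.smul_mem_smul hr (hN x))
  have hm0 : m ≠ ⊥ := by
    rintro rfl
    apply hu2
    rw [Ideal.mem_bot.mp hu]
    exact zero_mem _
  have hm (y : B) (hy : y ∈ m) : derivationPi B D y ∈ S := by
    obtain ⟨e, s, hs, rfl⟩ := Ideal.exists_mul_add_mem_pow_succ (P := m) (i := 1) hm0 u y
      (by simpa using hu) hu2 (by simpa using hy)
    rw [map_add, Derivation.leibniz]
    refine add_mem (add_mem (hS _ hu _) (Submodule.smul_mem _ _ (Submodule.mem_sup_left
      (Submodule.mem_sup_right (Submodule.mem_span_singleton_self _))))) ?_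
    rw [show 1 + 1 = 2 from rfl, pow_two] at hs
    refine Submodule.mul_induction_on hs (fun a ha b hb ↦ ?_) fun a b ha hb ↦ ?_
    · rw [Derivation.leibniz]
      exact add_mem (hS _ ha _) (hS _ hb _)
    · rw [map_add]
      exact add_mem ha hb
  refine Submodule.span_le.mpr ?_
  rintro _ ⟨x, rfl⟩
  have hsep := Algebra.IsSeparable.isSeparable K (Ideal.Quotient.mk m x)
  set f := minpoly K (Ideal.Quotient.mk m x)
  have hmk (g : Polynomial K) : Ideal.Quotient.mk m (Polynomial.aeval x g) =
      Polynomial.aeval (Ideal.Quotient.mk m x) g := by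
    exact (Polynomial.aeval_algHom_apply (Ideal.Quotient.mkₐ K m) x g).symm
  have h1 : Polynomial.aeval x f ∈ m := by
    rw [← Ideal.Quotient.eq_zero_iff_mem, hmk, minpoly.aeval]
  have h2 : Ideal.Quotient.mk m (Polynomial.aeval x (Polynomial.derivative f)) ≠ 0 := by
    rw [hmk]
    exact hsep.aeval_derivative_ne_zero (minpoly.aeval _ _)
  have h3 : Polynomial.aeval x (Polynomial.derivative f) • derivationPi B D x ∈ S := by
    have := sub_mem (hm _ h1) (Submodule.mem_sup_left (Submodule.mem_sup_left
      (aeval_derivationPi_sub_mem D x f)) :  _ ∈ S)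
    rwa [sub_sub_cancel] at this
  let _ := Ideal.Quotient.field m
  obtain ⟨g, hg⟩ := Ideal.Quotient.mk_surjective
    (Ideal.Quotient.mk m (Polynomial.aeval x (Polynomial.derivative f)))⁻¹
  have h4 : g * Polynomial.aeval x (Polynomial.derivative f) - 1 ∈ m := by
    rw [← Ideal.Quotient.eq_zero_iff_mem, map_sub, map_mul, hg, map_one, inv_mul_cancel₀ h2,
      sub_self]
  have h5 := sub_mem (S.smul_mem g h3) (hS _ h4 x)
  rwa [sub_smul, one_smul, mul_smul, sub_sub_cancel] at h5

/-- As column `t` of `w` is zero, the matrix is the product of `w` with column `t` replaced by `β`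
and the identity with row `t` replaced by `g`. -/
theorem det_add_mul_eq {L ι : Type*} [CommRing L] [Fintype ι] [DecidableEq ι] (t : ι)
    (w : ι → ι → L) (hw : ∀ r, w r t = 0) (β g : ι → L) :
    (Matrix.of fun r j ↦ w r j + β r * g j).det =
      g t * ((Matrix.of w).updateCol t β).det := by
  have h1 : (Matrix.of fun r j ↦ w r j + β r * g j) =
      (Matrix.of w).updateCol t β * (1 : Matrix ι ι L).updateRow t g := by
    ext r j
    rw [Matrix.mul_apply, ← Finset.add_sum_erase _ _ (Finset.mem_univ t)]
    rw [Matrix.updateCol_self, Matrix.updateRow_self, Matrix.of_apply, add_comm]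
    congr 1
    rw [Finset.sum_congr rfl fun l hl ↦ by
      rw [Matrix.updateCol_ne (Finset.ne_of_mem_erase hl),
        Matrix.updateRow_ne (Finset.ne_of_mem_erase hl), Matrix.of_apply, Matrix.one_apply,
        mul_ite, mul_one, mul_zero]]
    rw [Finset.sum_ite_eq']
    by_cases h : j = t
    · subst h; simp [hw]
    · simp [h]
  have h2 : ((1 : Matrix ι ι L).updateRow t g).det = g t := by
    rw [det_updateRow_eq_sum, Finset.sum_congr rfl fun j _ ↦ by
      rw [← Matrix.adjugate_apply, Matrix.adjugate_one, Matrix.one_apply, mul_ite, mul_one,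
        mul_zero]]
    simp
  rw [h1, Matrix.det_mul, h2, mul_comm]

variable {k K A B F L : Type*} [Field k] [Field K] [CommRing A] [CommRing B] [Field F] [Field L]
  [Algebra k L] [Algebra A B] [Algebra B L] [Algebra k B] [IsScalarTower k B L] [Algebra A F]
  [Algebra A L] [Algebra K B] [Algebra K L] [IsScalarTower K B L]
  [Algebra F L] [IsScalarTower A F L] [IsScalarTower A B L] [IsDomain A] [IsPrincipalIdealRing A]
  [IsFractionRing A F] [FiniteDimensional F L] [Algebra.IsSeparable F L] [IsIntegralClosure B A L]
  {ι : Type*} [Fintype ι] [DecidableEq ι]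

variable (K F) in
-- Near `m` every row is a combination of rows `dκ`, `κ ∈ K`, and of `du`. The former have entries
-- in `B` and a zero in column `t`, because `D t` kills `K`. So the Jacobian is `D t u` times an
-- element of `B`, to which `trace_mul_derivation_mem` applies.
theorem exists_notMem_trace_of_isSeparable [IsDedekindDomain B] {D : ι → Derivation k L L}
    (t : ι) (hDt : ∀ κ : K, D t (algebraMap K L κ) = 0)
    (hDK : ∀ j, ∀ κ : K, ∃ κ', D j (algebraMap K L κ) = algebraMap K L κ')
    (hD : ∀ j, ∀ a : A, ∃ a', D j (algebraMap A L a) = algebraMap A L a') {d : A} (hd0 : d ≠ 0)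
    (hd : ∀ j b, IsIntegral A b → IsIntegral A (d • D j b)) (m : Ideal B) [m.IsMaximal]
    (hm0 : m ≠ ⊥) [Algebra.IsSeparable K (B ⧸ m)] (b : ι → B) :
    ∃ c ∉ m, ∀ b₀ : B, ∃ a : A, Algebra.trace F L
      (algebraMap B L c * algebraMap B L b₀ * jac D fun i ↦ algebraMap B L (b i)) =
        algebraMap A F a := by
  have hint (x : B) : IsIntegral A (algebraMap B L x) := (IsIntegralClosure.isIntegral A L x).algebraMap
  have hAL : Function.Injective (algebraMap A L) := by
    rw [IsScalarTower.algebraMap_eq A F L]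
    exact (algebraMap F L).injective.comp (IsFractionRing.injective A F)
  have hdL : algebraMap A L d ≠ 0 := fun h ↦ hd0 (hAL (h.trans (map_zero _).symm))
  obtain ⟨u, hu, hu2⟩ := Ideal.exists_mem_pow_notMem_pow_succ m hm0 (Ideal.IsPrime.ne_top inferInstance) 1
  rw [pow_one] at hu
  -- Nakayama's lemma, with `r ≡ 1` modulo `m` in place of localization at `m`.
  obtain ⟨r, hr, hrN⟩ := Submodule.exists_sub_one_mem_and_smul_le_of_fg_of_le_sup
    (fg_span_range_derivationPi D hdL hd) le_rfl (range_derivationPi_le (K := K) D m hu hu2)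
  have hrm : r ∉ m := fun h ↦ (Ideal.ne_top_iff_one m).mp (Ideal.IsPrime.ne_top inferInstance)
    (by simpa using m.sub_mem h hr)
  refine ⟨r ^ Fintype.card ι, fun h ↦ hrm (Ideal.IsPrime.mem_of_pow_mem inferInstance _ h), fun b₀ ↦ ?_⟩
  have hrow (l : ι) : ∃ W : ι → B, W t = 0 ∧ ∃ β : B, ∀ j, algebraMap B L r * D j (algebraMap B L (b l)) =
      algebraMap B L (W j) + algebraMap B L β * D j (algebraMap B L u) := by
    have h1 := hrN <| Submodule.smul_mem_pointwise_smul (derivationPi B D (b l)) r _ (Submodule.subset_span ⟨_, rfl⟩)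
    obtain ⟨w, hw, v, hv, hwv⟩ := Submodule.mem_sup.mp h1
    obtain ⟨β, rfl⟩ := Submodule.mem_span_singleton.mp hv
    obtain ⟨W, hW, hW'⟩ : ∃ W : ι → B, W t = 0 ∧ ∀ j, w j = algebraMap B L (W j) := by
      clear * - hw hDt hDK
      induction hw using Submodule.span_induction with
      | mem w hw =>
        obtain ⟨κ, rfl⟩ := hw
        choose κ' hκ' using fun j ↦ hDK j κ
        have hj (j) : derivationPi B D (algebraMap K B κ) j = algebraMap K L (κ' j) := by
          rw [derivationPi_apply, ← IsScalarTower.algebraMap_apply, hκ']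
        refine ⟨fun j ↦ algebraMap K B (κ' j), ?_, fun j ↦ ?_⟩
        · have h0 : κ' t = 0 := (algebraMap K L).injective (by rw [← hκ', hDt, map_zero])
          simp [h0]
        · exact (hj j).trans (IsScalarTower.algebraMap_apply K B L _)
      | zero => exact ⟨0, rfl, fun j ↦ by simp⟩
      | add w w' _ _ h h' =>
        obtain ⟨W, hW, hW'⟩ := h
        obtain ⟨V, hV, hV'⟩ := h'
        exact ⟨W + V, by simp [hW, hV], fun j ↦ by simp [hW', hV']⟩
      | smul c w _ h =>
        obtain ⟨W, hW, hW'⟩ := h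
        exact ⟨c • W, by simp [hW], fun j ↦ by simp [hW', Algebra.smul_def]⟩
    refine ⟨W, hW, β, fun j ↦ ?_⟩
    have := congrFun hwv j
    simp only [Pi.add_apply, Pi.smul_apply, Algebra.smul_def, derivationPi_apply] at this
    rw [← hW']
    exact this.symm
  choose W hW β hβ using hrow
  have hdet : algebraMap B L (r ^ Fintype.card ι) * (jac D fun i ↦ algebraMap B L (b i)) =
      D t (algebraMap B L u) * algebraMap B L ((Matrix.of W).updateCol t β).det := by
    rw [map_pow, jac, ← Matrix.det_smul]
    have h1 := det_add_mul_eq t (fun i j ↦ algebraMap B L (W i j)) (fun i ↦ by simp [hW])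
      (fun i ↦ algebraMap B L (β i)) fun j ↦ D j (algebraMap B L u)
    rw [(algebraMap B L).map_det]
    convert h1 using 2
    · ext i j
      exact hβ i j
    · refine congrArg Matrix.det ?_
      ext i j
      simp only [RingHom.mapMatrix_apply, Matrix.map_apply, Matrix.updateCol_apply, Matrix.of_apply]
      split_ifs <;> rfl
  rw [mul_right_comm, hdet, mul_assoc, ← map_mul, mul_comm]
  exact trace_mul_derivation_mem (D t) (hD t) (hint _) (hint _)

end LocalTraceZero

end SepRuled

namespace SepRuled

/-! ### Global regularity of the trace of a Jacobian. -/

section TraceJacobian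

/-- Over a perfect field, the differentials of a finitely generated field extension form a vector
space of dimension the transcendence degree. -/
theorem not_linearIndependent_kaehlerDifferential {k K l σ ι : Type*} [Field k] [PerfectField k]
    [Field K] [Algebra k K] [Algebra.EssFiniteType k K] [Field l] [Algebra k l] [Algebra K l]
    [IsScalarTower k K l] [Algebra.FiniteType K l] [Fintype σ] [Fintype ι] {y : σ → K}
    (hy : IsTranscendenceBasis k y) (h : Fintype.card σ < Fintype.card ι) (v : ι → Ω[l⁄k]) :
    ¬ LinearIndependent l v := by
  intro hv
  -- Zariski's lemma: `l` is finite over `K`, so `y` remains a transcendence basis of `l`.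
  have : Module.Finite K l := finite_of_finite_type_of_isJacobsonRing K l
  have : Algebra.EssFiniteType k l := .comp k K l
  have hy' : IsTranscendenceBasis k (algebraMap K l ∘ y) := hy.algebraMap_comp
  obtain ⟨s, hs, hsep⟩ := exists_isTranscendenceBasis_and_isSeparable_of_perfectField k l
  obtain ⟨b, -⟩ := exists_kaehlerDifferential_basis (z := ((↑) : s → l)) hs.1
    (Eq.subst (motive := fun S : Set l ↦ Algebra.IsSeparable (IntermediateField.adjoin k S) l)
      Subtype.range_coe.symm hsep)
  have h1 := hy'.lift_cardinalMk_eq hs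
  have h2 : Fintype.card σ = Fintype.card s := by
    simpa using h1
  have h3 := hv.fintype_card_le_finrank
  rw [Module.finrank_eq_card_basis b] at h3
  omega

/-- The multipliers `c` that work for all `b₀` form an ideal, thanks to the quantifier over `b₀`. It
is contained in no maximal ideal, so `1` is a multiplier. -/
theorem mem_of_forall_exists_notMem {A B F L : Type*} [CommRing A] [CommRing B] [CommRing F]
    [CommRing L] [Algebra A F] [Algebra B L] {T : L →+ F} (w : L)
    (hT : ∀ m : Ideal B, m.IsMaximal → ∃ c ∉ m, ∀ b₀ : B, ∃ a : A,
      T (algebraMap B L c * algebraMap B L b₀ * w) = algebraMap A F a) (b₀ : B) :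
    ∃ a : A, T (algebraMap B L b₀ * w) = algebraMap A F a := by
  let I : Ideal B :=
    { carrier := {c | ∀ b₀ : B, ∃ a : A,
        T (algebraMap B L c * algebraMap B L b₀ * w) = algebraMap A F a}
      add_mem' := fun {c c'} h h' b₀ ↦ by
        obtain ⟨a, ha⟩ := h b₀
        obtain ⟨a', ha'⟩ := h' b₀
        exact ⟨a + a', by rw [map_add, map_add, add_mul, add_mul, map_add, ha, ha']⟩
      zero_mem' := fun b₀ ↦ ⟨0, by simp⟩
      smul_mem' := fun r c h b₀ ↦ by
        obtain ⟨a, ha⟩ := h (r * b₀)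
        refine ⟨a, ?_⟩
        rw [← ha, smul_eq_mul, (algebraMap B L).map_mul, (algebraMap B L).map_mul]
        congr 1
        ring }
  have hI : I = ⊤ := by
    by_contra h
    obtain ⟨m, hm, hIm⟩ := Ideal.exists_le_maximal I h
    obtain ⟨c, hc, hc'⟩ := hT m hm
    exact hc (hIm hc')
  obtain ⟨a, ha⟩ := (Ideal.eq_top_iff_one I).mp hI b₀
  exact ⟨a, by rwa [map_one, one_mul] at ha⟩

variable {k K A B F L : Type*} [Field k] [Field K] [CommRing A] [CommRing B] [Field F] [Field L]
  [Algebra k L] [Algebra A B] [Algebra B L] [Algebra k B] [IsScalarTower k B L] [Algebra A F]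
  [Algebra A L] [Algebra K B] [Algebra K L] [IsScalarTower K B L]
  [Algebra F L] [IsScalarTower A F L] [IsScalarTower A B L] [IsDomain A] [IsPrincipalIdealRing A]
  [IsFractionRing A F] [FiniteDimensional F L] [Algebra.IsSeparable F L] [IsIntegralClosure B A L]
  [Algebra k K] [IsScalarTower k K B] [Algebra.EssFiniteType k K] [PerfectField k]
  [Algebra K A] [IsScalarTower K A B] [Algebra.FiniteType K A]
  {ι : Type*} [Fintype ι] [DecidableEq ι]

variable (K F) in
-- Three cases at each `m`: no denominator; characteristic zero, where the residue field is finite,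
-- hence separable, over `K`; and characteristic `p`, where `card ι` differentials in a space of
-- dimension `card σ` are dependent.
theorem trace_jac_mem [IsDedekindDomain B] {D : ι → Derivation k L L} {z : ι → L}
    {σ : Type*} [Fintype σ] {y : σ → K} (hy : IsTranscendenceBasis k y)
    (hcard : Fintype.card σ < Fintype.card ι)
    (hDz : ∀ i j, D i (z j) = if i = j then 1 else 0)
    (hcomm : ∀ i j x, D i (D j x) = D j (D i x))
    (hgen : ∀ (p : ℕ) [Fact p.Prime] [CharP L p], ∀ S : Subfield L, (∀ x, x ^ p ∈ S) →
      (∀ i, z i ∈ S) → S = ⊤)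
    (t : ι) (hDt : ∀ κ : K, D t (algebraMap K L κ) = 0)
    (hDK : ∀ j, ∀ κ : K, ∃ κ', D j (algebraMap K L κ) = algebraMap K L κ')
    (hD : ∀ j, ∀ a : A, ∃ a', D j (algebraMap A L a) = algebraMap A L a') (b₀ : B) (b : ι → B) :
    ∃ a : A, Algebra.trace F L (algebraMap B L b₀ * jac D fun i ↦ algebraMap B L (b i)) =
      algebraMap A F a := by
  obtain ⟨d, hd0, hd⟩ := exists_smul_derivation_isIntegral (F := F) D hD
  have hAL : Function.Injective (algebraMap A L) := by
    rw [IsScalarTower.algebraMap_eq A F L]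
    exact (algebraMap F L).injective.comp (IsFractionRing.injective A F)
  have hdB : algebraMap A B d ≠ 0 := by
    intro h
    apply hd0
    apply hAL
    rw [IsScalarTower.algebraMap_apply A B L, h, map_zero, map_zero]
  have : Module.Finite A B := IsIntegralClosure.finite A F L B
  have : Algebra.FiniteType K B := .trans ‹Algebra.FiniteType K A› inferInstance
  refine mem_of_forall_exists_notMem (T := (Algebra.trace F L).toAddMonoidHom) _ (fun m hm ↦ ?_) b₀
  by_cases hdm : algebraMap A B d ∈ m
  · let _ := Ideal.Quotient.field m
    have : Algebra.FiniteType K (B ⧸ m) :=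
      .of_surjective (Ideal.Quotient.mkₐ K m) Ideal.Quotient.mk_surjective
    obtain h0 | ⟨p, hp, hpL⟩ := CharP.exists' L
    · have : CharZero K := (RingHom.charZero_iff (algebraMap K L).injective).mpr h0
      have : Module.Finite K (B ⧸ m) := finite_of_finite_type_of_isJacobsonRing K (B ⧸ m)
      exact exists_notMem_trace_of_isSeparable K F t hDt hDK hD hd0 hd m
        (fun h ↦ hdB (by simpa [h] using hdm)) b
    · exact exists_notMem_trace_of_char F p hDz hcomm (hgen p) hD hd0 hd m hdm b
        (not_linearIndependent_kaehlerDifferential hy hcard _)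
  · exact exists_notMem_trace_of_notMem F hd m hdm b

end TraceJacobian

end SepRuled

namespace SepRuled

/-! ### The module spanned by the values of forms. -/

section FormSpan

/-- Multilinearity, one row at a time; `s` is the set of rows only known to lie in the span. -/
theorem det_mem_of_forall_mem_span {R L n : Type*} [CommRing R] [CommRing L] [Algebra R L]
    [Fintype n] [DecidableEq n] {S : Set (n → L)} {P : Submodule R L}
    (h : ∀ v : n → n → L, (∀ l, v l ∈ S) → (Matrix.of v).det ∈ P) (v : n → n → L)
    (hv : ∀ l, v l ∈ Submodule.span R S) : (Matrix.of v).det ∈ P := by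
  suffices ∀ s : Finset n, ∀ v : n → n → L, (∀ l ∈ s, v l ∈ Submodule.span R S) →
      (∀ l ∉ s, v l ∈ S) → (Matrix.of v).det ∈ P from
    this Finset.univ v (fun l _ ↦ hv l) (by simp)
  intro s
  induction s using Finset.induction_on with
  | empty => exact fun v _ hv ↦ h v fun l ↦ hv l (by simp)
  | insert a s ha ih =>
    intro v hv hv'
    suffices ∀ x ∈ Submodule.span R S, ((Matrix.of v).updateRow a x).det ∈ P by
      have h1 := this (v a) (hv a (Finset.mem_insert_self _ _))
      rwa [show (Matrix.of v).updateRow a (v a) = Matrix.of v from Matrix.updateRow_eq_self ..] at h1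
    intro x hx
    induction hx using Submodule.span_induction with
    | mem x hx =>
      refine ih (Function.update v a x) (fun l hl ↦ ?_) fun l hl ↦ ?_
      · rw [Function.update_of_ne (ne_of_mem_of_not_mem hl ha)]
        exact hv l (Finset.mem_insert_of_mem hl)
      · by_cases hla : l = a
        · subst hla
          rwa [Function.update_self]
        · rw [Function.update_of_ne hla]
          exact hv' l (by simp [hla, hl])
    | zero => rw [Matrix.det_eq_zero_of_row_eq_zero a (by simp)]; exact P.zero_mem
    | add x y _ _ hx hy => rw [Matrix.det_updateRow_add]; exact P.add_mem hx hy
    | smul r x _ hx =>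
      rw [← algebraMap_smul L r x, Matrix.det_updateRow_smul, ← Algebra.smul_def]
      exact P.smul_mem r hx

variable {k L n : Type*} [CommRing k] [CommRing L] [Algebra k L] [Fintype n] [DecidableEq n]

/-- The `S`-submodule of `L` generated by the values `(dx₁ ∧ ⋯ ∧ dxᵢ)(D₁, …, Dᵢ)`, `xₗ ∈ S`. -/
def formSpan (S : Type*) [CommRing S] [Algebra S L] (D : n → Derivation k L L) : Submodule S L :=
  Submodule.span S (Set.range fun b : n → S ↦ jac D fun l ↦ algebraMap S L (b l))

theorem jac_mem_formSpan {S : Type*} [CommRing S] [Algebra S L] (D : n → Derivation k L L)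
    (b : n → S) : (jac D fun l ↦ algebraMap S L (b l)) ∈ formSpan S D :=
  Submodule.subset_span ⟨b, rfl⟩

theorem det_mem_formSpan {S : Type*} [CommRing S] [Algebra k S] [Algebra S L]
    [IsScalarTower k S L] (D : n → Derivation k L L) (v : n → n → L)
    (hv : ∀ l, v l ∈ Submodule.span S (Set.range (derivationPi S D))) :
    (Matrix.of v).det ∈ formSpan S D := by
  refine det_mem_of_forall_mem_span (fun v hv ↦ ?_) v hv
  choose b hb using hv
  convert jac_mem_formSpan D b
  exact congrArg Matrix.det (Matrix.ext fun r j ↦ congrFun (hb r).symm j)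

theorem formSpan_le {S R : Type*} [CommRing S] [Algebra S L] [CommRing R] [Algebra R L]
    [Algebra S R] [IsScalarTower S R L] (D : n → Derivation k L L) {x : L}
    (hx : x ∈ formSpan S D) : x ∈ formSpan R D := by
  have : formSpan S D ≤ (formSpan R D).restrictScalars S := by
    refine Submodule.span_le.mpr ?_
    rintro _ ⟨b, rfl⟩
    have := jac_mem_formSpan D fun l ↦ algebraMap S R (b l)
    simp only [← IsScalarTower.algebraMap_apply] at this
    exact this
  exact this hx

/-- Scaling derivations scales the columns of the Jacobian. This serves the change of coordinate
from `t` to `t⁻¹`. -/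
theorem formSpan_smul {S : Type*} [CommRing S] [Algebra S L] {D D' : n → Derivation k L L}
    (ε : n → L) (h : ∀ j x, D j x = ε j * D' j x) {x : L} (hx : x ∈ formSpan S D) :
    ∃ y ∈ formSpan S D', x = (∏ j, ε j) * y := by
  induction hx using Submodule.span_induction with
  | mem x hx =>
    obtain ⟨b, rfl⟩ := hx
    refine ⟨_, jac_mem_formSpan D' b, ?_⟩
    unfold jac
    rw [← Matrix.det_mul_row]
    exact congrArg Matrix.det (Matrix.ext fun r j ↦ h _ _)
  | zero => exact ⟨0, zero_mem _, by simp⟩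
  | add x y _ _ hx hy =>
    obtain ⟨x', hx', rfl⟩ := hx
    obtain ⟨y', hy', rfl⟩ := hy
    exact ⟨x' + y', add_mem hx' hy', by ring⟩
  | smul r x _ hx =>
    obtain ⟨x', hx', rfl⟩ := hx
    exact ⟨r • x', Submodule.smul_mem _ _ hx', by simp only [Algebra.smul_def]; ring⟩

/-- For `b = a / s` the quotient rule reads `s² db = s da - a ds`; hence the squared denominators in
the witness. -/
theorem exists_smul_mem_formSpan {B R : Type*} [CommRing B] [CommRing R] [Algebra B R]
    [Algebra B L] [Algebra R L] [IsScalarTower B R L] [Algebra k B] [IsScalarTower k B L]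
    (M : Submonoid B) [IsLocalization M R]
    (D : n → Derivation k L L) {x : L} (hx : x ∈ formSpan R D) :
    ∃ c ∈ M, algebraMap B L c * x ∈ formSpan B D := by
  induction hx using Submodule.span_induction with
  | mem x hx =>
    obtain ⟨b, rfl⟩ := hx
    choose as has using fun l ↦ IsLocalization.surj M (b l)
    refine ⟨∏ l, ((as l).2 * (as l).2 : B), prod_mem fun l _ ↦ mul_mem (as l).2.2 (as l).2.2, ?_⟩
    unfold jac
    rw [map_prod, ← Matrix.det_mul_column]
    refine det_mem_formSpan D _ fun l ↦ ?_
    have h1 : (fun j ↦ algebraMap B L ((as l).2 * (as l).2) * D j (algebraMap R L (b l))) =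
        ((as l).2 : B) • derivationPi B D (as l).1 - (as l).1 • derivationPi B D ((as l).2 : B) := by
      ext j
      have h2 : algebraMap R L (b l) * algebraMap B L (as l).2 = algebraMap B L (as l).1 := by
        rw [IsScalarTower.algebraMap_apply B R L, ← map_mul, has,
          ← IsScalarTower.algebraMap_apply]
      rw [Pi.sub_apply, Pi.smul_apply, Pi.smul_apply, derivationPi_apply, derivationPi_apply]
      simp only [Algebra.smul_def, ← h2, Derivation.leibniz, Algebra.algebraMap_self, RingHom.id_apply, map_mul]
      ring
    exact h1 ▸ sub_mem (Submodule.smul_mem _ _ (Submodule.subset_span ⟨_, rfl⟩))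
      (Submodule.smul_mem _ _ (Submodule.subset_span ⟨_, rfl⟩))
  | zero => exact ⟨1, M.one_mem, by simp⟩
  | add x y _ _ hx hy =>
    obtain ⟨c, hc, hx⟩ := hx
    obtain ⟨d, hd, hy⟩ := hy
    refine ⟨c * d, M.mul_mem hc hd, ?_⟩
    have : algebraMap B L (c * d) * (x + y) = d • (algebraMap B L c * x) +
        c • (algebraMap B L d * y) := by
      simp only [Algebra.smul_def, map_mul]
      ring
    rw [this]
    exact add_mem (Submodule.smul_mem _ _ hx) (Submodule.smul_mem _ _ hy)
  | smul r x _ hx =>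
    obtain ⟨c, hc, hx⟩ := hx
    obtain ⟨⟨a, s⟩, has⟩ := IsLocalization.surj M r
    refine ⟨c * s, M.mul_mem hc s.2, ?_⟩
    have h2 : algebraMap R L r * algebraMap B L s = algebraMap B L a := by
      rw [IsScalarTower.algebraMap_apply B R L, ← map_mul, has, ← IsScalarTower.algebraMap_apply]
    have : algebraMap B L (c * s) * (r • x) = a • (algebraMap B L c * x) := by
      simp only [Algebra.smul_def, map_mul, ← h2]
      ring
    rw [this]
    exact Submodule.smul_mem _ _ hx

/-- A minor of the Jacobian matrix is a Jacobian determinant, after adding dual coordinates. -/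
theorem jac_comp_injective {ι : Type*} [Fintype ι] [DecidableEq ι] {D : ι → Derivation k L L}
    {z : ι → L} (hDz : ∀ i j, D i (z j) = if i = j then 1 else 0) {I : n → ι}
    (hI : Function.Injective I) (b : n → L) :
    (jac (fun r ↦ D (I r)) b) = jac D (Function.extend I b z) := by
  let e : n ⊕ {j // j ∉ Set.range I} ≃ ι :=
    (Equiv.sumCongr (Equiv.ofInjective I hI) (Equiv.refl _)).trans
      (Equiv.sumCompl (· ∈ Set.range I))
  have he1 (r : n) : e (Sum.inl r) = I r := rfl
  have he2 (j : {j // j ∉ Set.range I}) : e (Sum.inr j) = j := rfl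
  have hb2 (j : {j // j ∉ Set.range I}) : Function.extend I b z j = z j :=
    Function.extend_apply' _ _ _ j.2
  -- With the indices in the image of `I` placed first, the added rows `dz j` form the block row `(0
  -- 1)`.
  have h1 : (Matrix.of fun r j ↦ D j (Function.extend I b z r)).submatrix e e =
      Matrix.fromBlocks (Matrix.of fun r j ↦ D (I j) (b r))
        (Matrix.of fun r (j : {j // j ∉ Set.range I}) ↦ D j (b r)) 0 1 := by
    ext r j
    obtain r | r := r <;> obtain j | j := j
    · simp [he1, hI.extend_apply]
    · simp [he1, he2, hI.extend_apply]
    · simp only [Matrix.submatrix_apply, he1, he2, Matrix.of_apply, hb2, hDz,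
        Matrix.fromBlocks_apply₂₁, Matrix.zero_apply]
      rw [if_neg]
      rintro h
      exact r.2 ⟨j, h⟩
    · simp only [Matrix.submatrix_apply, he2, Matrix.of_apply, hb2, hDz,
        Matrix.fromBlocks_apply₂₂, Matrix.one_apply, Subtype.ext_iff, eq_comm]
  rw [jac, jac, ← Matrix.det_submatrix_equiv_self e, h1, Matrix.det_fromBlocks_zero₂₁,
    Matrix.det_one, mul_one]

theorem formSpan_eq_bot {ι : Type*} {S : Type*} [CommRing S] [Algebra S L]
    (D : ι → Derivation k L L) {I : n → ι} (hI : ¬ Function.Injective I) :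
    formSpan S (fun r ↦ D (I r)) = ⊥ := by
  rw [formSpan, Submodule.span_eq_bot]
  rintro _ ⟨b, rfl⟩
  simp only [Function.Injective, not_forall] at hI
  obtain ⟨r, s, h, hrs⟩ := hI
  exact Matrix.det_zero_of_column_eq hrs fun j ↦ by simp [h]

end FormSpan

end SepRuled

namespace SepRuled

/-! ### Coordinates on `L` adapted to the ruling. -/

section Separating

open IntermediateField

theorem isSeparable_of_isSeparable_of_comp {E₁ E₂ M : Type*} [Field E₁] [Field E₂] [Field M]
    [Algebra E₁ M] [Algebra E₂ M] (f : E₁ →+* E₂)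
    (h : (algebraMap E₂ M).comp f = algebraMap E₁ M) {x : M} (hx : IsSeparable E₁ x) :
    IsSeparable E₂ x := by
  have h1 : ((minpoly E₁ x).map f).Separable := Polynomial.Separable.map hx
  refine h1.of_dvd (minpoly.dvd _ _ ?_)
  rw [Polynomial.aeval_def, Polynomial.eval₂_map, h, ← Polynomial.aeval_def, minpoly.aeval]

variable {k K F L σ : Type*} [Field k] [Field K] [Field F] [Field L] [Algebra k K] [Algebra K F]
  [Algebra F L] [Algebra k L] [Algebra K L] [IsScalarTower k K L] [IsScalarTower K F L]
  {y : σ → K} {t : F}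

/-- The coordinates `y, t` on `L`. -/
def coords (L : Type*) [Field L] [Algebra F L] [Algebra K L] (y : σ → K) (t : F) : Option σ → L :=
  fun o ↦ o.elim (algebraMap F L t) fun j ↦ algebraMap K L (y j)

theorem algebraicIndependent_coords (hy : AlgebraicIndependent k y) (ht : Transcendental K t) :
    AlgebraicIndependent k (coords L y t) := by
  have h1 : AlgebraicIndependent k (fun j ↦ algebraMap K L (y j)) :=
    hy.map' (f := IsScalarTower.toAlgHom k K L) (algebraMap K L).injective
  refine (h1.option_iff_transcendental _).mpr ?_
  have h2 : Transcendental K (algebraMap F L t) :=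
    (transcendental_algebraMap_iff (algebraMap F L).injective).mpr ht
  have hr : Algebra.adjoin k (Set.range fun j ↦ algebraMap K L (y j)) ≤
      (IsScalarTower.toAlgHom k K L).range := by
    refine Algebra.adjoin_le ?_
    rintro _ ⟨j, rfl⟩
    exact ⟨y j, rfl⟩
  intro halg
  apply h2
  obtain ⟨f, hf, hfx⟩ := halg
  have hex (c : Algebra.adjoin k (Set.range fun j ↦ algebraMap K L (y j))) :
      ∃ κ : K, algebraMap K L κ = c := hr c.2
  choose g hg using hex
  -- The subring `k[y]` of `L` lies in the image of `K`; through `G`, a relation for `t` over `k[y]`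
  -- becomes one over `K`.
  let G : Algebra.adjoin k (Set.range fun j ↦ algebraMap K L (y j)) →+* K :=
    { toFun := g
      map_one' := (algebraMap K L).injective (by simp [hg])
      map_zero' := (algebraMap K L).injective (by simp [hg])
      map_mul' := fun a b ↦ (algebraMap K L).injective (by simp [hg])
      map_add' := fun a b ↦ (algebraMap K L).injective (by simp [hg]) }
  have hG : (algebraMap K L).comp G = algebraMap _ L := RingHom.ext hg
  refine ⟨f.map G, ?_, ?_⟩
  · rw [Polynomial.map_ne_zero_iff]
    · exact hf
    · intro a b hab
      apply Subtype.ext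
      rw [← hg, ← hg]
      exact congrArg _ hab
  · rw [Polynomial.aeval_def, Polynomial.eval₂_map, hG]
    exact hfx

/-- The separable closure of `k(y, t)` in `L` contains `K` and `t`, hence `F = K(t)`, over which `L`
is separable. -/
theorem isSeparable_adjoin_coords (hy : Algebra.IsSeparable (adjoin k (Set.range y)) K)
    (hF : ∀ x : F, ∃ f g : Polynomial K, x = Polynomial.aeval t f / Polynomial.aeval t g)
    [Algebra.IsSeparable F L] :
    Algebra.IsSeparable (adjoin k (Set.range (coords L y t))) L := by
  set E := adjoin k (Set.range (coords L y t))
  let C := separableClosure E L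
  have hK (κ : K) : algebraMap K L κ ∈ C := by
    rw [mem_separableClosure_iff]
    let φ : K →ₐ[k] L := IsScalarTower.toAlgHom k K L
    have hmap : (adjoin k (Set.range y)).map φ ≤ E := by
      rw [adjoin_map, adjoin_le_iff]
      rintro _ ⟨_, ⟨j, rfl⟩, rfl⟩
      exact subset_adjoin _ _ ⟨some j, rfl⟩
    let f : adjoin k (Set.range y) →+* E :=
      (φ.toRingHom.comp (algebraMap _ K)).codRestrict E fun x ↦ hmap ⟨x, x.2, rfl⟩
    have h1 : ((minpoly (adjoin k (Set.range y)) κ).map f).Separable :=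
      Polynomial.Separable.map (Algebra.IsSeparable.isSeparable _ κ)
    refine h1.of_dvd (minpoly.dvd _ _ ?_)
    have h2 : (algebraMap E L).comp f = (algebraMap K L).comp (algebraMap _ K) := rfl
    rw [Polynomial.aeval_def, Polynomial.eval₂_map, h2, ← Polynomial.hom_eval₂,
      ← Polynomial.aeval_def, minpoly.aeval, map_zero]
  have ht : algebraMap F L t ∈ C :=
    C.algebraMap_mem ⟨_, subset_adjoin _ _ ⟨none, rfl⟩⟩
  have hpoly (f : Polynomial K) : algebraMap F L (Polynomial.aeval t f) ∈ C := by
    rw [← Polynomial.aeval_algebraMap_apply, Polynomial.aeval_eq_sum_range]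
    refine sum_mem fun i _ ↦ ?_
    rw [Algebra.smul_def]
    exact mul_mem (hK _) (pow_mem ht _)
  have hFC (x : F) : algebraMap F L x ∈ C := by
    obtain ⟨f, g, rfl⟩ := hF x
    rw [map_div₀]
    exact div_mem (hpoly f) (hpoly g)
  let f : F →+* C := (algebraMap F L).codRestrict C hFC
  have hsep : Algebra.IsSeparable C L := ⟨fun x ↦
    isSeparable_of_isSeparable_of_comp f rfl (Algebra.IsSeparable.isSeparable F x)⟩
  exact Algebra.IsSeparable.trans E C L

/-- `L` is purely inseparable over `S` because `Lᵖ ⊆ S`, and separable because `S` contains `k(z)`;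
for the constants, `k = kᵖ` by perfectness. -/
theorem eq_top_of_pow_mem [PerfectField k] {ι : Type*} {z : ι → L}
    (hsep : Algebra.IsSeparable (adjoin k (Set.range z)) L) (p : ℕ) [Fact p.Prime] [CharP L p]
    (S : Subfield L) (hS : ∀ x, x ^ p ∈ S) (hz : ∀ i, z i ∈ S) : S = ⊤ := by
  have : CharP k p := (RingHom.charP_iff (algebraMap k L) (algebraMap k L).injective p).mpr ‹_›
  have : ExpChar k p := .prime Fact.out
  have hk (c : k) : algebraMap k L c ∈ S := by
    obtain ⟨d, rfl⟩ := (PerfectField.toPerfectRing (K := k) p).bijective_frobenius.surjective c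
    change algebraMap k L (d ^ p) ∈ S
    rw [map_pow]
    exact hS _
  have hE : (adjoin k (Set.range z)).toSubfield ≤ S := by
    rw [adjoin_toSubfield, Subfield.closure_le]
    rintro _ (⟨c, rfl⟩ | ⟨i, rfl⟩)
    · exact hk c
    · exact hz i
  have : CharP S p := (RingHom.charP_iff (algebraMap S L) (algebraMap S L).injective p).mpr ‹_›
  have : ExpChar S p := .prime Fact.out
  have h1 : Algebra.IsSeparable S L := ⟨fun x ↦ isSeparable_of_isSeparable_of_comp
    ((algebraMap (adjoin k (Set.range z)) L).codRestrict S fun x ↦ hE x.2) rfl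
    (Algebra.IsSeparable.isSeparable _ x)⟩
  have h2 : IsPurelyInseparable S L := (isPurelyInseparable_iff_pow_mem S p).mpr fun x ↦
    ⟨1, ⟨x ^ p, hS x⟩, by rw [pow_one]; rfl⟩
  rw [eq_top_iff]
  intro x _
  obtain ⟨s, rfl⟩ := IsPurelyInseparable.surjective_algebraMap_of_isSeparable S L x
  exact s.2

end Separating

end SepRuled

namespace SepRuled

universe v

/-! ### Traces of coefficients of regular forms are polynomials in `t`. -/

section TraceForms

open IntermediateField

variable {k K F : Type*} {L : Type v} {σ : Type*} [Field k] [Field K] [Field F] [Field L]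
  [Algebra k K] [Algebra K F] [Algebra F L] [Algebra k L] [Algebra K L] [IsScalarTower k K L]
  [IsScalarTower K F L] {y : σ → K} {t : F}

theorem valuationRing_localization_atPrime {B : Type*} [CommRing B] [IsDedekindDomain B]
    (m : Ideal B) [m.IsPrime] : ValuationRing (Localization.AtPrime m) := by
  have : IsDedekindDomain (Localization.AtPrime m) :=
    IsLocalization.isDedekindDomain B m.primeCompl_le_nonZeroDivisors _
  have : IsPrincipalIdealRing (Localization.AtPrime m) := by
    refine IsPrincipalIdealRing.of_finite_maximals
      ((Set.finite_singleton (IsLocalRing.maximalIdeal _)).subset fun I hI ↦ ?_)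
    exact IsLocalRing.eq_maximalIdeal hI
  exact ValuationRing.iff_local_bezout_domain.mpr ⟨inferInstance, inferInstance⟩

/-- Only the localizations of `B` at maximal ideals are used: the `c` with `c • α ∈ formSpan B D`
form an ideal contained in no maximal ideal. -/
theorem mem_formSpan_of_forall_valuationRing {B : Type v} [CommRing B] [IsDedekindDomain B]
    [Algebra k B] [Algebra B L] [IsScalarTower k B L] [IsFractionRing B L] {n : Type*} [Fintype n]
    [DecidableEq n] (D : n → Derivation k L L) {α : L}
    (hα : ∀ (R : Type v) [CommRing R] [IsDomain R] [ValuationRing R] [Algebra k R] [Algebra R L]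
      [IsScalarTower k R L] [IsFractionRing R L], α ∈ formSpan R D) : α ∈ formSpan B D := by
  let I : Ideal B :=
    { carrier := {c | c • α ∈ formSpan B D}
      add_mem' := fun {a b} ha hb ↦ by
        simpa only [Set.mem_ofPred_eq, add_smul] using add_mem ha hb
      zero_mem' := by simp
      smul_mem' := fun r c h ↦ by
        simpa only [Set.mem_ofPred_eq, smul_eq_mul, mul_smul] using Submodule.smul_mem _ r h }
  have hI : I = ⊤ := by
    by_contra h
    obtain ⟨m, hm, hIm⟩ := Ideal.exists_le_maximal I h
    let R := Localization.AtPrime m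
    have := valuationRing_localization_atPrime m
    let _ : Algebra R L := IsLocalization.localizationAlgebraOfSubmonoidLe R L m.primeCompl
      (nonZeroDivisors B) m.primeCompl_le_nonZeroDivisors
    have : IsScalarTower B R L := IsLocalization.localization_isScalarTower_of_submonoid_le R L
      m.primeCompl (nonZeroDivisors B) m.primeCompl_le_nonZeroDivisors
    have : IsFractionRing R L :=
      IsFractionRing.isFractionRing_of_isDomain_of_isLocalization m.primeCompl R L
    have : IsScalarTower k R L := IsScalarTower.of_algebraMap_eq fun x ↦ by
      rw [IsScalarTower.algebraMap_apply k B R, ← IsScalarTower.algebraMap_apply B R L,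
        ← IsScalarTower.algebraMap_apply]
    obtain ⟨c, hc, hcα⟩ := exists_smul_mem_formSpan m.primeCompl D (hα R)
    refine hc (hIm ?_)
    change c • α ∈ formSpan B D
    rwa [Algebra.smul_def]
  have h1 := (Ideal.eq_top_iff_one I).mp hI
  change (1 : B) • α ∈ formSpan B D at h1
  rwa [one_smul] at h1

/-- Some derivation of `K` takes the prescribed values on `y`. It agrees with `d` on all of `K`,
since a derivation of `K` is determined by its values on the separating basis `y`. -/
theorem derivation_restrict (hy : AlgebraicIndependent k y)
    (hysep : Algebra.IsSeparable (adjoin k (Set.range y)) K) (d : Derivation k L L)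
    (c : σ → K) (hd : ∀ j, d (algebraMap K L (y j)) = algebraMap K L (c j)) (κ : K) :
    ∃ κ', d (algebraMap K L κ) = algebraMap K L κ' := by
  obtain ⟨d', hd'⟩ := exists_derivation_of_separating hy hysep c
  have h := derivation_eq_of_separating hy hysep (d.compAlgebraMap K)
    ((Algebra.linearMap K L).compDer d') fun j ↦ by
      change d (algebraMap K L (y j)) = algebraMap K L (d' (y j))
      rw [hd, hd']
  exact ⟨d' κ, congrArg (fun d : Derivation k K L ↦ d κ) h⟩

theorem derivation_restrict_eq_zero (hy : AlgebraicIndependent k y)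
    (hysep : Algebra.IsSeparable (adjoin k (Set.range y)) K) (d : Derivation k L L)
    (hd : ∀ j, d (algebraMap K L (y j)) = 0) (κ : K) : d (algebraMap K L κ) = 0 := by
  have h := derivation_eq_of_separating hy hysep (d.compAlgebraMap K) 0 hd
  exact congrArg (fun d : Derivation k K L ↦ d κ) h

variable [DecidableEq σ]

/-- The bracket of two dual derivations is a derivation that kills the coordinates. -/
theorem derivation_comm {z : Option σ → L} (hz : AlgebraicIndependent k z)
    (hsep : Algebra.IsSeparable (adjoin k (Set.range z)) L) {D : Option σ → Derivation k L L}
    (hDz : ∀ i j, D i (z j) = if i = j then 1 else 0) (i j x) : D i (D j x) = D j (D i x) := by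
  have h : ⁅D i, D j⁆ = 0 := by
    refine derivation_eq_of_separating hz hsep _ _ fun l ↦ ?_
    rw [Derivation.commutator_apply, hDz, hDz]
    split_ifs <;> simp
  have h2 := congrArg (fun d : Derivation k L L ↦ d x) h
  simpa [Derivation.commutator_apply, sub_eq_zero] using h2

/-- With `B` the integral closure of `K[t]` in `L`, `α` is a `B`-combination of minors. The
coordinates lie in `B`, so filling the missing rows with them turns each minor into a full Jacobian
of elements of `B`, as `trace_jac_mem` demands. -/
theorem trace_mem_of_mem_formSpan [PerfectField k] [Algebra.EssFiniteType k K]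
    [FiniteDimensional F L] [Algebra.IsSeparable F L] [Fintype σ]
    [Algebra (Polynomial K) F] [Algebra (Polynomial K) L] [IsScalarTower (Polynomial K) F L]
    [IsScalarTower k (Polynomial K) L] [IsScalarTower K (Polynomial K) L]
    [IsFractionRing (Polynomial K) F] (ht : ∀ f : Polynomial K, algebraMap (Polynomial K) F f = Polynomial.aeval t f)
    (hy : IsTranscendenceBasis k y) (hysep : Algebra.IsSeparable (adjoin k (Set.range y)) K)
    {D : Option σ → Derivation k L L}
    (hDz : ∀ i j, D i (coords L y t j) = if i = j then 1 else 0) {n : Type*} [Fintype n]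
    [DecidableEq n] (I : n → Option σ) {α : L}
    (hα : ∀ (R : Type v) [CommRing R] [IsDomain R] [ValuationRing R] [Algebra k R] [Algebra R L]
      [IsScalarTower k R L] [IsFractionRing R L], α ∈ formSpan R fun r ↦ D (I r)) :
    ∃ f : Polynomial K, Algebra.trace F L α = Polynomial.aeval t f := by
  by_cases hI : Function.Injective I
  swap
  · refine ⟨0, ?_⟩
    -- A repeated derivation makes every value zero; the field `L` is itself one of the valuation
    -- rings.
    have := hα L
    rw [formSpan_eq_bot D hI, Submodule.mem_bot] at this
    rw [this, map_zero, map_zero]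
  have hinj : Function.Injective (algebraMap (Polynomial K) F) := IsFractionRing.injective _ _
  have htt : Transcendental K t := by
    rw [transcendental_iff_injective]
    intro f g hfg
    exact hinj (by rwa [ht, ht])
  have hF (x : F) : ∃ f g : Polynomial K, x = Polynomial.aeval t f / Polynomial.aeval t g := by
    obtain ⟨f, g, -, rfl⟩ := IsFractionRing.div_surjective (A := Polynomial K) x
    exact ⟨f, g, by rw [ht, ht]⟩
  have hz := algebraicIndependent_coords (L := L) hy.1 htt
  have hsep := isSeparable_adjoin_coords (L := L) hysep hF
  let B := integralClosure (Polynomial K) L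
  have : IsDedekindDomain B := integralClosure.isDedekindDomain (Polynomial K) F L
  have : IsFractionRing B L := integralClosure.isFractionRing_of_finite_extension F L
  have : IsScalarTower k (Polynomial K) B := inferInstance
  have : IsScalarTower k K B := IsScalarTower.of_algebraMap_eq fun x ↦ Subtype.ext <| by
    exact IsScalarTower.algebraMap_apply k K L x
  have hDy (i : Option σ) (j : σ) : D i (algebraMap K L (y j)) = if i = some j then 1 else 0 :=
    hDz i (some j)
  have hDt (i : Option σ) : D i (algebraMap F L t) = if i = none then 1 else 0 := hDz i none
  have hD0 (κ : K) : D none (algebraMap K L κ) = 0 :=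
    derivation_restrict_eq_zero hy.1 hysep _ (fun j ↦ by rw [hDy, if_neg (by simp)]) κ
  have hDK (i : Option σ) (κ : K) : ∃ κ', D i (algebraMap K L κ) = algebraMap K L κ' :=
    derivation_restrict hy.1 hysep _ (fun j ↦ if i = some j then 1 else 0)
      (fun j ↦ by rw [hDy]; split_ifs <;> simp) κ
  have hmapK (κ : K) : algebraMap (Polynomial K) L (Polynomial.C κ) = algebraMap K L κ :=
    (IsScalarTower.algebraMap_apply K (Polynomial K) L κ).symm
  have hmapX : algebraMap (Polynomial K) L Polynomial.X = algebraMap F L t := by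
    rw [IsScalarTower.algebraMap_apply (Polynomial K) F L, ht, Polynomial.aeval_X]
  have hDA (i : Option σ) (f : Polynomial K) :
      ∃ g, D i (algebraMap (Polynomial K) L f) = algebraMap (Polynomial K) L g := by
    induction f using Polynomial.induction_on with
    | C a =>
      obtain ⟨a', ha⟩ := hDK i a
      exact ⟨Polynomial.C a', by rw [hmapK, hmapK, ha]⟩
    | add f g hf hg =>
      obtain ⟨f', hf⟩ := hf
      obtain ⟨g', hg⟩ := hg
      exact ⟨f' + g', by rw [map_add, map_add, map_add, hf, hg]⟩
    | monomial n a h =>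
      obtain ⟨g, hg⟩ := h
      refine ⟨g * Polynomial.X + Polynomial.C a * Polynomial.X ^ n * if i = none then 1 else 0, ?_⟩
      rw [pow_succ, ← mul_assoc, map_mul _ _ Polynomial.X, Derivation.leibniz, hg, hmapX, hDt,
        map_add, map_mul _ g, hmapX, map_mul _ (Polynomial.C a * Polynomial.X ^ n),
        apply_ite (algebraMap (Polynomial K) L), map_one, map_zero, smul_eq_mul, smul_eq_mul]
      ring
  let zB : Option σ → B := fun o ↦ o.elim (algebraMap (Polynomial K) B Polynomial.X)
    fun j ↦ algebraMap K B (y j)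
  have hzB (o) : algebraMap B L (zB o) = coords L y t o := by
    cases o with
    | none => exact hmapX
    | some j => rfl
  have hmem := mem_formSpan_of_forall_valuationRing (B := B) (fun r ↦ D (I r)) hα
  -- The extra factor `b₀` makes the statement stable under multiplication by `B`.
  suffices ∀ x ∈ formSpan B (fun r ↦ D (I r)), ∀ b₀ : B, ∃ f : Polynomial K,
      Algebra.trace F L (algebraMap B L b₀ * x) = algebraMap (Polynomial K) F f by
    obtain ⟨f, hf⟩ := this α hmem 1
    exact ⟨f, by rw [← ht, ← hf, map_one, one_mul]⟩
  intro x hx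
  induction hx using Submodule.span_induction with
  | mem x hx =>
    obtain ⟨b, rfl⟩ := hx
    intro b₀
    have h1 : (jac (fun r ↦ D (I r)) fun l ↦ algebraMap B L (b l)) =
        jac D fun o ↦ algebraMap B L (Function.extend I b zB o) := by
      rw [jac_comp_injective hDz hI]
      congr 1
      ext o
      by_cases ho : ∃ r, I r = o
      · obtain ⟨r, rfl⟩ := ho
        rw [hI.extend_apply, hI.extend_apply]
      · rw [Function.extend_apply' _ _ _ ho, Function.extend_apply' _ _ _ ho, hzB]
    have h2 : (algebraMap B L b₀ * (jac (fun r ↦ D (I r)) fun l ↦ algebraMap B L (b l))) = _ :=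
      congrArg _ h1
    rw [h2]
    exact trace_jac_mem K F hy (by simp) hDz (derivation_comm hz hsep hDz)
      (fun p _ _ ↦ eq_top_of_pow_mem hsep p) none hD0 hDK hDA b₀ _
  | zero => exact fun b₀ ↦ ⟨0, by simp⟩
  | add x y _ _ hx hy =>
    intro b₀
    obtain ⟨f, hf⟩ := hx b₀
    obtain ⟨g, hg⟩ := hy b₀
    exact ⟨f + g, by rw [mul_add, map_add, map_add, hf, hg]⟩
  | smul r x _ hx =>
    intro b₀
    obtain ⟨f, hf⟩ := hx (b₀ * r)
    exact ⟨f, by rw [← hf, Algebra.smul_def, (algebraMap B L).map_mul, mul_assoc]⟩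

end TraceForms

end SepRuled

namespace SepRuled

universe v

/-! ### Comparison of `t` with `t⁻¹`: the trace is constant along the ruling. -/

section TraceConstant

open IntermediateField

variable {k K F : Type*} {L : Type v} {σ : Type*} [Field k] [Field K] [Field F] [Field L]
  [Algebra k K] [Algebra K F] [Algebra F L] [Algebra k L] [Algebra K L] [IsScalarTower k K L]
  [IsScalarTower K F L] {y : σ → K} {t : F} [DecidableEq σ]

theorem exists_trace_eq_aeval [PerfectField k] [Algebra.EssFiniteType k K]
    [FiniteDimensional F L] [Algebra.IsSeparable F L] [Fintype σ] (ht : Transcendental K t)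
    (hF : ∀ x : F, ∃ f g : Polynomial K, x = Polynomial.aeval t f / Polynomial.aeval t g)
    (hy : IsTranscendenceBasis k y) (hysep : Algebra.IsSeparable (adjoin k (Set.range y)) K)
    {D : Option σ → Derivation k L L}
    (hDz : ∀ i j, D i (coords L y t j) = if i = j then 1 else 0) {n : Type*} [Fintype n]
    [DecidableEq n] (I : n → Option σ) {α : L}
    (hα : ∀ (R : Type v) [CommRing R] [IsDomain R] [ValuationRing R] [Algebra k R] [Algebra R L]
      [IsScalarTower k R L] [IsFractionRing R L], α ∈ formSpan R fun r ↦ D (I r)) :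
    ∃ f : Polynomial K, Algebra.trace F L α = Polynomial.aeval t f := by
  let _ : Algebra (Polynomial K) F := (Polynomial.aeval t).toRingHom.toAlgebra
  let _ : Algebra (Polynomial K) L :=
    ((algebraMap F L).comp (Polynomial.aeval t).toRingHom).toAlgebra
  have : IsScalarTower (Polynomial K) F L := .of_algebraMap_eq fun _ ↦ rfl
  have h1 (κ : K) : algebraMap K L κ = algebraMap F L (Polynomial.aeval t (Polynomial.C κ)) := by
    rw [Polynomial.aeval_C, ← IsScalarTower.algebraMap_apply]
  have : IsScalarTower K (Polynomial K) L := .of_algebraMap_eq fun κ ↦ h1 κ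
  have : IsScalarTower k (Polynomial K) L := .of_algebraMap_eq fun c ↦ by
    rw [IsScalarTower.algebraMap_apply k K L]
    exact h1 _
  have : FaithfulSMul (Polynomial K) F := (faithfulSMul_iff_algebraMap_injective _ _).mpr
    (transcendental_iff_injective.mp ht)
  have : IsFractionRing (Polynomial K) F := .of_field _ _ hF
  exact trace_mem_of_mem_formSpan (fun _ ↦ rfl) hy hysep hDz I hα

theorem aeval_inv_mul_pow (ht : t ≠ 0) (f : Polynomial K) :
    Polynomial.aeval t⁻¹ f * t ^ f.natDegree = Polynomial.aeval t f.reverse := by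
  let _ : Invertible t⁻¹ := invertibleOfNonzero (inv_ne_zero ht)
  have h := Polynomial.eval₂_reverse_mul_pow (algebraMap K F) t⁻¹ f
  rw [invOf_eq_inv, inv_inv, ← Polynomial.aeval_def, ← Polynomial.aeval_def] at h
  rw [← h, mul_assoc, ← mul_pow, inv_mul_cancel₀ ht, one_pow, mul_one]

theorem aeval_mul_inv_pow (ht : t ≠ 0) (f : Polynomial K) :
    Polynomial.aeval t f * t⁻¹ ^ f.natDegree = Polynomial.aeval t⁻¹ f.reverse := by
  simpa using aeval_inv_mul_pow (inv_ne_zero ht) f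

/-- `K[t] ∩ K[t⁻¹] = K`: with `m` the degree of `g`, clearing denominators gives `f Xᵐ = g.reverse`,
and the right side has degree at most `m`. -/
theorem eq_C_of_aeval_inv_eq (ht : Transcendental K t) {f g : Polynomial K}
    (h : Polynomial.aeval t f = Polynomial.aeval t⁻¹ g) : ∃ c, f = Polynomial.C c := by
  have ht0 : t ≠ 0 := fun h0 ↦ ht (h0 ▸ isAlgebraic_zero)
  have h1 : f * Polynomial.X ^ g.natDegree = g.reverse := by
    apply transcendental_iff_injective.mp ht
    rw [map_mul, map_pow, Polynomial.aeval_X, h, aeval_inv_mul_pow ht0]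
  by_cases hf : f = 0
  · exact ⟨0, by simp [hf]⟩
  have h2 := congrArg Polynomial.natDegree h1
  rw [Polynomial.natDegree_mul_X_pow _ hf] at h2
  have h3 := Polynomial.reverse_natDegree_le g
  exact ⟨_, Polynomial.eq_C_of_natDegree_eq_zero (by omega)⟩

/-- The trace of the coefficient of a regular differential form is constant on the fibres of a
ruling. -/
theorem exists_trace_eq_algebraMap [PerfectField k] [Algebra.EssFiniteType k K]
    [FiniteDimensional F L] [Algebra.IsSeparable F L] [Fintype σ] (ht : Transcendental K t)
    (hF : ∀ x : F, ∃ f g : Polynomial K, x = Polynomial.aeval t f / Polynomial.aeval t g)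
    (hy : IsTranscendenceBasis k y) (hysep : Algebra.IsSeparable (adjoin k (Set.range y)) K)
    {D : Option σ → Derivation k L L}
    (hDz : ∀ i j, D i (coords L y t j) = if i = j then 1 else 0) {n : Type*} [Fintype n]
    [DecidableEq n] (I : n → Option σ) {α : L}
    (hα : ∀ (R : Type v) [CommRing R] [IsDomain R] [ValuationRing R] [Algebra k R] [Algebra R L]
      [IsScalarTower k R L] [IsFractionRing R L], α ∈ formSpan R fun r ↦ D (I r)) :
    ∃ κ : K, Algebra.trace F L α = algebraMap K F κ := by
  have ht0 : t ≠ 0 := fun h0 ↦ ht (h0 ▸ isAlgebraic_zero)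
  have htL : algebraMap F L t ≠ 0 := (map_ne_zero _).mpr ht0
  obtain ⟨f, hf⟩ := exists_trace_eq_aeval ht hF hy hysep hDz I hα
  have ht' : Transcendental K t⁻¹ := fun h ↦ ht (by simpa using h.inv)
  have hF' (x : F) : ∃ f g : Polynomial K, x = Polynomial.aeval t⁻¹ f / Polynomial.aeval t⁻¹ g := by
    obtain ⟨f, g, rfl⟩ := hF x
    refine ⟨f.reverse * Polynomial.X ^ g.natDegree, g.reverse * Polynomial.X ^ f.natDegree, ?_⟩
    simp only [map_mul, map_pow, Polynomial.aeval_X, ← aeval_mul_inv_pow ht0]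
    by_cases hg : Polynomial.aeval t g = 0
    · simp [hg]
    · field_simp
  -- The derivation dual to `t⁻¹` is `-t² ∂/∂t`; `ε'` is this factor and `ε` its inverse. The
  -- product of the `ε` is a polynomial in `t⁻¹`, so undoing the change of derivations keeps the
  -- trace in `K[t⁻¹]`.
  let ε (o : Option σ) : F := if o = none then -t⁻¹ ^ 2 else 1
  let ε' (o : Option σ) : L := if o = none then -algebraMap F L t ^ 2 else 1
  have hε (o) : algebraMap F L (ε o) * ε' o = 1 := by
    simp only [ε, ε']
    split_ifs
    · rw [map_neg, neg_mul_neg, map_pow, map_inv₀, ← mul_pow, inv_mul_cancel₀ htL, one_pow]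
    · simp
  let D' (o : Option σ) : Derivation k L L := ε' o • D o
  have hD' (o : Option σ) (x : L) : D o x = algebraMap F L (ε o) * D' o x := by
    rw [Derivation.smul_apply, smul_eq_mul, ← mul_assoc, hε, one_mul]
  have hDz' (i j) : D' i (coords L y t⁻¹ j) = if i = j then 1 else 0 := by
    cases j with
    | some j =>
      have h1 := hDz i (some j)
      change D i (algebraMap K L (y j)) = _ at h1
      change ε' i • D i (algebraMap K L (y j)) = _
      rw [h1]
      split_ifs with h
      · simp [ε', h]
      · simp
    | none =>
      have h1 := hDz i none
      change D i (algebraMap F L t) = _ at h1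
      change ε' i • D i (algebraMap F L t⁻¹) = _
      rw [map_inv₀, Derivation.leibniz_inv, h1]
      split_ifs with h
      · simp only [ε', if_pos h, smul_eq_mul]
        field_simp
      · simp
  have hε2 : ∃ e : Polynomial K, ∏ r, ε (I r) = Polynomial.aeval t⁻¹ e := by
    refine ⟨∏ r, if I r = none then -Polynomial.X ^ 2 else 1, ?_⟩
    rw [map_prod]
    refine Finset.prod_congr rfl fun r _ ↦ ?_
    simp only [ε]
    split_ifs <;> simp
  obtain ⟨e, he⟩ := hε2
  have he0 : (∏ r, algebraMap F L (ε (I r))) ≠ 0 :=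
    Finset.prod_ne_zero_iff.mpr fun r _ ↦ left_ne_zero_of_mul_eq_one (hε _)
  obtain ⟨g, hg⟩ := exists_trace_eq_aeval (α := (∏ r, algebraMap F L (ε (I r)))⁻¹ * α)
    ht' hF' hy hysep hDz' I fun R _ _ _ _ _ _ _ ↦ by
      obtain ⟨β, hβ, h⟩ := formSpan_smul (fun r ↦ algebraMap F L (ε (I r)))
        (fun r x ↦ hD' (I r) x) (hα R)
      rwa [h, inv_mul_cancel_left₀ he0]
  have h2 : Algebra.trace F L α = Polynomial.aeval t⁻¹ (e * g) := by
    rw [map_mul, ← he, ← hg, ← smul_eq_mul, ← map_smul, Algebra.smul_def, map_prod,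
      mul_inv_cancel_left₀ he0]
  obtain ⟨c, rfl⟩ := eq_C_of_aeval_inv_eq ht (hf.symm.trans h2)
  exact ⟨c, by rw [hf, Polynomial.aeval_C]⟩

end TraceConstant

end SepRuled

namespace SepRuled

/-! ### Coefficients of differential forms. -/

section FormValue

variable {k L : Type u} [Field k] [Field L] [Algebra k L] {i : ℕ}

/-- The value of an `i`-form on `i` derivations. -/
noncomputable def evForm (S : Type u) [CommRing S] [Algebra k S] [Algebra S L] [IsScalarTower k S L]
    (D : Fin i → Derivation k L L) : ⋀[S]^i (Ω[S⁄k]) →ₗ[S] L :=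
  exteriorPower.alternatingMapLinearEquiv
    { ((Matrix.detRowAlternating (R := L) (n := Fin i)).toMultilinearMap.restrictScalars
        S).compLinearMap fun _ ↦ (derivationPi S D).liftKaehlerDifferential with
      map_eq_zero_of_eq' := fun v r s h hrs ↦ Matrix.det_zero_of_row_eq hrs (by
        change (derivationPi S D).liftKaehlerDifferential (v r) =
          (derivationPi S D).liftKaehlerDifferential (v s)
        rw [h]) }

variable {S : Type u} [CommRing S] [Algebra k S] [Algebra S L] [IsScalarTower k S L]
  {T : Type u} [CommRing T] [Algebra k T] [Algebra T L] [IsScalarTower k T L]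
  (D : Fin i → Derivation k L L)

theorem evForm_ιMulti (w : Fin i → Ω[S⁄k]) : evForm S D (exteriorPower.ιMulti S i w) =
    (Matrix.of fun l ↦ (derivationPi S D).liftKaehlerDifferential (w l)).det :=
  exteriorPower.alternatingMapLinearEquiv_apply_ιMulti _ _

theorem liftKaehlerDifferential_mem_span (w : Ω[S⁄k]) :
    (derivationPi S D).liftKaehlerDifferential w ∈
      Submodule.span S (Set.range (derivationPi S D)) := by
  have hw : w ∈ Submodule.span S (Set.range (KaehlerDifferential.D k S)) := by
    rw [KaehlerDifferential.span_range_derivation]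
    trivial
  have h := Submodule.mem_map_of_mem (f := (derivationPi S D).liftKaehlerDifferential) hw
  rw [Submodule.map_span, ← Set.range_comp] at h
  have h2 : (derivationPi S D).liftKaehlerDifferential ∘ KaehlerDifferential.D k S =
      derivationPi S D := funext fun x ↦ Derivation.liftKaehlerDifferential_comp_D _ _
  rwa [h2] at h

theorem evForm_mem_formSpan (m : ⋀[S]^i (Ω[S⁄k])) : evForm S D m ∈ formSpan S D := by
  have hm : m ∈ Submodule.span S (Set.range (exteriorPower.ιMulti S i (M := Ω[S⁄k]))) := by
    rw [exteriorPower.ιMulti_span]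
    trivial
  induction hm using Submodule.span_induction with
  | mem x hx =>
    obtain ⟨w, rfl⟩ := hx
    rw [evForm_ιMulti]
    exact det_mem_formSpan D _ fun l ↦ liftKaehlerDifferential_mem_span D _
  | zero => rw [map_zero]; exact zero_mem _
  | add x y _ _ hx hy => rw [map_add]; exact add_mem hx hy
  | smul a x _ hx => rw [map_smul]; exact Submodule.smul_mem _ _ hx

theorem evForm_exteriorPowerMap {ρ : S →+* T} (hρ : ∀ s, algebraMap T L (ρ s) = algebraMap S L s)
    (f : Ω[S⁄k] →ₛₗ[ρ] Ω[T⁄k])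
    (hf : ∀ x, f (KaehlerDifferential.D k S x) = KaehlerDifferential.D k T (ρ x))
    (m : ⋀[S]^i (Ω[S⁄k])) : evForm T D (exteriorPowerMap f i m) = evForm S D m := by
  have hlift (w : Ω[S⁄k]) : (derivationPi T D).liftKaehlerDifferential (f w) =
      (derivationPi S D).liftKaehlerDifferential w := by
    have hw : w ∈ Submodule.span S (Set.range (KaehlerDifferential.D k S)) := by
      rw [KaehlerDifferential.span_range_derivation]
      trivial
    induction hw using Submodule.span_induction with
    | mem x hx =>
      obtain ⟨x, rfl⟩ := hx
      rw [hf, Derivation.liftKaehlerDifferential_comp_D, Derivation.liftKaehlerDifferential_comp_D]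
      ext j
      rw [derivationPi_apply, derivationPi_apply, hρ]
    | zero => simp
    | add x y _ _ hx hy => simp only [map_add, hx, hy]
    | smul a x _ hx =>
      rw [map_smulₛₗ, map_smul, map_smul, hx]
      ext j
      simp [Algebra.smul_def, hρ]
  have hm : m ∈ Submodule.span S (Set.range (exteriorPower.ιMulti S i (M := Ω[S⁄k]))) := by
    rw [exteriorPower.ιMulti_span]
    trivial
  induction hm using Submodule.span_induction with
  | mem x hx =>
    obtain ⟨w, rfl⟩ := hx
    rw [exteriorPowerMap_ιMulti, evForm_ιMulti, evForm_ιMulti]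
    simp only [Function.comp_apply, hlift]
  | zero => simp
  | add x y _ _ hx hy => simp only [map_add, hx, hy]
  | smul a x _ hx =>
    rw [map_smulₛₗ, map_smul, map_smul, hx, Algebra.smul_def, Algebra.smul_def, hρ]

/-- The coordinates of `m` in the basis of `⋀ⁱ Ω` induced by `b` are its values on increasing tuples
of the dual derivations. -/
theorem eq_zero_of_evForm_eq_zero {ι : Type*} [LinearOrder ι] (D : ι → Derivation k L L)
    (hTL : Function.Injective (algebraMap T L)) (b : Module.Basis ι T (Ω[T⁄k]))
    (hb : ∀ j l, (derivationPi T D).liftKaehlerDifferential (b l) j = if j = l then 1 else 0)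
    (m : ⋀[T]^i (Ω[T⁄k])) (hm : ∀ I : Fin i → ι, evForm T (fun r ↦ D (I r)) m = 0) : m = 0 := by
  have hcoord (j : ι) (w : Ω[T⁄k]) : algebraMap T L (b.coord j w) =
      (derivationPi T D).liftKaehlerDifferential w j := by
    have h : (Algebra.linearMap T L).comp (b.coord j) = (LinearMap.proj j).comp
        (derivationPi T D).liftKaehlerDifferential := by
      refine b.ext fun l ↦ ?_
      simp [hb, Finsupp.single_apply, eq_comm, apply_ite]
    exact LinearMap.congr_fun h w
  refine (Module.Basis.exteriorPower i b).ext_elem fun s ↦ ?_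
  rw [map_zero, Finsupp.zero_apply, exteriorPower.basis_repr_apply]
  apply hTL
  rw [map_zero, ← hm fun r ↦ Set.powersetCard.ofFinEmbEquiv.symm s r]
  have h : (Algebra.linearMap T L).comp (exteriorPower.ιMultiDual T i b s) =
      evForm T fun r ↦ D (Set.powersetCard.ofFinEmbEquiv.symm s r) := by
    apply exteriorPower.linearMap_ext
    ext w
    simp only [LinearMap.compAlternatingMap_apply, LinearMap.comp_apply]
    rw [exteriorPower.ιMultiDual_apply_ιMulti, evForm_ιMulti, Algebra.linearMap_apply,
      RingHom.map_det]
    refine congrArg Matrix.det (Matrix.ext fun r j ↦ ?_)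
    rw [RingHom.mapMatrix_apply, Matrix.map_apply, Matrix.of_apply, Matrix.of_apply, hcoord]
    have h2 : (LinearMap.proj (Set.powersetCard.ofFinEmbEquiv.symm s j)).comp
        (derivationPi T D).liftKaehlerDifferential = (LinearMap.proj j).comp (derivationPi T
          fun r ↦ D (Set.powersetCard.ofFinEmbEquiv.symm s r)).liftKaehlerDifferential :=
      Derivation.liftKaehlerDifferential_unique _ _ (by ext; simp; rfl)
    exact LinearMap.congr_fun h2 (w r)
  exact LinearMap.congr_fun h m

end FormValue

end SepRuled

namespace SepRuled

/-! ### Spreading out from the generic point. -/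

section Spread

/-- The map on differentials induced by a ring homomorphism. -/
noncomputable def kaehlerMap {k S T : Type u} [CommRing k] [CommRing S] [CommRing T] [Algebra k S] [Algebra k T]
    (ρ : S →+* T) (hρ : ∀ c, ρ (algebraMap k S c) = algebraMap k T c) :
    Ω[S⁄k] →ₛₗ[ρ] Ω[T⁄k] :=
  letI : Algebra S T := ρ.toAlgebra
  haveI : IsScalarTower k S T := .of_algebraMap_eq fun c ↦ (hρ c).symm
  { toFun := KaehlerDifferential.map k k S T
    map_add' := map_add _
    map_smul' := fun r x ↦ by
      rw [map_smul]
      exact (algebraMap_smul T r _).symm }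

theorem kaehlerMap_D {k S T : Type u} [CommRing k] [CommRing S] [CommRing T] [Algebra k S]
    [Algebra k T] (ρ : S →+* T) (hρ : ∀ c, ρ (algebraMap k S c) = algebraMap k T c) (x : S) :
    kaehlerMap ρ hρ (KaehlerDifferential.D k S x) = KaehlerDifferential.D k T (ρ x) :=
  letI : Algebra S T := ρ.toAlgebra
  haveI : IsScalarTower k S T := .of_algebraMap_eq fun c ↦ (hρ c).symm
  KaehlerDifferential.map_D k k S T x

theorem kaehler_semilinear_ext {k S T : Type u} [CommRing k] [CommRing S] [CommRing T]
    [Algebra k S] {M : Type*} [AddCommGroup M] [Module T M] {ρ : S →+* T}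
    {f g : Ω[S⁄k] →ₛₗ[ρ] M}
    (h : ∀ x, f (KaehlerDifferential.D k S x) = g (KaehlerDifferential.D k S x)) (w : Ω[S⁄k]) :
    f w = g w := by
  have hw : w ∈ Submodule.span S (Set.range (KaehlerDifferential.D k S)) := by
    rw [KaehlerDifferential.span_range_derivation]
    trivial
  induction hw using Submodule.span_induction with
  | mem x hx => obtain ⟨x, rfl⟩ := hx; exact h x
  | zero => rw [map_zero, map_zero]
  | add x y _ _ hx hy => rw [map_add, map_add, hx, hy]
  | smul a x _ hx => rw [map_smulₛₗ, map_smulₛₗ, hx]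

variable {k L S : Type u} [Field k] [Field L] [Algebra k L] [CommRing S] [Algebra k S]
  [Algebra S L] [IsScalarTower k S L] [IsFractionRing S L] [IsDomain S]

/-- A basis of the differentials at the generic point spreads out. -/
theorem exists_basis_localization_away [Algebra.FiniteType k S] {ι : Type*} [Finite ι]
    (D : ι → Derivation k L L) (b : Module.Basis ι L (Ω[L⁄k]))
    [DecidableEq ι] (hb : ∀ j l, (derivationPi L D).liftKaehlerDifferential (b l) j = if j = l then 1 else 0) :
    ∃ r : S, r ≠ 0 ∧ ∀ [Algebra (Localization.Away r) L] [IsScalarTower S (Localization.Away r) L]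
      [IsScalarTower k (Localization.Away r) L],
      ∃ b' : Module.Basis ι (Localization.Away r) (Ω[Localization.Away r⁄k]),
      ∀ j l, (derivationPi (Localization.Away r) D).liftKaehlerDifferential (b' l) j =
        if j = l then 1 else 0 := by
  have : IsNoetherianRing S := Algebra.FiniteType.isNoetherianRing k S
  have : Module.FinitePresentation S (Ω[S⁄k]) := Module.finitePresentation_of_finite S _
  -- As `Ω` is finitely presented, a basis over the fraction field comes from a principal
  -- localization.
  obtain ⟨r, hr, b₁, hb₁⟩ := Module.FinitePresentation.exists_basis_localizedModule_powers
    (nonZeroDivisors S) (KaehlerDifferential.map k k S L) L b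
  refine ⟨r, nonZeroDivisors.ne_zero hr, fun {_ _ _} ↦ ?_⟩
  set T := Localization.Away r
  let e : LocalizedModule.Away r (Ω[S⁄k]) ≃ₗ[S] Ω[T⁄k] :=
    IsLocalizedModule.iso (.powers r) (KaehlerDifferential.map k k S T)
  let e' : LocalizedModule.Away r (Ω[S⁄k]) ≃ₗ[T] Ω[T⁄k] :=
    e.extendScalarsOfIsLocalization (.powers r) T
  refine ⟨b₁.map e', fun j l ↦ ?_⟩
  have h1 (x : LocalizedModule.Away r (Ω[S⁄k])) : KaehlerDifferential.map k k T L (e x) =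
      LocalizedModule.lift (.powers r) (KaehlerDifferential.map k k S L) (fun s ↦
        IsLocalizedModule.map_units (KaehlerDifferential.map k k S L)
        ⟨s.1, SetLike.le_def.mp (Submonoid.powers_le.mpr hr) s.2⟩) x := by
    have h2 : ((KaehlerDifferential.map k k T L).restrictScalars S).comp e.toLinearMap =
        LocalizedModule.lift (.powers r) (KaehlerDifferential.map k k S L) (fun s ↦
          IsLocalizedModule.map_units (KaehlerDifferential.map k k S L)
          ⟨s.1, SetLike.le_def.mp (Submonoid.powers_le.mpr hr) s.2⟩) := by
      refine (LocalizedModule.lift_unique _ _ _ _ ?_).symm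
      refine LinearMap.ext fun w ↦ ?_
      have h3 : e (LocalizedModule.mkLinearMap (.powers r) _ w) =
          KaehlerDifferential.map k k S T w := IsLocalizedModule.iso_mk_one _ _ w
      change KaehlerDifferential.map k k T L (e (LocalizedModule.mkLinearMap (.powers r) _ w)) = _
      rw [h3]
      refine kaehler_semilinear_ext (f := ((KaehlerDifferential.map k k T L).restrictScalars S).comp
        (KaehlerDifferential.map k k S T)) (fun x ↦ ?_) w
      simp [← IsScalarTower.algebraMap_apply]
    exact LinearMap.congr_fun h2 x
  have h4 (w : Ω[T⁄k]) : (derivationPi T D).liftKaehlerDifferential w =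
      (derivationPi L D).liftKaehlerDifferential (KaehlerDifferential.map k k T L w) := by
    have : (derivationPi T D).liftKaehlerDifferential =
        ((derivationPi L D).liftKaehlerDifferential.restrictScalars T).comp
          (KaehlerDifferential.map k k T L) := by
      refine Derivation.liftKaehlerDifferential_unique _ _ ?_
      ext x
      simp [derivationPi_apply]
    exact LinearMap.congr_fun this w
  rw [Module.Basis.map_apply, h4, ← hb, ← hb₁, ← h1]
  rfl

/-- A form with vanishing coefficients may still be torsion, but it is zero over `S[1/r]`, where `Ω`
is free; any `ρ` that inverts `r` factors through this ring. -/
theorem exists_exteriorPowerMap_eq_zero [Algebra.FiniteType k S] {ι : Type*} [Finite ι]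
    (D : ι → Derivation k L L) (b : Module.Basis ι L (Ω[L⁄k]))
    [DecidableEq ι] (hb : ∀ j l, (derivationPi L D).liftKaehlerDifferential (b l) j = if j = l then 1 else 0)
    {i : ℕ} (m : ⋀[S]^i (Ω[S⁄k])) (hm : ∀ I : Fin i → ι, evForm S (fun r ↦ D (I r)) m = 0) :
    ∃ r : S, r ≠ 0 ∧ ∀ (T : Type u) [CommRing T] [Algebra k T] (ρ : S →+* T)
      (_ : ∀ c, ρ (algebraMap k S c) = algebraMap k T c) (f : Ω[S⁄k] →ₛₗ[ρ] Ω[T⁄k]),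
      (∀ x, f (KaehlerDifferential.D k S x) = KaehlerDifferential.D k T (ρ x)) →
      IsUnit (ρ r) → exteriorPowerMap f i m = 0 := by
  classical
  obtain ⟨r, hr, h⟩ := exists_basis_localization_away (S := S) D b hb
  refine ⟨r, hr, fun T _ _ ρ hρ f hf hrT ↦ ?_⟩
  let T₀ := Localization.Away r
  have hrL : IsUnit (algebraMap S L r) := by
    rw [isUnit_iff_ne_zero]
    exact fun h0 ↦ hr (IsFractionRing.injective S L (h0.trans (map_zero _).symm))
  let _ : Algebra T₀ L := (IsLocalization.Away.lift r hrL).toAlgebra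
  have : IsScalarTower S T₀ L := .of_algebraMap_eq fun s ↦
    (IsLocalization.Away.lift_eq r hrL s).symm
  have : IsScalarTower k T₀ L := .of_algebraMap_eq fun s ↦ by
    rw [IsScalarTower.algebraMap_apply k S T₀, ← IsScalarTower.algebraMap_apply S T₀ L,
      ← IsScalarTower.algebraMap_apply]
  obtain ⟨b', hb'⟩ := h
  let g : T₀ →+* T := IsLocalization.Away.lift r hrT
  have hg (s : S) : g (algebraMap S T₀ s) = ρ s := IsLocalization.Away.lift_eq r hrT s
  have hgk (c : k) : g (algebraMap k T₀ c) = algebraMap k T c := by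
    rw [IsScalarTower.algebraMap_apply k S T₀, hg, hρ]
  let f₀ := kaehlerMap (k := k) (algebraMap S T₀) fun c ↦ (IsScalarTower.algebraMap_apply k S T₀ c).symm
  have h0 : exteriorPowerMap f₀ i m = 0 := by
    let _ : LinearOrder ι := linearOrderOfSTO WellOrderingRel
    have hinj : Function.Injective (algebraMap T₀ L) := by
      have : IsFractionRing T₀ L := IsFractionRing.isFractionRing_of_isDomain_of_isLocalization
        (.powers r) T₀ L
      exact IsFractionRing.injective T₀ L
    refine eq_zero_of_evForm_eq_zero D hinj b' (fun j l ↦ by rw [hb']; congr) _ fun I ↦ ?_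
    rw [evForm_exteriorPowerMap _ (fun s ↦ (IsScalarTower.algebraMap_apply S T₀ L s).symm) f₀
      (fun x ↦ kaehlerMap_D _ _ x), hm]
  rw [exteriorPowerMap_comp (σ := g) (RingHom.ext fun s ↦ (hg s).symm) f₀ (kaehlerMap g hgk) f
    (fun w ↦ ?_) i m, h0, map_zero]
  have : RingHomCompTriple (algebraMap S T₀) g ρ := ⟨RingHom.ext hg⟩
  refine kaehler_semilinear_ext (g := (kaehlerMap g hgk).comp f₀) (fun x ↦ ?_) w
  rw [hf, LinearMap.comp_apply, kaehlerMap_D, kaehlerMap_D, hg]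

end Spread

end SepRuled

namespace SepRuled

/-! ### Sections of an associated sheaf: local lifting and local vanishing. -/

section AssociatedSheaf

variable {X : Scheme.{u}} (P : PresheafOfModules.{u} X.ringCatSheaf.obj)

/-- The sheaf of modules associated with a presheaf. -/
noncomputable abbrev assocSheaf : X.Modules :=
  (PresheafOfModules.sheafification (𝟙 X.ringCatSheaf.obj)).obj P

instance sectionsModule (U : X.Opens) : Module Γ(X, U) (P.obj (op U)) :=
  inferInstanceAs (Module (X.ringCatSheaf.obj.obj (op U)) (P.obj (op U)))

/-- The canonical map from sections of a presheaf to sections of the associated sheaf. -/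
noncomputable def toAssoc (U : X.Opens) : P.obj (op U) →ₗ[Γ(X, U)] Γ(assocSheaf P, U) :=
  { toFun := fun m ↦ (CategoryTheory.toSheafify (Opens.grothendieckTopology X) P.presheaf).app (op U) m
    map_add' := fun a b ↦ map_add
      ((CategoryTheory.toSheafify (Opens.grothendieckTopology X) P.presheaf).app (op U)).hom a b
    map_smul' := fun r m ↦ ((PresheafOfModules.toSheafify (𝟙 X.ringCatSheaf.obj)
      (CategoryTheory.toSheafify (Opens.grothendieckTopology X) P.presheaf)).app (op U)).hom.map_smul
        r m }

theorem toAssoc_res {U V : X.Opens} (f : V ⟶ U) (m : P.obj (op U)) :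
    (assocSheaf P).presheaf.map f.op (toAssoc P U m) = toAssoc P V (P.presheaf.map f.op m) :=
  (NatTrans.naturality_apply (CategoryTheory.toSheafify (Opens.grothendieckTopology X) P.presheaf)
    f.op m).symm

theorem exists_res_eq_zero {U : X.Opens} {m : P.obj (op U)} (hm : toAssoc P U m = 0) {x : X}
    (hx : x ∈ U) : ∃ (V : X.Opens) (f : V ⟶ U), x ∈ V ∧ P.presheaf.map f.op m = 0 := by
  have h := Presheaf.equalizerSieve_mem (Opens.grothendieckTopology X)
    (CategoryTheory.toSheafify (Opens.grothendieckTopology X) P.presheaf) (X := op U) m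
    (0 : P.presheaf.obj (op U)) (hm.trans (map_zero _).symm)
  obtain ⟨V, f, hf, hxV⟩ := h x hx
  exact ⟨V, f, hxV, hf.trans (map_zero _)⟩

theorem exists_toAssoc_eq {U : X.Opens} (s : Γ(assocSheaf P, U)) {x : X} (hx : x ∈ U) :
    ∃ (V : X.Opens) (f : V ⟶ U) (m : P.obj (op V)), x ∈ V ∧
      toAssoc P V m = (assocSheaf P).presheaf.map f.op s := by
  have h := Presheaf.imageSieve_mem (Opens.grothendieckTopology X)
    (CategoryTheory.toSheafify (Opens.grothendieckTopology X) P.presheaf) (U := op U) s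
  obtain ⟨V, f, ⟨m, hm⟩, hxV⟩ := h x hx
  exact ⟨V, f, m, hxV, hm⟩

end AssociatedSheaf

/-! ### Sections of the quotient by torsion. -/

section ModTorsion

variable {X : Scheme.{u}} [IsIntegral X] (M : X.Modules)

/-- The projection `M → M / M_tors` on sections. -/
noncomputable def toModTorsion (U : X.Opens) : Γ(M, U) →ₗ[Γ(X, U)] Γ(modTorsion M, U) :=
  { toFun := fun m ↦ toAssoc (Limits.cokernel (torsion M).ι) U
      ((Limits.cokernel.π (torsion M).ι).app (op U) m)
    map_add' := fun a b ↦ (congrArg (toAssoc (Limits.cokernel (torsion M).ι) U)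
      (((Limits.cokernel.π (torsion M).ι).app (op U)).hom.map_add a b)).trans
        ((toAssoc (Limits.cokernel (torsion M).ι) U).map_add _ _)
    map_smul' := fun r m ↦ (congrArg (toAssoc (Limits.cokernel (torsion M).ι) U)
      (((Limits.cokernel.π (torsion M).ι).app (op U)).hom.map_smul r m)).trans
        ((toAssoc (Limits.cokernel (torsion M).ι) U).map_smul r _) }

theorem toModTorsion_res {U V : X.Opens} (f : V ⟶ U) (m : Γ(M, U)) :
    (modTorsion M).presheaf.map f.op (toModTorsion M U m) =
      toModTorsion M V (M.presheaf.map f.op m) := by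
  refine (toAssoc_res (Limits.cokernel (torsion M).ι) f _).trans ?_
  refine congrArg (toAssoc (Limits.cokernel (torsion M).ι) V) ?_
  exact (PresheafOfModules.naturality_apply (Limits.cokernel.π (torsion M).ι) f.op m).symm

/-- Sheafification kills only locally zero sections, and evaluation on an open set keeps the
cokernel sequence of presheaves exact. -/
theorem exists_res_mem_torsionSections {U : X.Opens} {m : Γ(M, U)} (hm : toModTorsion M U m = 0)
    {x : X} (hx : x ∈ U) : ∃ (V : X.Opens) (f : V ⟶ U), x ∈ V ∧
      M.presheaf.map f.op m ∈ torsionSections M V := by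
  obtain ⟨V, f, hxV, hf⟩ := exists_res_eq_zero _ hm hx
  refine ⟨V, f, hxV, ?_⟩
  have h1 : (Limits.cokernel.π (torsion M).ι).app (op V) (M.presheaf.map f.op m) = 0 :=
    (PresheafOfModules.naturality_apply (Limits.cokernel.π (torsion M).ι) f.op m).trans hf
  let S := ShortComplex.mk (torsion M).ι (Limits.cokernel.π (torsion M).ι)
    (Limits.cokernel.condition _)
  have h2 : S.Exact := ShortComplex.exact_cokernel _
  have h3 := h2.map (PresheafOfModules.evaluation _ (op V))
  obtain ⟨y, hy⟩ := (ShortComplex.moduleCat_exact_iff _).mp h3 (M.presheaf.map f.op m) h1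
  exact hy ▸ y.2

theorem exists_toModTorsion_eq {U : X.Opens} (s : Γ(modTorsion M, U)) {x : X} (hx : x ∈ U) :
    ∃ (V : X.Opens) (f : V ⟶ U) (m : Γ(M, V)), x ∈ V ∧
      toModTorsion M V m = (modTorsion M).presheaf.map f.op s := by
  obtain ⟨V, f, m, hxV, hm⟩ := exists_toAssoc_eq _ s hx
  have h1 : Epi ((Limits.cokernel.π (torsion M).ι).app (op V)) :=
    inferInstanceAs (Epi ((PresheafOfModules.evaluation _ (op V)).map
      (Limits.cokernel.π (torsion M).ι)))
  obtain ⟨m', rfl⟩ := (ModuleCat.epi_iff_surjective _).mp h1 m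
  exact ⟨V, f, m', hxV, hm⟩

end ModTorsion

end SepRuled

/-! ### Forms on open subsets and their values at the generic point. -/

namespace SepRuled

theorem eq_zero_of_one_tmul_eq_zero {A B M : Type u} [CommRing A] [CommRing B] [Algebra A B]
    [AddCommGroup M] [Module A M] (h : Function.Bijective (algebraMap A B)) {m : M}
    (hm : (1 : B) ⊗ₜ[A] m = 0) : m = 0 := by
  let e := LinearEquiv.ofBijective (Algebra.linearMap A B) h
  have h2 := congrArg (TensorProduct.lid A M) (congrArg (e.symm.rTensor M) hm)
  have h3 : e.symm 1 = 1 := e.symm_apply_eq.mpr (map_one (algebraMap A B)).symm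
  rwa [LinearEquiv.rTensor_tmul, h3, TensorProduct.lid_tmul, one_smul, map_zero, map_zero] at h2

section Forms

variable {k : Type u} [Field k] {X : Scheme.{u}} [X.Over (Spec (CommRingCat.of k))]

noncomputable instance sectionsAlgebra (U : X.Opens) : Algebra k Γ(X, U) :=
  ((baseToSections (X ↘ Spec (CommRingCat.of k))).app (op U)).hom.toAlgebra

noncomputable instance stalkAlgebra (x : X) : Algebra k (X.presheaf.stalk x) :=
  ((X.presheaf.germ ⊤ x trivial).hom.comp (algebraMap k Γ(X, ⊤))).toAlgebra

theorem map_algebraMap {U V : X.Opens} (f : V ⟶ U) (c : k) :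
    X.presheaf.map f.op (algebraMap k Γ(X, U) c) = algebraMap k Γ(X, V) c :=
  (NatTrans.naturality_apply (baseToSections (X ↘ Spec (CommRingCat.of k))) f.op c).symm

theorem germ_algebraMap {U : X.Opens} (x : X) (hx : x ∈ U) (c : k) :
    X.presheaf.germ U x hx (algebraMap k Γ(X, U) c) = algebraMap k (X.presheaf.stalk x) c := by
  rw [← map_algebraMap (homOfLE le_top : U ⟶ ⊤), X.presheaf.germ_res_apply]
  rfl

instance [IsIntegral X] (U : X.Opens) [Nonempty U] : IsScalarTower k Γ(X, U) X.functionField :=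
  .of_algebraMap_eq fun c ↦ (germ_algebraMap _ _ c).symm

variable (X) in
/-- The presheaf of forms `U ↦ ⋀ⁱ Ω_{Γ(X, U)/k}`. -/
noncomputable abbrev formsPresheaf (k : Type u) [Field k] [X.Over (Spec (CommRingCat.of k))]
    (i : ℕ) : PresheafOfModules.{u} X.ringCatSheaf.obj :=
  presheafExteriorPower (PresheafOfModules.DifferentialsConstruction.relativeDifferentials'
    (baseToSections (X ↘ Spec (CommRingCat.of k)))) i

/-- Restriction of differentials to a smaller open subset. -/
noncomputable def kaehlerRestr {U V : X.Opens} (f : V ⟶ U) :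
    Ω[Γ(X, U)⁄k] →ₛₗ[(X.presheaf.map f.op).hom] Ω[Γ(X, V)⁄k] :=
  restr (PresheafOfModules.DifferentialsConstruction.relativeDifferentials'
    (baseToSections (X ↘ Spec (CommRingCat.of k)))) f.op

theorem kaehlerRestr_D {U V : X.Opens} (f : V ⟶ U) (x : Γ(X, U)) :
    kaehlerRestr f (KaehlerDifferential.D k _ x) =
      KaehlerDifferential.D k _ (X.presheaf.map f.op x) :=
  PresheafOfModules.DifferentialsConstruction.relativeDifferentials'_map_d
    (baseToSections (X ↘ Spec (CommRingCat.of k))) f.op x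

theorem formsPresheaf_map {i : ℕ} {U V : X.Opens} (f : V ⟶ U) (m : ⋀[Γ(X, U)]^i (Ω[Γ(X, U)⁄k])) :
    (formsPresheaf X k i).presheaf.map f.op m = exteriorPowerMap (kaehlerRestr f) i m := rfl

variable [IsIntegral X] {i : ℕ} (D : Fin i → Derivation k X.functionField X.functionField)

theorem evForm_restr {U V : X.Opens} [Nonempty U] [Nonempty V] (f : V ⟶ U)
    (m : ⋀[Γ(X, U)]^i (Ω[Γ(X, U)⁄k])) :
    evForm Γ(X, V) D ((formsPresheaf X k i).presheaf.map f.op m) = evForm Γ(X, U) D m := by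
  rw [formsPresheaf_map]
  exact evForm_exteriorPowerMap D (fun s ↦ X.presheaf.germ_res_apply f _ _ s) _ (kaehlerRestr_D f) m

/-- The form modulo torsion given by an element of `⋀ⁱ Ω_{Γ(X, U)/k}`. -/
noncomputable def toForms (U : X.Opens) (m : ⋀[Γ(X, U)]^i (Ω[Γ(X, U)⁄k])) :
    Γ(modTorsion (differentialForms (X ↘ Spec (CommRingCat.of k)) i), U) :=
  toModTorsion (assocSheaf (formsPresheaf X k i)) U (toAssoc (formsPresheaf X k i) U m)

theorem toForms_sub (U : X.Opens) (m m' : ⋀[Γ(X, U)]^i (Ω[Γ(X, U)⁄k])) :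
    toForms U (m - m') = toForms U m - toForms U m' :=
  (congrArg (toModTorsion (assocSheaf (formsPresheaf X k i)) U)
    ((toAssoc (formsPresheaf X k i) U).map_sub m m')).trans (map_sub _ _ _)

theorem toForms_smul (U : X.Opens) (r : Γ(X, U)) (m : ⋀[Γ(X, U)]^i (Ω[Γ(X, U)⁄k])) :
    toForms U (r • m) = r • toForms U m :=
  (congrArg (toModTorsion (assocSheaf (formsPresheaf X k i)) U)
    ((toAssoc (formsPresheaf X k i) U).map_smul r m)).trans (map_smul _ _ _)

theorem toForms_res {U V : X.Opens} (f : V ⟶ U) (m : ⋀[Γ(X, U)]^i (Ω[Γ(X, U)⁄k])) :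
    (modTorsion (differentialForms (X ↘ Spec (CommRingCat.of k)) i)).presheaf.map f.op
      (toForms U m) = toForms (k := k) V ((formsPresheaf X k i).presheaf.map f.op m :) :=
  (toModTorsion_res (assocSheaf (formsPresheaf X k i)) f _).trans
    (congrArg (toModTorsion (assocSheaf (formsPresheaf X k i)) V) (toAssoc_res (formsPresheaf X k i) f m))

theorem exists_toForms_eq {U : X.Opens}
    (s : Γ(modTorsion (differentialForms (X ↘ Spec (CommRingCat.of k)) i), U)) {x : X}
    (hx : x ∈ U) : ∃ (V : X.Opens) (f : V ⟶ U) (m : ⋀[Γ(X, V)]^i (Ω[Γ(X, V)⁄k])), x ∈ V ∧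
      toForms V m = (modTorsion (differentialForms (X ↘ Spec (CommRingCat.of k)) i)).presheaf.map
        f.op s := by
  obtain ⟨V, f, m, hxV, hm⟩ := exists_toModTorsion_eq _ s hx
  obtain ⟨W, g, m', hxW, hm'⟩ := exists_toAssoc_eq (formsPresheaf X k i) m hxV
  let m₀ : ⋀[Γ(X, W)]^i (Ω[Γ(X, W)⁄k]) := m'
  refine ⟨W, g ≫ f, m₀, hxW, ?_⟩
  refine (congrArg (toModTorsion (assocSheaf (formsPresheaf X k i)) W) hm').trans ?_
  refine (toModTorsion_res (assocSheaf (formsPresheaf X k i)) g m).symm.trans ?_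
  refine (congrArg _ hm).trans ?_
  rw [op_comp, Functor.map_comp]
  rfl

omit [X.Over (Spec (CommRingCat.of k))] in
-- At the generic point the local ring is already the function field, so the tensor product loses
-- nothing.
theorem germ_genericPoint_eq_zero {M : X.Modules} {U : X.Opens} {s : Γ(M, U)}
    (hs : s ∈ torsionSections M U) (hU : genericPoint X ∈ U) :
    (M.presheaf.germ U _ hU s : stalk M (genericPoint X)) = 0 := by
  refine @eq_zero_of_one_tmul_eq_zero _ _ _ _ _ (stalkFunctionFieldAlgebra X _) _ _ ?_ _ (hs _ hU)
  have : @algebraMap (X.presheaf.stalk (genericPoint X)) X.functionField _ _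
      (stalkFunctionFieldAlgebra X _) = RingHom.id _ := by
    change (X.presheaf.stalkSpecializes _).hom = _
    rw [TopCat.Presheaf.stalkSpecializes_refl]
    rfl
  rw [this]
  exact Function.bijective_id

/-- A form that is zero modulo torsion restricts to zero near the generic point, and restriction
does not change its value in the function field. -/
theorem evForm_eq_zero_of_toForms_eq_zero {U : X.Opens} [Nonempty U]
    {m : ⋀[Γ(X, U)]^i (Ω[Γ(X, U)⁄k])} (hm : toForms U m = 0) : evForm Γ(X, U) D m = 0 := by
  have hη {V : X.Opens} [h : Nonempty V] : genericPoint X ∈ V :=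
    ((genericPoint_spec X).mem_open_set_iff V.isOpen).mpr (by simpa using h)
  obtain ⟨V, f, hV, h1⟩ := exists_res_mem_torsionSections _ hm hη
  have h2 := germ_genericPoint_eq_zero h1 hV
  obtain ⟨W, hW, iU, iV, e⟩ := (assocSheaf (formsPresheaf X k i)).presheaf.germ_eq _ hV hV _ _
    (h2.trans (map_zero ((assocSheaf (formsPresheaf X k i)).presheaf.germ V _ hV).hom).symm)
  have h3 : toAssoc (formsPresheaf X k i) W ((formsPresheaf X k i).presheaf.map (iU ≫ f).op m) = 0 := by
    refine (toAssoc_res (formsPresheaf X k i) (iU ≫ f) m).symm.trans ?_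
    rw [op_comp, Functor.map_comp]
    exact e.trans (map_zero ((assocSheaf (formsPresheaf X k i)).presheaf.map iV.op).hom)
  obtain ⟨W', f', hW', h4⟩ := exists_res_eq_zero _ h3 hW
  have : Nonempty W := ⟨⟨_, hW⟩⟩
  have : Nonempty W' := ⟨⟨_, hW'⟩⟩
  rw [← evForm_restr D (iU ≫ f) m]
  exact (evForm_restr D f' _).symm.trans ((congrArg _ h4).trans (map_zero _))

end Forms

end SepRuled

namespace SepRuled

/-! ### Local generators of an invertible sheaf. -/

section Generator

variable {X : Scheme.{u}} {Q : X.Modules}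

/-- A section which freely generates `Q` on an open subset. -/
def IsGenerator {U : X.Opens} (e : Γ(Q, U)) : Prop :=
  ∀ ⦃V : X.Opens⦄ (f : V ⟶ U), Function.Bijective fun a : Γ(X, V) ↦ a • Q.presheaf.map f.op e

theorem IsGenerator.restrict {U V : X.Opens} {e : Γ(Q, U)} (he : IsGenerator e) (f : V ⟶ U) :
    IsGenerator (Q.presheaf.map f.op e) := fun W g ↦ by
  have h : Q.presheaf.map g.op (Q.presheaf.map f.op e) = Q.presheaf.map (g ≫ f).op e := by
    rw [op_comp, Functor.map_comp]
    rfl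
  rw [h]
  exact he (g ≫ f)

theorem exists_isGenerator (hQ : IsInvertible Q) (x : X) :
    ∃ (U : X.Opens) (e : Γ(Q, U)), x ∈ U ∧ IsGenerator e := by
  obtain ⟨U, hx, ⟨ψ⟩⟩ := hQ x
  let o (V : U.toScheme.Opens) : Γ((SheafOfModules.unit U.toScheme.ringCatSheaf : U.toScheme.Modules), V) :=
    (1 : Γ(U, V))
  let e : Γ(Q.restrict U.ι, ⊤) := ψ.inv.app ⊤ (o ⊤)
  refine ⟨U.ι ''ᵁ ⊤, e, by simpa using hx, fun V f ↦ ?_⟩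
  obtain ⟨V', rfl⟩ : ∃ V', V = U.ι ''ᵁ V' := ⟨U.ι ⁻¹ᵁ V, by
    rw [Scheme.Hom.image_preimage_eq_opensRange_inf]
    simpa using f.le⟩
  have h1 : Q.presheaf.map f.op e = (Q.restrict U.ι).presheaf.map (homOfLE le_top : V' ⟶ ⊤).op e := rfl
  have h2 : (Q.restrict U.ι).presheaf.map (homOfLE le_top : V' ⟶ ⊤).op e = ψ.inv.app V' (o V') := by
    refine (NatTrans.naturality_apply ψ.inv.mapPresheaf (homOfLE le_top : V' ⟶ ⊤).op (o ⊤)).symm.trans ?_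
    refine congrArg _ ?_
    exact (U.toScheme.presheaf.map (homOfLE le_top : V' ⟶ ⊤).op).hom.map_one
  have h3 (a : Γ(X, U.ι ''ᵁ V')) : a • Q.presheaf.map f.op e =
      ψ.inv.app V' ((U.ι.appIso V').hom a : Γ(U, V')) := by
    refine Eq.trans (congrArg (a • · : Γ(Q, U.ι ''ᵁ V') → Γ(Q, U.ι ''ᵁ V')) (h1.trans h2)) ?_
    refine Eq.trans ?_ ((congrArg (ψ.inv.app V') (mul_one (M := Γ(U, V')) _)))
    refine Eq.trans ?_ (Scheme.Modules.Hom.app_smul ψ.inv ((U.ι.appIso V').hom a) (o V')).symm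
    have h6 : (U.ι.appIso V').inv ((U.ι.appIso V').hom a) = a := by
      rw [← CommRingCat.comp_apply, Iso.hom_inv_id]
      rfl
    let E : Γ(Q, U.ι ''ᵁ V') := ψ.inv.app V' (o V')
    exact (congrArg (· • E) h6).symm
  have h4 : Function.Bijective (ψ.inv.app V') := by
    refine Function.bijective_iff_has_inverse.mpr ⟨ψ.hom.app V', fun y ↦ ?_, fun y ↦ ?_⟩
    · exact ConcreteCategory.congr_hom (congrArg (fun g ↦ Scheme.Modules.Hom.app g V')
        ψ.inv_hom_id) y
    · exact ConcreteCategory.congr_hom (congrArg (fun g ↦ Scheme.Modules.Hom.app g V')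
        ψ.hom_inv_id) y
  have h5 : Function.Bijective (U.ι.appIso V').hom := ConcreteCategory.bijective_of_isIso _
  have h7 := h4.comp h5
  rw [Function.Bijective] at h7 ⊢
  exact ⟨fun a b hab ↦ h7.1 ((h3 a).symm.trans (hab.trans (h3 b))), fun s ↦
    (h7.2 s).imp fun a ha ↦ (h3 a).trans ha⟩

theorem IsGenerator.bijective_germ {U : X.Opens} {e : Γ(Q, U)} (he : IsGenerator e) {x : X}
    (hx : x ∈ U) : Function.Bijective (LinearMap.toSpanSingleton (X.presheaf.stalk x) (stalk Q x)
      (Q.presheaf.germ U x hx e)) := by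
  constructor
  · rw [injective_iff_map_eq_zero]
    intro a ha
    obtain ⟨V, hV, b, rfl⟩ := X.presheaf.exists_germ_eq a
    let W := V ⊓ U
    let g : W ⟶ V := homOfLE inf_le_left
    let f : W ⟶ U := homOfLE inf_le_right
    have hW : x ∈ W := ⟨hV, hx⟩
    have h1 : Q.presheaf.germ W x hW (X.presheaf.map g.op b • Q.presheaf.map f.op e) =
        Q.presheaf.germ W x hW 0 := by
      refine (germ_smul Q x W hW _ _).trans (Eq.trans ?_ (map_zero (Q.presheaf.germ W x hW).hom).symm)
      exact (congrArg₂ (fun (a : X.presheaf.stalk x) (q : stalk Q x) ↦ a • q)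
        (X.presheaf.germ_res_apply g x hW b) (Q.presheaf.germ_res_apply f x hW e)).trans ha
    obtain ⟨W', hW', iU, iV, h2⟩ := Q.presheaf.germ_eq _ _ _ _ _ h1
    have h3 : X.presheaf.map iU.op (X.presheaf.map g.op b) = 0 := by
      refine (he (iU ≫ f)).1 ?_
      refine Eq.trans ?_ (h2.trans ((map_zero (Q.presheaf.map iV.op).hom).trans (zero_smul _ _).symm))
      refine Eq.trans ?_ (Scheme.Modules.map_smul Q iU _ _).symm
      rw [op_comp, Functor.map_comp]
      rfl
    rw [← X.presheaf.germ_res_apply g x hW, ← X.presheaf.germ_res_apply iU x hW', h3, map_zero]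
  · intro q
    obtain ⟨V, hV, s, rfl⟩ := Q.presheaf.exists_germ_eq q
    let W := V ⊓ U
    let g : W ⟶ V := homOfLE inf_le_left
    let f : W ⟶ U := homOfLE inf_le_right
    have hW : x ∈ W := ⟨hV, hx⟩
    obtain ⟨b, hb⟩ := (he f).2 (Q.presheaf.map g.op s)
    refine ⟨X.presheaf.germ W x hW b, ?_⟩
    rw [LinearMap.toSpanSingleton_apply]
    refine (congrArg _ (Q.presheaf.germ_res_apply f x hW e)).symm.trans ?_
    refine (germ_smul Q x W hW _ _).symm.trans ?_
    refine (congrArg _ hb).trans ?_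
    exact Q.presheaf.germ_res_apply g x hW s

/-- The generator identifies the fibre at `x` with the residue field, and `s(x)` with the residue of
`a`. -/
theorem IsGenerator.valueAt_eq_zero_iff {U : X.Opens} {e : Γ(Q, U)} (he : IsGenerator e) {x : X}
    (hx : x ∈ U) (s : Γ(Q, ⊤)) (a : Γ(X, U))
    (ha : Q.presheaf.map (homOfLE le_top : U ⟶ ⊤).op s = a • e) :
    valueAt Q x s = 0 ↔ X.presheaf.germ U x hx a ∈ IsLocalRing.maximalIdeal (X.presheaf.stalk x) := by
  let E := (LinearEquiv.ofBijective _ (he.bijective_germ hx)).symm.lTensor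
    (IsLocalRing.ResidueField (X.presheaf.stalk x)) ≪≫ₗ
      TensorProduct.rid _ _
  have h1 : (Q.presheaf.germ ⊤ x trivial s : stalk Q x) =
      X.presheaf.germ U x hx a • (Q.presheaf.germ U x hx e : stalk Q x) := by
    refine (Q.presheaf.germ_res_apply (homOfLE le_top : U ⟶ ⊤) x hx s).symm.trans ?_
    exact (congrArg _ ha).trans (germ_smul Q x U hx a e)
  have h2 : E (valueAt Q x s) = IsLocalRing.residue _ (X.presheaf.germ U x hx a) := by
    have h3 : (LinearEquiv.ofBijective _ (he.bijective_germ hx)).symm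
        (Q.presheaf.germ ⊤ x trivial s : stalk Q x) = X.presheaf.germ U x hx a := by
      rw [LinearEquiv.symm_apply_eq]
      exact h1
    rw [LinearEquiv.trans_apply, valueAt]
    refine (congrArg (TensorProduct.rid _ _) ((LinearEquiv.lTensor_tmul _ _ _ _).trans
      (congrArg _ h3))).trans ?_
    rw [TensorProduct.rid_tmul, Algebra.smul_def, mul_one]
    rfl
  rw [← IsLocalRing.residue_eq_zero_iff, ← h2, E.map_eq_zero_iff]

end Generator

end SepRuled

namespace SepRuled

/-! ### Coefficients of sections of `Q`. -/

section Coefficient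

theorem app_injective_of_mono {X : Scheme.{u}} {M N : X.Modules} (φ : M ⟶ N) [Mono φ] (U : X.Opens) :
    Function.Injective (φ.app U) := by
  have h1 : Mono ((Scheme.Modules.toPresheafOfModules X).map φ) := inferInstance
  have h2 : Mono ((PresheafOfModules.evaluation _ (op U)).map
    ((Scheme.Modules.toPresheafOfModules X).map φ)) := inferInstance
  exact (ModuleCat.mono_iff_injective _).mp h2

theorem app_res {X : Scheme.{u}} {M N : X.Modules} (φ : M ⟶ N) {U V : X.Opens} (f : V ⟶ U)
    (s : Γ(M, U)) : φ.app V (M.presheaf.map f.op s) = N.presheaf.map f.op (φ.app U s) :=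
  NatTrans.naturality_apply φ.mapPresheaf f.op s

theorem res_res {X : Scheme.{u}} (M : X.Modules) {U V W : X.Opens} (f : V ⟶ U) (g : W ⟶ V)
    (s : Γ(M, U)) : M.presheaf.map g.op (M.presheaf.map f.op s) = M.presheaf.map (g ≫ f).op s := by
  rw [op_comp, Functor.map_comp]
  rfl

variable {k : Type u} [Field k] {X : Scheme.{u}} [X.Over (Spec (CommRingCat.of k))]

theorem finiteType_sections [LocallyOfFiniteType (X ↘ Spec (CommRingCat.of k))] {U : X.Opens}
    (hU : IsAffineOpen U) : Algebra.FiniteType k Γ(X, U) := by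
  have h := (X ↘ Spec (CommRingCat.of k)).finiteType_appLE (isAffineOpen_top _) hU le_top
  have h2 := h.comp (RingHom.FiniteType.of_surjective _
    (ConcreteCategory.bijective_of_isIso (Scheme.ΓSpecIso (CommRingCat.of k)).inv).2)
  exact h2

variable [IsIntegral X]

theorem genericPoint_mem {V : X.Opens} [h : Nonempty V] : genericPoint X ∈ V :=
  ((genericPoint_spec X).mem_open_set_iff V.isOpen).mpr (by simpa using h)

theorem nonempty_inf {U V : X.Opens} [Nonempty U] [Nonempty V] : Nonempty (U ⊓ V : X.Opens) :=
  ⟨⟨genericPoint X, genericPoint_mem, genericPoint_mem⟩⟩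

/-- `c` is a non-zero coefficient of the form of the generator `e`, so that `s = a e` has
coefficient `a c`. The form of `s` is also represented near every point `x`, inside `U` or not,
which places `a c` in the span over the local ring at `x`. -/
theorem exists_coefficient [LocallyOfFiniteType (X ↘ Spec (CommRingCat.of k))] {ι : Type*}
    [Finite ι] [DecidableEq ι] (D : ι → Derivation k X.functionField X.functionField)
    (b : Module.Basis ι X.functionField (Ω[X.functionField⁄k]))
    (hb : ∀ j l, (derivationPi X.functionField D).liftKaehlerDifferential (b l) j = if j = l then 1 else 0)
    {Q : X.Modules} (hQ : IsInvertible Q) {i : ℕ}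
    (φ : Q ⟶ modTorsion (differentialForms (X ↘ Spec (CommRingCat.of k)) i)) [Mono φ] :
    ∃ (U : X.Opens) (_ : IsAffineOpen U) (_ : Nonempty U) (e : Γ(Q, U)) (_ : IsGenerator e)
      (I : Fin i → ι) (c : X.functionField), c ≠ 0 ∧ ∀ (s : Γ(Q, ⊤)) (a : Γ(X, U)),
        Q.presheaf.map (homOfLE le_top : U ⟶ ⊤).op s = a • e →
        ∀ x : X, algebraMap Γ(X, U) X.functionField a * c ∈
          formSpan (X.presheaf.stalk x) fun r ↦ D (I r) := by
  obtain ⟨U₀, e₀, hη, he₀⟩ := exists_isGenerator hQ (genericPoint X)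
  obtain ⟨V, f, m, hV, hm⟩ := exists_toForms_eq (k := k) (φ.app U₀ e₀) hη
  obtain ⟨_, ⟨U, hU, rfl⟩, hηU, hUV⟩ :=
    X.isBasis_affineOpens.exists_subset_of_mem_open hV V.isOpen
  have hne : Nonempty U := ⟨⟨_, hηU⟩⟩
  have hneV : Nonempty V := ⟨⟨_, hV⟩⟩
  let g : U ⟶ V := homOfLE hUV
  let e : Γ(Q, U) := Q.presheaf.map (g ≫ f).op e₀
  have he : IsGenerator e := he₀.restrict (g ≫ f)
  let m₀ : ⋀[Γ(X, U)]^i (Ω[Γ(X, U)⁄k]) := (formsPresheaf X k i).presheaf.map g.op m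
  have hm₀ : toForms U m₀ = φ.app U e := by
    refine (toForms_res g m).symm.trans ((congrArg _ hm).trans ?_)
    exact (res_res _ f g _).trans (app_res φ (g ≫ f) e₀).symm
  have hI : ∃ I : Fin i → ι, evForm Γ(X, U) (fun r ↦ D (I r)) m₀ ≠ 0 := by
    -- If all coefficients vanished, the form of `e` would be zero on some `X.basicOpen r`. By
    -- injectivity of `φ` so would `e`, which generates freely.
    by_contra! hI
    have := functionField_isFractionRing_of_isAffineOpen X U hU
    have := finiteType_sections (k := k) hU
    obtain ⟨r, hr, h⟩ := exists_exteriorPowerMap_eq_zero D b hb m₀ hI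
    let j : X.basicOpen r ⟶ U := homOfLE (X.basicOpen_le r)
    have h1 := h Γ(X, X.basicOpen r) (X.presheaf.map j.op).hom (map_algebraMap j) (kaehlerRestr j)
      (kaehlerRestr_D j) (RingedSpace.isUnit_res_basicOpen _ r)
    have h2 : φ.app (X.basicOpen r) (Q.presheaf.map j.op e) = 0 := by
      refine (app_res φ j e).trans ((congrArg _ hm₀.symm).trans ((toForms_res j m₀).trans ?_))
      refine (congrArg (toForms (X.basicOpen r)) h1).trans ?_
      rw [← sub_self 0, toForms_sub, sub_self]
    have h3 : Q.presheaf.map j.op e = 0 :=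
      app_injective_of_mono φ _ (h2.trans (map_zero (φ.app (X.basicOpen r)).hom).symm)
    have h4 : (1 : Γ(X, X.basicOpen r)) = 0 := (he j).1 (by simp only [h3, smul_zero])
    have : Nonempty (X.basicOpen r) := by
      obtain ⟨y, hy⟩ := (Opens.ne_bot_iff_nonempty _).mp
        (mt (basicOpen_eq_bot_iff r).mp hr)
      exact ⟨⟨y, hy⟩⟩
    exact one_ne_zero h4
  obtain ⟨I, hI⟩ := hI
  refine ⟨U, hU, hne, e, he, I, _, hI, fun s a hs x ↦ ?_⟩
  -- Near `x` the form of `s` is given by `m`; on `V ⊓ U` it agrees with `a • m₀` modulo torsion, so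
  -- the values coincide.
  obtain ⟨V, f, m, hxV, hm⟩ := exists_toForms_eq (k := k) (φ.app ⊤ s) (Set.mem_univ x : x ∈ (⊤ : X.Opens))
  have : Nonempty V := ⟨⟨x, hxV⟩⟩
  have hW : Nonempty (V ⊓ U : X.Opens) := nonempty_inf
  let p : (V ⊓ U : X.Opens) ⟶ V := homOfLE inf_le_left
  let q : (V ⊓ U : X.Opens) ⟶ U := homOfLE inf_le_right
  let m₁ : ⋀[Γ(X, V ⊓ U)]^i (Ω[Γ(X, V ⊓ U)⁄k]) := (formsPresheaf X k i).presheaf.map p.op m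
  let m₂ : ⋀[Γ(X, V ⊓ U)]^i (Ω[Γ(X, V ⊓ U)⁄k]) := (formsPresheaf X k i).presheaf.map q.op m₀
  let a' : Γ(X, V ⊓ U) := X.presheaf.map q.op a
  have h0 : φ.app (V ⊓ U) (Q.presheaf.map (homOfLE le_top).op s) =
      a' • φ.app (V ⊓ U) (Q.presheaf.map q.op e) := by
    rw [← Scheme.Modules.Hom.app_smul, ← Scheme.Modules.map_smul, ← hs]
    exact congrArg _ (res_res Q _ q s).symm
  have h1 : toForms (V ⊓ U) (m₁ - a' • m₂) = 0 := by
    rw [toForms_sub, toForms_smul, sub_eq_zero]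
    refine (toForms_res p m).symm.trans ((congrArg _ hm).trans ?_)
    refine (res_res _ f p _).trans ((app_res φ (p ≫ f) s).symm.trans (h0.trans ?_))
    refine congrArg (a' • ·) ((app_res φ q e).trans ?_)
    exact (congrArg _ hm₀.symm).trans (toForms_res q m₀)
  have h2 := evForm_eq_zero_of_toForms_eq_zero (fun r ↦ D (I r)) h1
  have h3 : algebraMap Γ(X, U) X.functionField a * evForm Γ(X, U) (fun r ↦ D (I r)) m₀ =
      evForm Γ(X, V) (fun r ↦ D (I r)) m := by
    have h4 : evForm Γ(X, V ⊓ U) (fun r ↦ D (I r)) m₁ = evForm Γ(X, V) (fun r ↦ D (I r)) m :=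
      evForm_restr _ p m
    have h5 : evForm Γ(X, V ⊓ U) (fun r ↦ D (I r)) m₂ = evForm Γ(X, U) (fun r ↦ D (I r)) m₀ :=
      evForm_restr _ q m₀
    have h6 : algebraMap Γ(X, V ⊓ U) X.functionField a' = algebraMap Γ(X, U) X.functionField a :=
      X.presheaf.germ_res_apply q _ _ a
    rw [map_sub, map_smul, sub_eq_zero, h4, h5, Algebra.smul_def, h6] at h2
    exact h2.symm
  rw [h3]
  let _ := TopCat.Presheaf.algebra_section_stalk X.presheaf (⟨x, hxV⟩ : V)
  have := functionField_isScalarTower X V ⟨x, hxV⟩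
  exact formSpan_le (S := Γ(X, V)) _ (evForm_mem_formSpan _ m)

end Coefficient

end SepRuled

namespace SepRuled

/-! ### The valuative criterion for coefficients. -/

section Valuative

variable {k : Type u} [Field k] {X : Scheme.{u}} [X.Over (Spec (CommRingCat.of k))]

theorem fromSpecStalk_over (x : X) : X.fromSpecStalk x ≫ (X ↘ Spec (CommRingCat.of k)) =
    Spec.map (CommRingCat.ofHom (algebraMap k (X.presheaf.stalk x))) := by
  refine ext_of_isAffine ?_
  rw [Scheme.Hom.comp_appTop, Scheme.fromSpecStalk_appTop, ← Iso.cancel_iso_inv_left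
    (Scheme.ΓSpecIso (CommRingCat.of k)), ← Scheme.ΓSpecIso_inv_naturality]
  have h : X.presheaf.map (homOfLE le_top : (⊤ : X.Opens) ⟶ ⊤).op = 𝟙 _ := X.presheaf.map_id _
  have h2 : CommRingCat.ofHom (algebraMap k (X.presheaf.stalk x)) =
      ((Scheme.ΓSpecIso (CommRingCat.of k)).inv ≫ (X ↘ Spec (CommRingCat.of k)).appTop) ≫
        X.presheaf.germ ⊤ x trivial := by
    change ((Scheme.ΓSpecIso (CommRingCat.of k)).inv ≫ (X ↘ Spec (CommRingCat.of k)).appTop ≫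
      X.presheaf.map (homOfLE le_top : (⊤ : X.Opens) ⟶ ⊤).op) ≫ X.presheaf.germ ⊤ x trivial = _
    rw [h, Category.comp_id]
  rw [h2]
  simp only [Category.assoc]
  have h3 : (Spec (X.presheaf.stalk x)).presheaf.map
    (homOfLE le_top : (⊤ : (Spec (X.presheaf.stalk x)).Opens) ⟶ ⊤).op = 𝟙 _ :=
    (Spec (X.presheaf.stalk x)).presheaf.map_id _
  refine congrArg _ (congrArg _ (congrArg _ ?_))
  exact (congrArg _ h3).trans (Category.comp_id _)

variable [IsIntegral X]

/-- Properness extends `Spec L → X` to `Spec R`. The closed point goes to some `x`, and `R` becomes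
an algebra over the local ring at `x` inside the function field, so the span at `x` lies in that
over `R`. -/
theorem mem_formSpan_of_valuationRing [IsProper (X ↘ Spec (CommRingCat.of k))] {i : ℕ}
    (D : Fin i → Derivation k X.functionField X.functionField) {α : X.functionField}
    (hα : ∀ x : X, α ∈ formSpan (X.presheaf.stalk x) D)
    (R : Type u) [CommRing R] [IsDomain R] [ValuationRing R] [Algebra k R]
    [Algebra R X.functionField] [IsScalarTower k R X.functionField]
    [IsFractionRing R X.functionField] : α ∈ formSpan R D := by
  have hv := (UniversallyClosed.eq_valuativeCriterion.le _ _ _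
    (inferInstance : UniversallyClosed (X ↘ Spec (CommRingCat.of k)))).1
  have hsq : X.fromSpecStalk (genericPoint X) ≫ (X ↘ Spec (CommRingCat.of k)) =
      Spec.map (CommRingCat.ofHom (algebraMap R X.functionField)) ≫
        Spec.map (CommRingCat.ofHom (algebraMap k R)) := by
    rw [fromSpecStalk_over, ← Spec.map_comp, ← CommRingCat.ofHom_comp,
      ← IsScalarTower.algebraMap_eq]
  let S : ValuativeCommSq (X ↘ Spec (CommRingCat.of k)) :=
    { R := R
      K := X.functionField
      i₁ := X.fromSpecStalk (genericPoint X)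
      i₂ := Spec.map (CommRingCat.ofHom (algebraMap k R))
      commSq := ⟨hsq⟩ }
  obtain ⟨l, hl⟩ : ∃ l : Spec (CommRingCat.of R) ⟶ X,
      Spec.map (CommRingCat.ofHom (algebraMap R X.functionField)) ≫ l =
        X.fromSpecStalk (genericPoint X) := ((hv S).exists_lift).elim fun l ↦ ⟨l.l, l.fac_left⟩
  set x := l (IsLocalRing.closedPoint R) with hx
  let ψ : X.presheaf.stalk x ⟶ CommRingCat.of R := Scheme.stalkClosedPointTo l
  have hψ : ψ ≫ CommRingCat.ofHom (algebraMap R X.functionField) =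
      X.presheaf.stalkSpecializes (genericPoint_specializes x) := by
    apply Spec.map_injective
    rw [← cancel_mono (X.fromSpecStalk x), Scheme.SpecMap_stalkSpecializes_fromSpecStalk,
      Spec.map_comp, Category.assoc]
    exact (congrArg _ (Scheme.Spec_stalkClosedPointTo_fromSpecStalk l)).trans hl
  let _ : Algebra (X.presheaf.stalk x) R := ψ.hom.toAlgebra
  have : IsScalarTower (X.presheaf.stalk x) R X.functionField :=
    .of_algebraMap_eq fun a ↦ (ConcreteCategory.congr_hom hψ a).symm
  exact formSpan_le D (hα x)

end Valuative

end SepRuled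

namespace SepRuled

/-! ### The standard chart of the projective line. -/

section AffineChart

variable (k : Type u) [Field k]

attribute [local instance] MvPolynomial.gradedAlgebra

open HomogeneousLocalization

/-- The coordinate ring of the chart `T₀ ≠ 0` of the projective line. -/
abbrev LineChart : Type u :=
  Away (MvPolynomial.homogeneousSubmodule (Fin 2) k) (MvPolynomial.X 0 : MvPolynomial (Fin 2) k)

/-- The constants in `LineChart k`. -/
noncomputable def lineChartBase : k →+* LineChart k :=
  (fromZeroRingHom (MvPolynomial.homogeneousSubmodule (Fin 2) k) _).comp
    (algebraMap k (MvPolynomial.homogeneousSubmodule (Fin 2) k 0))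

theorem X_mem_homogeneousSubmodule (i : Fin 2) :
    (MvPolynomial.X i : MvPolynomial (Fin 2) k) ∈ MvPolynomial.homogeneousSubmodule (Fin 2) k 1 :=
  MvPolynomial.isHomogeneous_X k i

/-- The map `k[t] → k[T₀, T₁]_(T₀)`, `t ↦ T₁ / T₀`. -/
noncomputable def lineChartMap : Polynomial k →+* LineChart k :=
  Polynomial.eval₂RingHom (lineChartBase k)
    (Away.mk _ (X_mem_homogeneousSubmodule k 0) 1 (MvPolynomial.X 1)
      (by simpa using X_mem_homogeneousSubmodule k 1))

theorem val_lineChartBase (c : k) : (lineChartBase k c).val =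
    algebraMap (MvPolynomial (Fin 2) k) _ (MvPolynomial.C c) :=
  Localization.mk_one_eq_algebraMap _

theorem val_lineChartMap_X : (lineChartMap k Polynomial.X).val * algebraMap (MvPolynomial (Fin 2) k)
    (Localization.Away (MvPolynomial.X 0 : MvPolynomial (Fin 2) k)) (MvPolynomial.X 0) =
      algebraMap (MvPolynomial (Fin 2) k) _ (MvPolynomial.X 1) := by
  rw [lineChartMap, Polynomial.coe_eval₂RingHom, Polynomial.eval₂_X, Away.val_mk,
    Localization.mk_eq_mk']
  simp only [pow_one]
  exact IsLocalization.mk'_spec _ _ _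

theorem lineChartMap_injective : Function.Injective (lineChartMap k) := by
  have h1 : IsUnit ((MvPolynomial.aeval ![(1 : Polynomial k), Polynomial.X]).toRingHom
      (MvPolynomial.X 0 : MvPolynomial (Fin 2) k)) := by simp
  -- The left inverse sets `T₀ = 1` and `T₁ = X`.
  let l : LineChart k →+* Polynomial k :=
    (IsLocalization.Away.lift (S := Localization.Away (MvPolynomial.X 0 : MvPolynomial (Fin 2) k))
      _ h1).comp (algebraMap (LineChart k) (Localization.Away (MvPolynomial.X 0 : MvPolynomial (Fin 2) k)))
  have h2 : l.comp (lineChartMap k) = RingHom.id _ := by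
    refine Polynomial.ringHom_ext (fun c ↦ ?_) ?_
    · have h3 : (lineChartMap k (Polynomial.C c)).val =
          algebraMap (MvPolynomial (Fin 2) k) _ (MvPolynomial.C c) := by
        rw [lineChartMap, Polynomial.coe_eval₂RingHom, Polynomial.eval₂_C, val_lineChartBase]
      change IsLocalization.Away.lift _ h1 (lineChartMap k (Polynomial.C c)).val = _
      rw [h3, IsLocalization.Away.lift_eq]
      simp
    · have h3 := congrArg (IsLocalization.Away.lift _ h1) (val_lineChartMap_X k)
      rw [map_mul, IsLocalization.Away.lift_eq, IsLocalization.Away.lift_eq] at h3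
      change IsLocalization.Away.lift _ h1 (lineChartMap k Polynomial.X).val = _
      simpa using h3
  exact Function.LeftInverse.injective (g := l) fun p ↦ RingHom.congr_fun h2 p

variable {k} in
-- Dehomogenisation with `v = T₁ / T₀`: in degree `n` the monomial `T₀ᵃ T₁ᵇ` is `vᵇ T₀ⁿ`.
theorem sum_mul_pow_of_isHomogeneous {B : Type*} [CommRing B] (φ : MvPolynomial (Fin 2) k →+* B)
    {v : B} (hv : v * φ (MvPolynomial.X 0) = φ (MvPolynomial.X 1)) {p : MvPolynomial (Fin 2) k}
    {n : ℕ} (hp : p.IsHomogeneous n) :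
    (∑ d ∈ p.support, φ (MvPolynomial.C (p.coeff d)) * v ^ d 1) * φ (MvPolynomial.X 0) ^ n =
      φ p := by
  conv_rhs => rw [p.as_sum]
  rw [map_sum, Finset.sum_mul]
  refine Finset.sum_congr rfl fun d hd ↦ ?_
  have hdn : d 0 + d 1 = n := by
    have := hp (MvPolynomial.mem_support_iff.mp hd)
    simpa [Finsupp.weight_apply, Finsupp.sum_fintype, Fin.sum_univ_two] using this
  rw [MvPolynomial.monomial_eq, Finsupp.prod_fintype _ _ (fun _ ↦ pow_zero _), Fin.prod_univ_two,
    map_mul, map_mul, map_pow, map_pow, ← hv, ← hdn]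
  ring

theorem lineChartMap_surjective : Function.Surjective (lineChartMap k) := by
  intro x
  obtain ⟨n, p, hp, rfl⟩ := Away.mk_surjective _ (X_mem_homogeneousSubmodule k 0) x
  refine ⟨∑ d ∈ p.support, Polynomial.C (p.coeff d) * Polynomial.X ^ d 1, ?_⟩
  apply HomogeneousLocalization.val_injective
  have h1 (c : k) : (lineChartMap k (Polynomial.C c)).val =
      algebraMap (MvPolynomial (Fin 2) k) _ (MvPolynomial.C c) := by
    rw [lineChartMap, Polynomial.coe_eval₂RingHom, Polynomial.eval₂_C, val_lineChartBase]
  have h2 := sum_mul_pow_of_isHomogeneous (algebraMap (MvPolynomial (Fin 2) k)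
    (Localization.Away (MvPolynomial.X 0 : MvPolynomial (Fin 2) k))) (val_lineChartMap_X k)
    (p := p) (n := n) (by simpa using hp)
  rw [Away.val_mk, Localization.mk_eq_mk', IsLocalization.eq_mk'_iff_mul_eq]
  refine Eq.trans ?_ h2
  rw [← map_pow, ← HomogeneousLocalization.algebraMap_apply, map_sum, map_sum]
  refine congrArg (· * _) (Finset.sum_congr rfl fun d _ ↦ ?_)
  rw [map_mul, map_mul, map_pow, map_pow, HomogeneousLocalization.algebraMap_apply, h1,
    HomogeneousLocalization.algebraMap_apply]

end AffineChart

end SepRuled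

namespace SepRuled

/-! ### A chart `Spec R[X]` of the product with the projective line. -/

section Chart

theorem fromSpec_over {k : Type u} [Field k] {X : Scheme.{u}} [X.Over (Spec (CommRingCat.of k))]
    {U : X.Opens} (hU : IsAffineOpen U) : hU.fromSpec ≫ (X ↘ Spec (CommRingCat.of k)) =
      Spec.map (CommRingCat.ofHom (algebraMap k Γ(X, U))) := by
  have h1 : (X ↘ Spec (CommRingCat.of k)) = X.toSpecΓ ≫
      Spec.map ((Scheme.ΓSpecIso (CommRingCat.of k)).inv ≫ (X ↘ Spec (CommRingCat.of k)).appTop) := by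
    rw [Spec.map_comp, ← Scheme.toSpecΓ_naturality_assoc, ← SpecMap_ΓSpecIso_hom,
      ← Spec.map_comp, Iso.inv_hom_id, Spec.map_id, Category.comp_id]
  rw [h1, IsAffineOpen.fromSpec_toSpecΓ_assoc, ← Spec.map_comp, Category.assoc]
  rfl

variable (k : Type u) [Field k]

attribute [local instance] MvPolynomial.gradedAlgebra

theorem exists_affineLine_to_projectiveLine :
    ∃ (b : Spec (CommRingCat.of (Polynomial k)) ⟶ projectiveLine k), IsOpenImmersion b ∧
      b ≫ projectiveLineToSpec k = Spec.map (CommRingCat.ofHom (algebraMap k (Polynomial k))) := by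
  let e := RingEquiv.ofBijective (lineChartMap k) ⟨lineChartMap_injective k, lineChartMap_surjective k⟩
  let e' : CommRingCat.of (Polynomial k) ≅ CommRingCat.of (LineChart k) := e.toCommRingCatIso
  let w : Spec (CommRingCat.of (LineChart k)) ⟶ projectiveLine k :=
    Proj.awayι _ _ (X_mem_homogeneousSubmodule k 0) zero_lt_one
  have hw : IsOpenImmersion w :=
    inferInstanceAs (IsOpenImmersion (Proj.awayι _ _ (X_mem_homogeneousSubmodule k 0) zero_lt_one))
  have hwk : w ≫ projectiveLineToSpec k = Spec.map (CommRingCat.ofHom (lineChartBase k)) :=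
    (Proj.awayι_toSpecZero_assoc _ _ (X_mem_homogeneousSubmodule k 0) zero_lt_one _).trans
      (Spec.map_comp _ _).symm
  refine ⟨Spec.map e'.inv ≫ w, inferInstance, ?_⟩
  rw [Category.assoc, hwk, ← Spec.map_comp]
  congr 1
  rw [Iso.comp_inv_eq]
  refine CommRingCat.hom_ext (RingHom.ext fun c ↦ ?_)
  exact (Polynomial.eval₂_C (lineChartBase k) _).symm

variable {k} {Y : Scheme.{u}} {sY : Y ⟶ Spec (CommRingCat.of k)}

/-- `R` is the coordinate ring of a non-empty affine open subset of `Y`, and `R ⊗ k[X] = R[X]`. -/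
theorem exists_chart (hY : IsVariety sY) :
    ∃ (R : Type u) (_ : CommRing R) (_ : IsDomain R) (_ : Algebra k R) (_ : Algebra.FiniteType k R)
      (j : Spec (CommRingCat.of (Polynomial R)) ⟶ Limits.pullback sY (projectiveLineToSpec k)),
      IsOpenImmersion j ∧ j ≫ Limits.pullback.fst sY (projectiveLineToSpec k) ≫ sY =
        Spec.map (CommRingCat.ofHom (algebraMap k (Polynomial R))) := by
  obtain ⟨hint, hft, -⟩ := hY
  let _ : Y.Over (Spec (CommRingCat.of k)) := ⟨sY⟩
  obtain ⟨_, ⟨V, hV, rfl⟩, hη, -⟩ :=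
    Y.isBasis_affineOpens.exists_subset_of_mem_open (Set.mem_univ (genericPoint Y)) isOpen_univ
  have : Nonempty V := ⟨⟨_, hη⟩⟩
  obtain ⟨b, hb, hbk⟩ := exists_affineLine_to_projectiveLine k
  have hft' : LocallyOfFiniteType (Y ↘ Spec (CommRingCat.of k)) := hft
  have hV' : hV.fromSpec ≫ sY = Spec.map (CommRingCat.ofHom (algebraMap k Γ(Y, V))) :=
    fromSpec_over (k := k) hV
  let e : CommRingCat.of (Polynomial Γ(Y, V)) ≅ CommRingCat.of (Γ(Y, V) ⊗[k] Polynomial k) :=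
    (polyEquivTensor k Γ(Y, V)).toRingEquiv.toCommRingCatIso
  have : IsOpenImmersion hV.fromSpec := hV.isOpenImmersion_fromSpec
  let p := Limits.pullback.map _ _ sY (projectiveLineToSpec k) hV.fromSpec b (𝟙 _)
    ((Category.comp_id _).trans hV'.symm) ((Category.comp_id _).trans hbk.symm)
  have hp : IsOpenImmersion p := Scheme.pullback_map_isOpenImmersion _ _ _ _ _ _ _ _ _
  refine ⟨Γ(Y, V), inferInstance, inferInstance, inferInstance, finiteType_sections hV,
    Spec.map e.inv ≫ (pullbackSpecIso k Γ(Y, V) (Polynomial k)).inv ≫ p, inferInstance, ?_⟩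
  have hpf : p ≫ Limits.pullback.fst sY (projectiveLineToSpec k) ≫ sY =
      Limits.pullback.fst _ _ ≫ Spec.map (CommRingCat.ofHom (algebraMap k Γ(Y, V))) := by
    rw [Limits.pullback.lift_fst_assoc, Category.assoc, hV']
  rw [Category.assoc, Category.assoc, hpf, pullbackSpecIso_inv_fst_assoc, ← Spec.map_comp,
    ← Spec.map_comp]
  congr 1
  refine CommRingCat.hom_ext (RingHom.ext fun c ↦ ?_)
  change (polyEquivTensor k Γ(Y, V)).symm (algebraMap k Γ(Y, V) c ⊗ₜ 1) = _
  rw [← Algebra.TensorProduct.algebraMap_apply]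
  exact (polyEquivTensor k Γ(Y, V)).symm.commutes c

end Chart

end SepRuled

namespace SepRuled

/-! ### Function fields of ruled varieties and of dominant maps. -/

section FunctionFields

/-- An open immersion induces an isomorphism of function fields. -/
noncomputable def functionFieldIso {A B : Scheme.{u}} [IrreducibleSpace A] [IrreducibleSpace B]
    (g : A ⟶ B) [IsOpenImmersion g] : B.functionField ≅ A.functionField :=
  B.presheaf.stalkCongr (.of_eq (genericPoint_eq_of_isOpenImmersion g).symm) ≪≫
    asIso (g.stalkMap (genericPoint A))

theorem functionFieldIso_fromSpecStalk {A B : Scheme.{u}} [IrreducibleSpace A] [IrreducibleSpace B]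
    (g : A ⟶ B) [IsOpenImmersion g] : Spec.map (functionFieldIso g).hom ≫ B.fromSpecStalk _ =
      A.fromSpecStalk _ ≫ g := by
  rw [functionFieldIso, Iso.trans_hom, Spec.map_comp, Category.assoc, TopCat.Presheaf.stalkCongr_hom]
  exact (congrArg _ (Scheme.SpecMap_stalkSpecializes_fromSpecStalk _)).trans
    (Scheme.SpecMap_stalkMap_fromSpecStalk g)

theorem exists_toFunctionField (R : CommRingCat.{u}) [IsDomain R] :
    ∃ τ : R ⟶ (Spec R).functionField, (Spec R).fromSpecStalk (genericPoint (Spec R)) = Spec.map τ ∧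
      Function.Injective τ ∧ ∀ y, ∃ a b, y = τ a / τ b :=
  ⟨CommRingCat.ofHom (algebraMap R (Spec R).functionField),
    AlgebraicGeometry.Spec.fromSpecStalk_eq' _ _, IsFractionRing.injective R (Spec R).functionField,
    fun y ↦ by
      obtain ⟨a, b, -, rfl⟩ := IsFractionRing.div_surjective (A := R) y
      exact ⟨a, b, rfl⟩⟩

variable {k : Type u} [Field k]

/-- The part `O` of the chart `Spec R[X]` on which the birational map is defined is open in both
`Spec R[X]` and `W`, so the two function fields are isomorphic over `k`. -/
theorem exists_ruling {W : Scheme.{u}} [IsIntegral W] [W.Over (Spec (CommRingCat.of k))]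
    (h : IsRuled (W ↘ Spec (CommRingCat.of k))) :
    ∃ (R : Type u) (_ : CommRing R) (_ : IsDomain R) (_ : Algebra k R) (_ : Algebra.FiniteType k R)
      (ψ : Polynomial R →+* W.functionField), Function.Injective ψ ∧
        (∀ x, ∃ f g, x = ψ f / ψ g) ∧
        ∀ c, ψ (algebraMap k _ c) = algebraMap k W.functionField c := by
  obtain ⟨Y, sY, hY, f, hf⟩ := h
  obtain ⟨R, _, _, _, hR, j, hj, hjk⟩ := exists_chart hY
  let O := j ⁻¹ᵁ f.target
  have hO : Nonempty O := by
    obtain ⟨y, ⟨x, rfl⟩, hy⟩ := f.dense_target.inter_open_nonempty (Set.range j)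
      j.isOpenEmbedding.isOpen_range (Set.range_nonempty j)
    exact ⟨⟨x, hy⟩⟩
  have hint : IsIntegral O.toScheme := inferInstance
  let l : O.toScheme ⟶ f.target := IsOpenImmersion.lift f.target.ι (O.ι ≫ j) (by
    rintro _ ⟨x, rfl⟩
    exact Set.mem_range.mpr ⟨⟨_, x.2⟩, rfl⟩)
  have hl : l ≫ f.target.ι = O.ι ≫ j := IsOpenImmersion.lift_fac _ _ _
  have hl' : IsOpenImmersion l := by
    have : IsOpenImmersion (l ≫ f.target.ι) := hl ▸ inferInstance
    exact IsOpenImmersion.of_comp l f.target.ι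
  let J : O.toScheme ⟶ W := l ≫ f.iso.inv ≫ f.source.ι
  have hJ : J ≫ (W ↘ Spec (CommRingCat.of k)) =
      O.ι ≫ Spec.map (CommRingCat.ofHom (algebraMap k (Polynomial R))) := by
    have h1 : f.iso.inv ≫ f.source.ι ≫ (W ↘ Spec (CommRingCat.of k)) = f.target.ι ≫
        (Limits.pullback.fst sY (projectiveLineToSpec k) ≫ sY) := hf.symm
    rw [← hjk, Category.assoc, Category.assoc, h1, reassoc_of% hl]
  let B := CommRingCat.of (Polynomial R)
  have : IsDomain B := inferInstanceAs (IsDomain (Polynomial R))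
  obtain ⟨τ, hτ, hinj, hfrac⟩ := exists_toFunctionField B
  let Θ : (Spec B).functionField ≅ W.functionField := functionFieldIso O.ι ≪≫ (functionFieldIso J).symm
  refine ⟨R, _, ‹_›, _, hR, (τ ≫ Θ.hom).hom, ?_, ?_, ?_⟩
  · exact (ConcreteCategory.bijective_of_isIso Θ.hom).1.comp hinj
  · intro x
    obtain ⟨y, rfl⟩ := (ConcreteCategory.bijective_of_isIso Θ.hom).2 x
    obtain ⟨a, b, rfl⟩ := hfrac y
    exact ⟨a, b, map_div₀ Θ.hom.hom _ _⟩
  · have : CommRingCat.ofHom (algebraMap k (Polynomial R)) ≫ τ ≫ Θ.hom =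
        CommRingCat.ofHom (algebraMap k W.functionField) := by
      have e : Θ.hom = (functionFieldIso O.ι).hom ≫ (functionFieldIso J).inv := rfl
      rw [e, ← Category.assoc, ← Category.assoc, Iso.comp_inv_eq]
      apply Spec.map_injective
      rw [Spec.map_comp, Spec.map_comp, Spec.map_comp, ← hτ, reassoc_of% functionFieldIso_fromSpecStalk, ← hJ,
        ← fromSpecStalk_over, reassoc_of% functionFieldIso_fromSpecStalk]
    exact fun c ↦ ConcreteCategory.congr_hom this c

variable {X W : Scheme.{u}} [IsIntegral X] [IsIntegral W]

theorem functionFieldMap_fromSpecStalk (f : X ⤏ W) [f.IsDominant] :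
    Spec.map (functionFieldMap f) ≫ W.fromSpecStalk _ = f.fromFunctionField := by
  rw [functionFieldMap, Spec.map_comp, Category.assoc, Scheme.SpecMap_stalkSpecializes_fromSpecStalk]
  exact Scheme.Spec_stalkClosedPointTo_fromSpecStalk _

/-- The constants in a local ring of a scheme over `k`. -/
noncomputable def baseToStalk (k : Type u) [Field k] {X : Scheme.{u}}
    [X.Over (Spec (CommRingCat.of k))] (x : X) : CommRingCat.of k ⟶ X.presheaf.stalk x :=
  CommRingCat.ofHom (algebraMap k (X.presheaf.stalk x))

theorem baseToStalk_comp_functionFieldMap [X.Over (Spec (CommRingCat.of k))]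
    [W.Over (Spec (CommRingCat.of k))] (f : X ⤏ W) [f.IsDominant]
    (hf : f.compHom (W ↘ Spec (CommRingCat.of k)) = (X ↘ Spec (CommRingCat.of k)).toRationalMap) :
    baseToStalk k (genericPoint W) ≫ functionFieldMap f = baseToStalk k (genericPoint X) := by
  have h1 : (f.compHom (W ↘ Spec (CommRingCat.of k))).fromFunctionField =
      f.fromFunctionField ≫ (W ↘ Spec (CommRingCat.of k)) := by
    obtain ⟨g, rfl⟩ := f.exists_rep
    rw [← Scheme.RationalMap.compHom_toRationalMap, Scheme.RationalMap.fromFunctionField_toRationalMap,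
      Scheme.RationalMap.fromFunctionField_toRationalMap]
    exact Scheme.PartialMap.fromSpecStalkOfMem_compHom _ _ _ _
  have h2 : (X ↘ Spec (CommRingCat.of k)).toRationalMap.fromFunctionField =
      X.fromSpecStalk _ ≫ (X ↘ Spec (CommRingCat.of k)) := by
    refine (Scheme.RationalMap.fromFunctionField_toRationalMap _).trans ?_
    exact Scheme.PartialMap.fromSpecStalkOfMem_toPartialMap _ _
  have e1 : _ = Spec.map (baseToStalk k (genericPoint W)) := fromSpecStalk_over (genericPoint W)
  have e2 : _ = Spec.map (baseToStalk k (genericPoint X)) := fromSpecStalk_over (genericPoint X)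
  apply Spec.map_injective
  rw [Spec.map_comp, ← e1, ← e2, ← Category.assoc, functionFieldMap_fromSpecStalk, ← h1, hf, h2]

theorem functionFieldMap_comp_algebraMap [X.Over (Spec (CommRingCat.of k))]
    [W.Over (Spec (CommRingCat.of k))] (f : X ⤏ W) [f.IsDominant]
    (hf : f.compHom (W ↘ Spec (CommRingCat.of k)) = (X ↘ Spec (CommRingCat.of k)).toRationalMap) :
    (functionFieldMap f).hom.comp (algebraMap k (W.presheaf.stalk (genericPoint W))) =
      algebraMap k (X.presheaf.stalk (genericPoint X)) :=
  congrArg CommRingCat.Hom.hom (baseToStalk_comp_functionFieldMap f hf)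

end FunctionFields

end SepRuled

namespace SepRuled

/-! ### Points with values in `k`. -/

section Points

variable {k : Type*} [Field k] [IsAlgClosed k]

/-- Lying over: a maximal ideal above the kernel of `y` has residue field integral over `k`, hence
equal to `k`. -/
theorem exists_ringHom_extension {A B : Type*} [CommRing A] [CommRing B] [Algebra k A] [Algebra A B]
    [Algebra.IsIntegral A B] (hinj : Function.Injective (algebraMap A B)) (y : A →ₐ[k] k) :
    ∃ z : B →+* k, ∀ a, z (algebraMap A B a) = y a := by
  have hy : Function.Surjective y := fun c ↦ ⟨algebraMap k A c, y.commutes c⟩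
  have hmax : (RingHom.ker y).IsMaximal := RingHom.ker_isMaximal_of_surjective y hy
  obtain ⟨Q, hQ, hQA⟩ := Ideal.exists_ideal_over_maximal_of_isIntegral (S := B) (RingHom.ker y) (by
    rw [(RingHom.injective_iff_ker_eq_bot _).mp hinj]
    exact bot_le)
  let _ : Field (B ⧸ Q) := Ideal.Quotient.field Q
  let _ : Algebra k (B ⧸ Q) := ((Ideal.Quotient.mk Q).comp ((algebraMap A B).comp (algebraMap k A))).toAlgebra
  have hA (a : A) : Ideal.Quotient.mk Q (algebraMap A B a) = algebraMap k (B ⧸ Q) (y a) := by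
    refine Ideal.Quotient.eq.mpr ?_
    have : a - algebraMap k A (y a) ∈ RingHom.ker y := by
      rw [RingHom.mem_ker, map_sub, y.commutes]
      exact sub_self _
    rw [← hQA, Ideal.mem_comap, map_sub] at this
    exact this
  have hint : Algebra.IsIntegral k (B ⧸ Q) := by
    refine ⟨fun b ↦ ?_⟩
    obtain ⟨b, rfl⟩ := Ideal.Quotient.mk_surjective b
    obtain ⟨p, hp, hb⟩ := Algebra.IsIntegral.isIntegral (R := A) b
    refine ⟨p.map y.toRingHom, hp.map _, ?_⟩
    rw [Polynomial.eval₂_map]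
    have h1 : (algebraMap k (B ⧸ Q)).comp y.toRingHom = (Ideal.Quotient.mk Q).comp (algebraMap A B) :=
      RingHom.ext fun a ↦ (hA a).symm
    rw [h1, ← Polynomial.hom_eval₂, hb, map_zero]
  have hbij := IsAlgClosed.algebraMap_bijective_of_isIntegral (k := k) (K := B ⧸ Q)
  let e := RingEquiv.ofBijective _ hbij
  refine ⟨e.symm.toRingHom.comp (Ideal.Quotient.mk Q), fun a ↦ ?_⟩
  change e.symm (Ideal.Quotient.mk Q (algebraMap A B a)) = y a
  rw [hA]
  exact e.symm_apply_apply _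

theorem nonempty_algHom_of_finiteType (R : Type*) [CommRing R] [Nontrivial R] [Algebra k R]
    [Algebra.FiniteType k R] : Nonempty (R →ₐ[k] k) := by
  obtain ⟨m, hm⟩ := Ideal.exists_maximal R
  let _ : Field (R ⧸ m) := Ideal.Quotient.field m
  have : Module.Finite k (R ⧸ m) := finite_of_finite_type_of_isJacobsonRing k (R ⧸ m)
  have hbij := IsAlgClosed.algebraMap_bijective_of_isIntegral (k := k) (K := R ⧸ m)
  exact ⟨(AlgEquiv.ofBijective (Algebra.ofId k (R ⧸ m)) hbij).symm.toAlgHom.comp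
    (Ideal.Quotient.mkₐ k m)⟩

theorem exists_algHom_apply_ne_zero (R : Type*) [CommRing R] [IsDomain R] [Algebra k R]
    [Algebra.FiniteType k R] {r : R} (hr : r ≠ 0) : ∃ y : R →ₐ[k] k, y r ≠ 0 := by
  have : Nontrivial (Localization.Away r) := by
    refine (IsLocalization.injective (Localization.Away r)
      (powers_le_nonZeroDivisors_of_noZeroDivisors hr)).nontrivial
  have : Algebra.FiniteType R (Localization.Away r) :=
    RingHom.finiteType_algebraMap.mp (RingHom.finiteType_holdsForLocalizationAway _ r)
  have : Algebra.FiniteType k (Localization.Away r) := Algebra.FiniteType.trans (S := R) ‹_› ‹_›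
  obtain ⟨y⟩ := nonempty_algHom_of_finiteType (k := k) (Localization.Away r)
  refine ⟨y.comp (IsScalarTower.toAlgHom k R _), ?_⟩
  exact ((IsLocalization.Away.algebraMap_isUnit r).map y).ne_zero

end Points

end SepRuled

namespace SepRuled

/-! ### The fibre over one point, through the conjugates of `L`. -/

section Fibre

variable {k T F L Ω S : Type*} [Field k] [CommRing T] [Field F] [Field L] [Field Ω]
  [CommRing S] [Algebra T F] [Algebra T L] [Algebra F L]
  [Algebra S L] [Algebra T Ω] [Algebra F Ω] [IsScalarTower T F L] [IsScalarTower T F Ω]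

/-- The specialisation of a conjugate of `S` at a point of the integral closure of `T`. -/
noncomputable def conjPoint (z : integralClosure T Ω →+* k) (σ : L →ₐ[F] Ω)
    (hS : ∀ s : S, IsIntegral T (algebraMap S L s)) : S →+* k :=
  z.comp ((σ.toRingHom.comp (algebraMap S L)).codRestrict (integralClosure T Ω).toSubring fun s ↦
    (hS s).map (σ.restrictScalars T))

theorem conjPoint_apply (z : integralClosure T Ω →+* k) (σ : L →ₐ[F] Ω)
    (hS : ∀ s : S, IsIntegral T (algebraMap S L s)) (s : S) : conjPoint z σ hS s =
      z ⟨σ (algebraMap S L s), (hS s).map (σ.restrictScalars T)⟩ := rfl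

theorem ringHom_ne_zero_of_isIntegral_inv (z : integralClosure T Ω →+* k) {x : Ω} (hx : IsIntegral T x)
    (hx' : IsIntegral T x⁻¹) (h0 : x ≠ 0) : z ⟨x, hx⟩ ≠ 0 := by
  have h : (⟨x, hx⟩ : integralClosure T Ω) * ⟨x⁻¹, hx'⟩ = 1 := Subtype.ext (mul_inv_cancel₀ h0)
  intro h1
  have := congrArg z h
  rw [map_mul, h1, zero_mul, map_one] at this
  exact zero_ne_one this

variable [Algebra k T] [Algebra k L] [Algebra k S] [IsScalarTower k T L] [IsScalarTower k S L]
  [IsAlgClosed k] [IsAlgClosed Ω] [FiniteDimensional F L] [Algebra.IsSeparable F L]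

/-- Extend `y` to a point `z` of the integral closure of `T` in `Ω`; the points of the fibre are `z
∘ σ` for the embeddings `σ` of `L`. The trace is the sum of the conjugates, so its value at `y` is
the sum over the fibre with weights `z (σ c)`. Elements integral along with their inverses have
non-zero values: hence the non-zero weights and values of `g`, and the distinctness of the points.
-/
theorem exists_points_over (hT : Function.Injective (algebraMap T Ω))
    (hS : ∀ s : S, IsIntegral T (algebraMap S L s)) {c : L} (hc0 : c ≠ 0) {g : S} (hg0 : algebraMap S L g ≠ 0)
    (hc : ∀ σ : L →ₐ[F] Ω, IsIntegral T (σ c)) (hc' : ∀ σ : L →ₐ[F] Ω, IsIntegral T (σ c)⁻¹)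
    (hg : ∀ σ : L →ₐ[F] Ω, IsIntegral T (σ (algebraMap S L g))⁻¹)
    (hsep : ∀ σ τ : L →ₐ[F] Ω, σ ≠ τ → ∃ s : S, σ (algebraMap S L s) ≠ τ (algebraMap S L s) ∧
      IsIntegral T (σ (algebraMap S L s) - τ (algebraMap S L s))⁻¹) (y : T →ₐ[k] k) :
    ∃ (χ : (L →ₐ[F] Ω) → S →ₐ[k] k) (w : (L →ₐ[F] Ω) → k), Function.Injective χ ∧
      (∀ σ, χ σ g ≠ 0) ∧ (∀ σ, w σ ≠ 0) ∧
      (∀ a q, Algebra.trace F L (algebraMap S L a * c) = algebraMap T F q →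
        ∑ σ, w σ * χ σ a = y q) ∧
      ∀ σ q s s', algebraMap T L q * algebraMap S L s = algebraMap S L s' →
        y q * χ σ s = χ σ s' := by
  have hinj : Function.Injective (algebraMap T (integralClosure T Ω)) := fun a b h ↦
    hT (congrArg Subtype.val h)
  obtain ⟨z, hz⟩ := exists_ringHom_extension hinj y
  have hmul (σ : L →ₐ[F] Ω) (q : T) (s s' : S)
      (h : algebraMap T L q * algebraMap S L s = algebraMap S L s') :
      y q * conjPoint z σ hS s = conjPoint z σ hS s' := by
    rw [← hz, conjPoint_apply, conjPoint_apply, ← map_mul]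
    refine congrArg z (Subtype.ext ?_)
    change algebraMap T Ω q * σ (algebraMap S L s) = σ (algebraMap S L s')
    rw [← h, map_mul]
    exact congrArg (· * _) ((σ.restrictScalars T).commutes q).symm
  let χ (σ : L →ₐ[F] Ω) : S →ₐ[k] k :=
    { conjPoint z σ hS with
      commutes' := fun r ↦ by
        have := hmul σ (algebraMap k T r) 1 (algebraMap k S r) (by
          rw [map_one, mul_one, ← IsScalarTower.algebraMap_apply, ← IsScalarTower.algebraMap_apply])
        rw [map_one, mul_one, y.commutes] at this
        exact this.symm }
  have hχ (σ : L →ₐ[F] Ω) (s : S) : χ σ s = conjPoint z σ hS s := rfl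
  refine ⟨χ, fun σ ↦ z ⟨σ c, hc σ⟩, fun σ τ hστ ↦ ?_, fun σ ↦ ?_, fun σ ↦ ?_, fun a q h ↦ ?_, hmul⟩
  · by_contra hne
    obtain ⟨s, hs, hs'⟩ := hsep σ τ hne
    refine ringHom_ne_zero_of_isIntegral_inv z (((hS s).map (σ.restrictScalars T)).sub
      ((hS s).map (τ.restrictScalars T))) hs' (sub_ne_zero.mpr hs) ?_
    have h1 := DFunLike.congr_fun hστ s
    rw [hχ, hχ, conjPoint_apply, conjPoint_apply, ← sub_eq_zero, ← map_sub] at h1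
    exact h1
  · exact ringHom_ne_zero_of_isIntegral_inv z ((hS g).map (σ.restrictScalars T)) (hg σ)
      ((map_ne_zero σ).mpr hg0)
  · exact ringHom_ne_zero_of_isIntegral_inv z (hc σ) (hc' σ) ((map_ne_zero σ).mpr hc0)
  · rw [← hz]
    simp only [hχ, conjPoint_apply, ← map_mul, ← map_sum]
    refine congrArg z (Subtype.ext ?_)
    change _ = algebraMap T Ω q
    rw [IsScalarTower.algebraMap_apply T F Ω, ← h, trace_eq_sum_embeddings Ω,
      AddSubmonoidClass.coe_finsetSum]
    refine Finset.sum_congr rfl fun σ _ ↦ ?_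
    rw [map_mul, mul_comm]
    rfl

end Fibre

end SepRuled

namespace SepRuled

universe v

/-! ### Finitely many conditions on the base. -/

section Denominators

variable {k F L Ω S : Type*} [Field k] [Field F] [Field L] [Field Ω]
  [CommRing S] [Algebra k L] [Algebra k S] [Algebra F L] [Algebra S L] [Algebra F Ω]
  [IsScalarTower k S L]

theorem isIntegral_of_coeff_mem_range {T : Type*} [CommRing T] [Algebra T F] [Algebra T Ω]
    [IsScalarTower T F Ω] {x : Ω} (hx : IsIntegral F x)
    (h : ∀ j, (minpoly F x).coeff j ∈ Set.range (algebraMap T F)) : IsIntegral T x := by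
  obtain ⟨q, hq, -, hm⟩ := Polynomial.lifts_and_degree_eq_and_monic
    ((Polynomial.lifts_iff_coeff_lifts _).mpr h) (minpoly.monic hx)
  refine ⟨q, hm, ?_⟩
  rw [IsScalarTower.algebraMap_eq T F Ω, ← Polynomial.eval₂_map, hq]
  exact minpoly.aeval F x

theorem exists_finite_isIntegral (Z : Set Ω) (hZ : Z.Finite) [Algebra.IsAlgebraic F Ω] :
    ∃ E : Set F, E.Finite ∧ ∀ (T : Type v) [CommRing T] [Algebra T F] [Algebra T Ω]
      [IsScalarTower T F Ω], E ⊆ Set.range (algebraMap T F) → ∀ x ∈ Z, IsIntegral T x := by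
  refine ⟨⋃ x ∈ Z, ((minpoly F x).coeffs : Set F), hZ.biUnion fun x _ ↦ Finset.finite_toSet _,
    fun T _ _ _ _ hE x hx ↦ isIntegral_of_coeff_mem_range (F := F)
      (Algebra.IsIntegral.isIntegral x) fun j ↦ ?_⟩
  by_cases hj : (minpoly F x).coeff j = 0
  · exact ⟨0, by rw [hj, map_zero]⟩
  · exact hE (Set.mem_biUnion hx (Polynomial.coeff_mem_coeffs hj))

/-- Once `T` contains the structure constants of a basis `ε` and the coordinates of `1` and of
generators of `S`, the `T`-span of `ε` is a finite `T`-algebra containing `S`. The traces then only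
involve the finitely many `Tr(ε j * c)`. -/
theorem exists_finite_trace_mem [FiniteDimensional F L] [Algebra.FiniteType k S] (c : L) :
    ∃ E : Set F, E.Finite ∧ ∀ (T : Type v) [CommRing T] [Algebra T F] [Algebra T L] [Algebra k T]
      [IsScalarTower T F L] [IsScalarTower k T L], E ⊆ Set.range (algebraMap T F) →
      (∀ s : S, IsIntegral T (algebraMap S L s)) ∧
        ∀ s : S, Algebra.trace F L (algebraMap S L s * c) ∈ Set.range (algebraMap T F) := by
  obtain ⟨G, hG⟩ := Algebra.FiniteType.out (R := k) (A := S)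
  let ε := Module.finBasis F L
  let X : Set L := {1} ∪ Set.range (fun p : _ × _ ↦ ε p.1 * ε p.2) ∪ algebraMap S L '' G
  have hX : X.Finite := ((Set.finite_singleton _).union (Set.finite_range _)).union
    (G.finite_toSet.image _)
  refine ⟨(⋃ x ∈ X, Set.range (ε.repr x)) ∪ Set.range fun j ↦ Algebra.trace F L (ε j * c),
    (hX.biUnion fun _ _ ↦ Set.finite_range _).union (Set.finite_range _),
    fun T _ _ _ _ _ _ hE ↦ ?_⟩
  let N : Submodule T L := Submodule.span T (Set.range ε)
  have hXN : ∀ x ∈ X, x ∈ N := by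
    intro x hx
    rw [← ε.sum_repr x]
    refine Submodule.sum_mem _ fun j _ ↦ ?_
    obtain ⟨t, ht⟩ := hE (Or.inl (Set.mem_biUnion hx ⟨j, rfl⟩))
    rw [← ht, algebraMap_smul]
    exact Submodule.smul_mem _ _ (Submodule.subset_span ⟨j, rfl⟩)
  have hmul : ∀ x y, x ∈ N → y ∈ N → x * y ∈ N := by
    have h : N * N ≤ N := by
      rw [Submodule.span_mul_span, Submodule.span_le]
      rintro _ ⟨_, ⟨i, rfl⟩, _, ⟨j, rfl⟩, rfl⟩
      exact hXN _ (Or.inl (Or.inr ⟨(i, j), rfl⟩))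
    exact fun x y hx hy ↦ h (Submodule.mul_mem_mul hx hy)
  let B : Subalgebra T L := N.toSubalgebra (hXN _ (Or.inl (Or.inl rfl))) hmul
  have hB : B.toSubmodule.FG := ⟨(Set.finite_range ε).toFinset, by
    rw [Set.Finite.coe_toFinset]
    rfl⟩
  have hSB (s : S) : algebraMap S L s ∈ B := by
    have hs : s ∈ Algebra.adjoin k (G : Set S) := hG ▸ trivial
    induction hs using Algebra.adjoin_induction with
    | mem x hx => exact hXN _ (Or.inr ⟨x, hx, rfl⟩)
    | algebraMap r =>
      rw [← IsScalarTower.algebraMap_apply, IsScalarTower.algebraMap_apply k T L]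
      exact B.algebraMap_mem _
    | add x y _ _ hx hy => rw [map_add]; exact add_mem hx hy
    | mul x y _ _ hx hy => rw [map_mul]; exact mul_mem hx hy
  refine ⟨fun s ↦ IsIntegral.of_mem_of_fg B hB _ (hSB s), fun s ↦ ?_⟩
  have hs : algebraMap S L s ∈ N := hSB s
  generalize algebraMap S L s = x at hs ⊢
  induction hs using Submodule.span_induction with
  | mem x hx => obtain ⟨j, rfl⟩ := hx; exact hE (Or.inr ⟨j, rfl⟩)
  | zero => exact ⟨0, by simp⟩
  | add x y _ _ hx hy =>
    obtain ⟨p, hp⟩ := hx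
    obtain ⟨q, hq⟩ := hy
    exact ⟨p + q, by rw [map_add, hp, hq, add_mul, map_add]⟩
  | smul t x _ hx =>
    obtain ⟨p, hp⟩ := hx
    exact ⟨t * p, by rw [map_mul, hp, ← algebraMap_smul F t x, smul_mul_assoc, map_smul, smul_eq_mul]⟩

theorem exists_algebraMap_ne [IsFractionRing S L] {σ τ : L →ₐ[F] Ω} (h : σ ≠ τ) :
    ∃ s : S, σ (algebraMap S L s) ≠ τ (algebraMap S L s) := by
  by_contra! hs
  refine h (AlgHom.ext fun x ↦ ?_)
  obtain ⟨a, b, -, rfl⟩ := IsFractionRing.div_surjective (A := S) x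
  rw [map_div₀, map_div₀, hs, hs]

/-- The hypotheses of `exists_points_over` ask that finitely many further elements of `Ω` be
integral, so it suffices to put the coefficients of their minimal polynomials into `T`. -/
theorem exists_finite_points [IsAlgClosed k] [IsAlgClosed Ω] [FiniteDimensional F L]
    [Algebra.IsSeparable F L] [Algebra.IsAlgebraic F Ω] [Algebra.FiniteType k S]
    [IsFractionRing S L] {c : L} (hc : c ≠ 0) {g : S} (hg : algebraMap S L g ≠ 0) :
    ∃ E : Set F, E.Finite ∧ ∀ (T : Type v) [CommRing T] [Algebra T F] [Algebra T L] [Algebra T Ω]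
      [Algebra k T] [IsScalarTower T F L] [IsScalarTower T F Ω] [IsScalarTower k T L],
      E ⊆ Set.range (algebraMap T F) → Function.Injective (algebraMap T F) →
      (∀ s : S, Algebra.trace F L (algebraMap S L s * c) ∈ Set.range (algebraMap T F)) ∧
      ∀ y : T →ₐ[k] k, ∃ (χ : (L →ₐ[F] Ω) → S →ₐ[k] k) (w : (L →ₐ[F] Ω) → k),
        Function.Injective χ ∧ (∀ σ, χ σ g ≠ 0) ∧ (∀ σ, w σ ≠ 0) ∧
        (∀ a q, Algebra.trace F L (algebraMap S L a * c) = algebraMap T F q →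
          ∑ σ, w σ * χ σ a = y q) ∧
        ∀ σ q s s', algebraMap T L q * algebraMap S L s = algebraMap S L s' →
          y q * χ σ s = χ σ s' := by
  classical
  obtain ⟨E₁, hE₁, h₁⟩ := exists_finite_trace_mem.{v} (k := k) (F := F) (S := S) c
  choose! f hf using fun (p : (L →ₐ[F] Ω) × (L →ₐ[F] Ω)) (h : p.1 ≠ p.2) ↦
    exists_algebraMap_ne (S := S) h
  let Z : Set Ω := (Set.range fun σ : L →ₐ[F] Ω ↦ σ c) ∪ (Set.range fun σ : L →ₐ[F] Ω ↦ (σ c)⁻¹) ∪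
    (Set.range fun σ : L →ₐ[F] Ω ↦ (σ (algebraMap S L g))⁻¹) ∪
    Set.range fun p : (L →ₐ[F] Ω) × (L →ₐ[F] Ω) ↦
      (p.1 (algebraMap S L (f p)) - p.2 (algebraMap S L (f p)))⁻¹
  have hZ : Z.Finite := (((Set.finite_range _).union (Set.finite_range _)).union
    (Set.finite_range _)).union (Set.finite_range _)
  obtain ⟨E₂, hE₂, h₂⟩ := exists_finite_isIntegral.{v} (F := F) Z hZ
  refine ⟨E₁ ∪ E₂, hE₁.union hE₂, fun T _ _ _ _ _ _ _ _ hE hT ↦ ?_⟩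
  obtain ⟨hS, htr⟩ := h₁ T (Set.subset_union_left.trans hE)
  have hZT := h₂ T (Set.subset_union_right.trans hE)
  refine ⟨htr, fun y ↦ ?_⟩
  have hTΩ : Function.Injective (algebraMap T Ω) := by
    rw [IsScalarTower.algebraMap_eq T F Ω]
    exact (algebraMap F Ω).injective.comp hT
  refine exists_points_over hTΩ hS hc hg (fun σ ↦ hZT _ (Or.inl (Or.inl (Or.inl ⟨σ, rfl⟩))))
    (fun σ ↦ hZT _ (Or.inl (Or.inl (Or.inr ⟨σ, rfl⟩)))) (fun σ ↦ hZT _ (Or.inl (Or.inr ⟨σ, rfl⟩)))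
    (fun σ τ hστ ↦ ⟨f (σ, τ), hf (σ, τ) hστ, hZT _ (Or.inr ⟨(σ, τ), rfl⟩)⟩) y

end Denominators

end SepRuled

namespace SepRuled

universe v

/-! ### Fibres over several points of one line of the ruling. -/

section Fibres

open Polynomial

variable {k R : Type*} [Field k] [CommRing R] [Algebra k R]

theorem exists_injective_eval_ne_zero [Infinite k] (N : ℕ) {h : R[X]} (y : R →ₐ[k] k)
    (hy : y h.leadingCoeff ≠ 0) : ∃ τ : Fin N → k, Function.Injective τ ∧
      ∀ i, (h.map (y : R →+* k)).eval (τ i) ≠ 0 := by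
  classical
  have h0 : h.map (y : R →+* k) ≠ 0 := fun h0 ↦ hy (by
    have := congrArg (fun p ↦ p.coeff h.natDegree) h0
    simpa using this)
  have hinf : Set.Infinite {a : k | (h.map (y : R →+* k)).eval a ≠ 0} := by
    have hf : Set.Finite {a : k | (h.map (y : R →+* k)).IsRoot a} := by
      refine (h.map (y : R →+* k)).roots.toFinset.finite_toSet.subset fun a ha ↦ ?_
      exact Multiset.mem_toFinset.mpr ((mem_roots h0).mpr ha)
    exact hf.infinite_compl
  let e := hinf.natEmbedding
  exact ⟨fun i ↦ (e i : k), fun i j hij ↦ Fin.ext (e.injective (Subtype.ext hij)), fun i ↦ (e i).2⟩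

/-- Evaluation of a fraction `p / hᵐ` at a point `(y, τ)` of `Spec R × 𝔸¹`. -/
noncomputable def awayEval (y : R →ₐ[k] k) {h : R[X]} (τ : k)
    (hτ : (h.map (y : R →+* k)).eval τ ≠ 0) : Localization.Away h →ₐ[k] k :=
  { IsLocalization.Away.lift (S := Localization.Away h) h
      (g := eval₂RingHom (y : R →+* k) τ) (by
        rw [coe_eval₂RingHom, ← Polynomial.eval_map]
        exact hτ.isUnit) with
    commutes' := fun r ↦ by
      change IsLocalization.Away.lift (S := Localization.Away h) h _ (algebraMap k _ r) = _
      rw [IsScalarTower.algebraMap_apply k R[X] (Localization.Away h), IsLocalization.Away.lift_eq]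
      simp [Polynomial.algebraMap_apply] }

theorem awayEval_algebraMap (y : R →ₐ[k] k) {h : R[X]} (τ : k)
    (hτ : (h.map (y : R →+* k)).eval τ ≠ 0) (p : R[X]) :
    awayEval y τ hτ (algebraMap _ _ p) = (p.map (y : R →+* k)).eval τ := by
  rw [Polynomial.eval_map]
  exact IsLocalization.Away.lift_eq h (g := eval₂RingHom (y : R →+* k) τ)
    (by rw [coe_eval₂RingHom, ← Polynomial.eval_map]; exact hτ.isUnit) p

/-- An element of `Frac R` inside `R[X]_h` is constant on the line over `y`. As `r'` may vanish at
`y`, the relation `p r' = r hᵐ` is first compared with its leading coefficients to give `lc(h)ᵐ p =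
lc(p) hᵐ`, which can be evaluated. -/
theorem awayEval_eq [IsDomain R] (y : R →ₐ[k] k) {h : R[X]} (hy : y h.leadingCoeff ≠ 0)
    {q : Localization.Away h} {r r' : R} (hr' : r' ≠ 0)
    (hq : q * algebraMap _ _ (C r') = algebraMap _ _ (C r)) :
    ∃ a : k, ∀ (τ : k) (hτ : (h.map (y : R →+* k)).eval τ ≠ 0), awayEval y τ hτ q = a := by
  have h0 : h ≠ 0 := by
    rintro rfl
    exact hy (by simp)
  have hinj : Function.Injective (algebraMap R[X] (Localization.Away h)) :=
    IsLocalization.injective _ (powers_le_nonZeroDivisors_of_noZeroDivisors h0)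
  obtain ⟨m, p, hp⟩ := IsLocalization.Away.surj h q
  have key : p * C r' = C r * h ^ m := hinj (by
    rw [map_mul, map_mul, map_pow, ← hp, ← hq]
    ring)
  have hlc : p.leadingCoeff * r' = r * h.leadingCoeff ^ m := by
    have := congrArg leadingCoeff key
    rwa [leadingCoeff_mul, leadingCoeff_mul, leadingCoeff_C, leadingCoeff_C, leadingCoeff_pow] at this
  have key' : C (h.leadingCoeff ^ m) * p = C p.leadingCoeff * h ^ m := by
    have hC : (C r' : R[X]) ≠ 0 := C_ne_zero.mpr hr'
    refine mul_right_cancel₀ hC ?_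
    rw [mul_assoc, key, mul_right_comm, ← C_mul, hlc, ← mul_assoc, ← C_mul, mul_comm (_ ^ m) r]
  refine ⟨y p.leadingCoeff / y h.leadingCoeff ^ m, fun τ hτ ↦ ?_⟩
  rw [eq_div_iff (pow_ne_zero _ hy)]
  have e1 := congrArg (awayEval y τ hτ) hp
  rw [map_mul, map_pow, awayEval_algebraMap, awayEval_algebraMap] at e1
  have e2 := congrArg (fun P ↦ (P.map (y : R →+* k)).eval τ) key'
  simp only [Polynomial.map_mul, Polynomial.map_pow, map_C, eval_mul, eval_pow, eval_C,
    RingHom.coe_coe, map_pow] at e2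
  refine mul_right_cancel₀ (pow_ne_zero m hτ) ?_
  rw [mul_right_comm, e1, mul_comm, e2]

theorem exists_algebra_away {R F L Ω : Type*} [CommRing R] [Field F] [Field L] [Field Ω]
    [Algebra R F] [FaithfulSMul R F] [Algebra F L] [Algebra F Ω] {h : R} (h0 : h ≠ 0) :
    ∃ (_ : Algebra (Localization.Away h) F) (_ : Algebra (Localization.Away h) L)
      (_ : Algebra (Localization.Away h) Ω), IsScalarTower (Localization.Away h) F L ∧
      IsScalarTower (Localization.Away h) F Ω ∧ IsScalarTower R (Localization.Away h) F := by
  let f : Localization.Away h →+* F := IsLocalization.Away.lift h (g := algebraMap R F)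
    ((map_ne_zero_iff _ (FaithfulSMul.algebraMap_injective R F)).mpr h0).isUnit
  let _ : Algebra (Localization.Away h) F := f.toAlgebra
  let _ : Algebra (Localization.Away h) L := ((algebraMap F L).comp f).toAlgebra
  let _ : Algebra (Localization.Away h) Ω := ((algebraMap F Ω).comp f).toAlgebra
  exact ⟨_, _, _, IsScalarTower.of_algebraMap_eq fun _ ↦ rfl,
    IsScalarTower.of_algebraMap_eq fun _ ↦ rfl,
    IsScalarTower.of_algebraMap_eq fun r ↦ (IsLocalization.Away.lift_eq h _ r).symm⟩

/-- The base is `T = R[X]_h`, with `h` a common denominator for the finite set of conditions. The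
fibres are those over `(y, τ i)`, where `y` is a point of `Spec R` at which the leading coefficient
of `h` does not vanish. -/
theorem exists_points_over_fibres {k F L Ω S : Type*} {R : Type v} [Field k] [Field F] [Field L]
    [Field Ω] [CommRing S] [CommRing R] [IsDomain R] [Algebra k R] [Algebra.FiniteType k R]
    [Algebra R[X] F] [IsFractionRing R[X] F] [Algebra k F] [IsScalarTower k R[X] F]
    [Algebra k L] [Algebra k S] [Algebra F L] [IsScalarTower k F L] [Algebra S L] [Algebra F Ω]
    [IsScalarTower k S L] [IsAlgClosed k] [IsAlgClosed Ω] [FiniteDimensional F L]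
    [Algebra.IsSeparable F L] [Algebra.IsAlgebraic F Ω] [Algebra.FiniteType k S]
    [IsFractionRing S L] {c : L} (hc : c ≠ 0) {g : S} (hg : algebraMap S L g ≠ 0) (N : ℕ) :
    ∃ (χ : Fin N × (L →ₐ[F] Ω) → S →ₐ[k] k) (w : Fin N × (L →ₐ[F] Ω) → k),
      Function.Injective χ ∧ (∀ p, χ p g ≠ 0) ∧ (∀ p, w p ≠ 0) ∧
      ∀ (a : S) (r r' : R), r' ≠ 0 → Algebra.trace F L (algebraMap S L a * c) *
        algebraMap R[X] F (C r') = algebraMap R[X] F (C r) →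
        ∃ b : k, ∀ i, ∑ σ, w (i, σ) * χ (i, σ) a = b := by
  classical
  have : IsDomain S := (IsFractionRing.injective S L).isDomain
  -- In `L` the coordinate `X` is `s₁ / s₂`. Keeping `s₂` non-zero at the points allows `τ i` to be
  -- recovered from `χ (i, σ)`, so different fibres are disjoint.
  obtain ⟨s₁, s₂, hs₂, hX⟩ := IsFractionRing.div_surjective (A := S)
    (algebraMap F L (algebraMap R[X] F X))
  have hs₂' : algebraMap S L s₂ ≠ 0 := (map_ne_zero_iff _ (IsFractionRing.injective S L)).mpr
    (nonZeroDivisors.ne_zero hs₂)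
  have hg' : algebraMap S L (g * s₂) ≠ 0 := by
    rw [map_mul]
    exact mul_ne_zero hg hs₂'
  obtain ⟨E, hE, H⟩ := exists_finite_points.{v} (k := k) (F := F) (Ω := Ω) hc hg'
  obtain ⟨⟨h, hh⟩, hEh⟩ := IsLocalization.exist_integer_multiples_of_finset
    (nonZeroDivisors R[X]) hE.toFinset
  have h0 : h ≠ 0 := nonZeroDivisors.ne_zero hh
  obtain ⟨_, _, _, _, _, _⟩ := exists_algebra_away (F := F) (L := L) (Ω := Ω) h0
  have hkF (x : k) : algebraMap (Localization.Away h) F (algebraMap k _ x) = algebraMap k F x := by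
    rw [IsScalarTower.algebraMap_apply k R[X] (Localization.Away h),
      ← IsScalarTower.algebraMap_apply R[X] (Localization.Away h) F,
      ← IsScalarTower.algebraMap_apply k R[X] F]
  have : IsScalarTower k (Localization.Away h) L := IsScalarTower.of_algebraMap_eq fun x ↦ by
    rw [IsScalarTower.algebraMap_apply (Localization.Away h) F L, hkF,
      ← IsScalarTower.algebraMap_apply k F L]
  have hhF : algebraMap R[X] F h ≠ 0 :=
    (map_ne_zero_iff _ (IsFractionRing.injective R[X] F)).mpr h0
  have hinj : Function.Injective (algebraMap (Localization.Away h) F) := by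
    rw [injective_iff_map_eq_zero]
    intro q hq
    obtain ⟨m, p, hp⟩ := IsLocalization.Away.surj h q
    have h1 := congrArg (algebraMap (Localization.Away h) F) hp
    rw [map_mul, hq, zero_mul, ← IsScalarTower.algebraMap_apply, eq_comm,
      map_eq_zero_iff _ (IsFractionRing.injective R[X] F)] at h1
    rw [h1, map_zero] at hp
    exact ((IsLocalization.Away.algebraMap_isUnit h).pow m).mul_left_eq_zero.mp hp
  have hER : E ⊆ Set.range (algebraMap (Localization.Away h) F) := by
    intro x hx
    obtain ⟨p, hp⟩ := hEh x (hE.mem_toFinset.mpr hx)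
    change _ = h • x at hp
    rw [Algebra.smul_def] at hp
    refine ⟨algebraMap _ _ p * IsLocalization.Away.invSelf h, mul_left_cancel₀ hhF ?_⟩
    rw [← hp, IsScalarTower.algebraMap_apply R[X] (Localization.Away h) F,
      IsScalarTower.algebraMap_apply R[X] (Localization.Away h) F, ← map_mul, mul_left_comm,
      IsLocalization.Away.mul_invSelf, mul_one]
  obtain ⟨htr, H⟩ := H (Localization.Away h) hER hinj
  obtain ⟨y, hy⟩ := exists_algHom_apply_ne_zero (k := k) R (leadingCoeff_ne_zero.mpr h0)
  have := IsAlgClosed.instInfinite (K := k)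
  obtain ⟨τ, hτ, hτh⟩ := exists_injective_eval_ne_zero N y hy
  choose χ w hχ hχg hw htrχ hmul using fun i ↦ H (awayEval y (τ i) (hτh i))
  have hχs (i : Fin N) (σ : L →ₐ[F] Ω) : τ i * χ i σ s₂ = χ i σ s₁ := by
    have := hmul i σ (algebraMap R[X] _ X) s₂ s₁ (by
      rw [IsScalarTower.algebraMap_apply (Localization.Away h) F L,
        ← IsScalarTower.algebraMap_apply R[X] (Localization.Away h) F, ← hX,
        div_mul_cancel₀ _ hs₂'])
    rwa [awayEval_algebraMap, map_X, eval_X] at this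
  have hχg' (i : Fin N) (σ : L →ₐ[F] Ω) : χ i σ g ≠ 0 ∧ χ i σ s₂ ≠ 0 := by
    have := hχg i σ
    rw [map_mul] at this
    exact mul_ne_zero_iff.mp this
  refine ⟨fun p ↦ χ p.1 p.2, fun p ↦ w p.1 p.2, ?_, fun p ↦ (hχg' p.1 p.2).1, fun p ↦ hw p.1 p.2,
    fun a r r' hr' ha ↦ ?_⟩
  · rintro ⟨i, σ⟩ ⟨j, ρ⟩ (hij : χ i σ = χ j ρ)
    have h1 := hχs i σ
    rw [hij, ← hχs j ρ] at h1
    obtain rfl := hτ (mul_right_cancel₀ (hχg' j ρ).2 h1)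
    rw [hχ i hij]
  · obtain ⟨q, hq⟩ := htr a
    obtain ⟨b, hb⟩ := awayEval_eq y hy hr' (q := q) (r := r) (hinj (by
      rw [map_mul, hq, ← IsScalarTower.algebraMap_apply, ← IsScalarTower.algebraMap_apply, ha]))
    exact ⟨b, fun i ↦ (htrχ i a q hq.symm).trans (hb _ _)⟩

end Fibres

end SepRuled

namespace SepRuled

/-! ### From homomorphisms to `k` to closed points of `X`. -/

section ClosedPoints

variable {k : Type u} [Field k] [IsAlgClosed k] {X : Scheme.{u}} [X.Over (Spec (CommRingCat.of k))]
  [LocallyOfFiniteType (X ↘ Spec (CommRingCat.of k))]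

theorem exists_isClosed_of_algHom {U : X.Opens} (hU : IsAffineOpen U) (χ : Γ(X, U) →ₐ[k] k) :
    ∃ x : X, IsClosed {x} ∧ ∃ hx : x ∈ U, ∀ a, X.presheaf.germ U x hx a ∈
      IsLocalRing.maximalIdeal (X.presheaf.stalk x) ↔ χ a = 0 := by
  let p := Spec.map (CommRingCat.ofHom χ.toRingHom)
  have hp : (p ≫ hU.fromSpec) ≫ (X ↘ Spec (CommRingCat.of k)) = 𝟙 _ := by
    rw [Category.assoc, fromSpec_over, ← Spec.map_comp, ← Spec.map_id]
    refine congrArg Spec.map (CommRingCat.hom_ext (RingHom.ext fun c ↦ ?_))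
    exact χ.commutes c
  have hpU (q) : (p ≫ hU.fromSpec) q ∈ U := by
    have : hU.fromSpec (p q) ∈ Set.range hU.fromSpec := ⟨_, rfl⟩
    rw [hU.range_fromSpec] at this
    exact this
  refine ⟨(p ≫ hU.fromSpec) (IsLocalRing.closedPoint k),
    (pointEquivClosedPoint (X ↘ Spec (CommRingCat.of k)) ⟨_, hp⟩).2, hpU _, fun a ↦ ?_⟩
  rw [← not_iff_not, IsLocalRing.mem_maximalIdeal, mem_nonunits_iff, not_not,
    ← Scheme.mem_basicOpen]
  change p (IsLocalRing.closedPoint k) ∈ hU.fromSpec ⁻¹ᵁ X.basicOpen a ↔ _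
  rw [hU.fromSpec_preimage_basicOpen]
  change ¬ χ a ∈ (IsLocalRing.closedPoint k).asIdeal ↔ _
  rw [not_iff_not]
  change χ a ∈ IsLocalRing.maximalIdeal k ↔ _
  rw [IsLocalRing.maximalIdeal_eq_bot, Ideal.mem_bot]

end ClosedPoints

end SepRuled

namespace SepRuled

/-! ### The fraction field of `R[X]` as a rational function field over `Frac R`. -/

section RationalFunctionField

open Polynomial

theorem transcendental_of_isFractionRing {R K F : Type*} [CommRing R] [IsDomain R] [Field K]
    [Field F] [Algebra R K] [IsFractionRing R K] [Algebra R[X] F] [IsFractionRing R[X] F]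
    [Algebra R F] [IsScalarTower R R[X] F] [Algebra K F] [IsScalarTower R K F] :
    Transcendental K (algebraMap R[X] F X) := by
  rw [Transcendental, ← IsFractionRing.isAlgebraic_iff R K F,
    isAlgebraic_algebraMap_iff (IsFractionRing.injective R[X] F)]
  exact Polynomial.transcendental_X R

theorem exists_eq_aeval_div_aeval {R K F : Type*} [CommRing R] [IsDomain R] [Field K]
    [Field F] [Algebra R K] [Algebra R[X] F] [IsFractionRing R[X] F]
    [Algebra R F] [IsScalarTower R R[X] F] [Algebra K F] [IsScalarTower R K F] (x : F) :
    ∃ f g : K[X], x = aeval (algebraMap R[X] F X) f / aeval (algebraMap R[X] F X) g := by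
  have h (p : R[X]) : algebraMap R[X] F p = aeval (algebraMap R[X] F X) (p.map (algebraMap R K)) := by
    rw [aeval_map_algebraMap, aeval_algebraMap_apply, aeval_X_left_apply]
  obtain ⟨p, q, -, rfl⟩ := IsFractionRing.div_surjective (A := R[X]) x
  exact ⟨_, _, by rw [h p, h q]⟩

end RationalFunctionField

/-! ### Constancy of the trace for sections of `Q`. -/

section TraceOfCoefficient

open AlgebraicIndependent

variable {k : Type u} [Field k] [PerfectField k] {X : Scheme.{u}} [IsIntegral X]
  [X.Over (Spec (CommRingCat.of k))] [IsProper (X ↘ Spec (CommRingCat.of k))]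

theorem exists_coefficient_of_ruling {K F : Type*} [Field K] [Field F] [Algebra k K]
    [Algebra.EssFiniteType k K] [Algebra K F] [Algebra F X.functionField]
    [Algebra K X.functionField] [IsScalarTower k K X.functionField]
    [IsScalarTower K F X.functionField] [FiniteDimensional F X.functionField]
    [Algebra.IsSeparable F X.functionField] {t : F} (ht : Transcendental K t)
    (hF : ∀ x : F, ∃ f g : Polynomial K, x = Polynomial.aeval t f / Polynomial.aeval t g)
    {Q : X.Modules} (hQ : IsInvertible Q) {i : ℕ}
    (φ : Q ⟶ modTorsion (differentialForms (X ↘ Spec (CommRingCat.of k)) i)) [Mono φ] :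
    ∃ (U : X.Opens) (_ : IsAffineOpen U) (_ : Nonempty U) (e : Γ(Q, U)) (_ : IsGenerator e)
      (c : X.functionField), c ≠ 0 ∧ ∀ (s : Γ(Q, ⊤)) (a : Γ(X, U)),
        Q.presheaf.map (homOfLE le_top : U ⟶ ⊤).op s = a • e →
        ∃ κ : K, Algebra.trace F X.functionField (algebraMap Γ(X, U) X.functionField a * c) =
          algebraMap K F κ := by
  classical
  -- Coordinates adapted to the ruling: a separating transcendence basis of `K`, which exists
  -- because `k` is perfect, completed by `t`.
  obtain ⟨S, hS, hsep⟩ := exists_isTranscendenceBasis_and_isSeparable_of_perfectField k K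
  have hsep' := Eq.subst (motive := fun S : Set _ ↦
    Algebra.IsSeparable (IntermediateField.adjoin k S) _) Subtype.range_coe.symm hsep
  let y : S → K := Subtype.val
  have hz := algebraicIndependent_coords (L := X.functionField) hS.1 ht
  have hzsep := isSeparable_adjoin_coords (L := X.functionField) hsep' hF
  obtain ⟨b, hb⟩ := exists_kaehlerDifferential_basis hz hzsep
  choose D hD using fun j ↦ exists_derivation_of_separating hz hzsep fun l ↦ if j = l then 1 else 0
  obtain ⟨U, hU, hne, e, he, I, c, hc, H⟩ := exists_coefficient D b (fun j l ↦ by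
    rw [hb, Derivation.liftKaehlerDifferential_comp_D]
    exact hD j l) hQ φ
  exact ⟨U, hU, hne, e, he, c, hc, fun s a ha ↦ exists_trace_eq_algebraMap ht hF hS hsep' hD I
    fun R _ _ _ _ _ _ _ ↦ mem_formSpan_of_valuationRing _ (H s a ha) R⟩

end TraceOfCoefficient

end SepRuled

/-! ### Separation of points bounds the degree. -/

namespace SepRuled

/-- Completes the points of two fibres to a list of exactly `n` points, with a prescribed one in
position `l`. -/
theorem exists_injective_of_card_le {α : Type*} [Fintype α] {n : ℕ} {A : Finset α} {a : α}
    (ha : a ∈ A) (hA : A.card ≤ n) (hn : n ≤ Fintype.card α) (l : Fin n) :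
    ∃ p : Fin n → α, Function.Injective p ∧ p l = a ∧ ∀ b ∈ A, ∃ j, p j = b := by
  classical
  obtain ⟨B, hAB, -, hB⟩ := Finset.exists_subsuperset_card_eq A.subset_univ hA hn
  let ε := B.equivFinOfCardEq hB
  refine ⟨fun j ↦ ε.symm (Equiv.swap l (ε ⟨a, hAB ha⟩) j), fun i j hij ↦ ?_, ?_, fun b hb ↦ ?_⟩
  · exact (Equiv.swap _ _).injective (ε.symm.injective (Subtype.ext hij))
  · simp
  · exact ⟨Equiv.swap l (ε ⟨a, hAB ha⟩) (ε ⟨b, hAB hb⟩), by simp⟩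

section Separation

open Polynomial

variable {k : Type u} [Field k] [IsAlgClosed k] {X : Scheme.{u}} [IsIntegral X]
  [X.Over (Spec (CommRingCat.of k))] [IsProper (X ↘ Spec (CommRingCat.of k))]

/-- If `n ≥ 2 d`, some section vanishes at every point of two fibres over one line except at a
single point of the second. The weighted sum over the first fibre is then zero, and over the second
a single non-zero term, yet the two sums agree. -/
theorem lt_two_mul_finrank {Q : X.Modules} {U : X.Opens} (hU : IsAffineOpen U)
    [Nonempty U] {e : Γ(Q, U)} (he : IsGenerator e) {c : X.functionField} (hc : c ≠ 0)
    {F : Type u} [Field F] [Algebra k F] [Algebra F X.functionField]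
    [IsScalarTower k F X.functionField] [FiniteDimensional F X.functionField]
    [Algebra.IsSeparable F X.functionField] {R : Type u} [CommRing R] [IsDomain R] [Algebra k R]
    [Algebra.FiniteType k R] [Algebra R[X] F] [IsFractionRing R[X] F] [IsScalarTower k R[X] F]
    (H : ∀ (s : Γ(Q, ⊤)) (a : Γ(X, U)),
      Q.presheaf.map (homOfLE le_top : U ⟶ ⊤).op s = a • e → ∃ r r' : R, r' ≠ 0 ∧
        Algebra.trace F X.functionField (algebraMap Γ(X, U) X.functionField a * c) *
          algebraMap R[X] F (C r') = algebraMap R[X] F (C r))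
    {n : ℕ} (hn : SeparatesGeneralPoints Q n) : n < 2 * Module.finrank F X.functionField := by
  classical
  by_contra! hle
  obtain ⟨V, hV, hsep⟩ := hn
  have hd : 0 < Module.finrank F X.functionField := Module.finrank_pos
  obtain ⟨x₀, hx₀U, hx₀V⟩ := hV.inter_open_nonempty U U.isOpen
    ⟨_, (‹Nonempty U› : Nonempty U).some.2⟩
  -- Non-vanishing of `g` will keep the chosen points inside the open set on which sections
  -- separate.
  obtain ⟨g, hgV, hx₀g⟩ := hU.exists_basicOpen_le (V := V) ⟨x₀, hx₀V⟩ hx₀U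
  have hfr := functionField_isFractionRing_of_isAffineOpen X U hU
  have hg0 : g ≠ 0 := by
    rintro rfl
    rw [Scheme.basicOpen_zero] at hx₀g
    exact hx₀g
  have hg : algebraMap Γ(X, U) X.functionField g ≠ 0 :=
    (map_ne_zero_iff _ (IsFractionRing.injective _ _)).mpr hg0
  have hft := finiteType_sections (k := k) hU
  -- `n` fibres are taken rather than two, so that there are enough points to complete the list to
  -- length `n`.
  obtain ⟨χ, w, hχ, hχg, hw, hsum⟩ := exists_points_over_fibres (k := k) (F := F)
    (Ω := AlgebraicClosure F) (R := R) hc hg n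
  choose x hxc hxU hx using fun p ↦ exists_isClosed_of_algHom hU (χ p)
  have hxinj : Function.Injective x := by
    intro p q hpq
    refine hχ (AlgHom.ext fun a ↦ ?_)
    have h1 := hx p (a - algebraMap k _ (χ q a))
    have h2 := hx q (a - algebraMap k _ (χ q a))
    have h3 : ∀ (y z : X) (hyz : y = z) (hy : y ∈ U) (hz : z ∈ U) (a : Γ(X, U)),
        X.presheaf.germ U y hy a ∈ IsLocalRing.maximalIdeal (X.presheaf.stalk y) ↔
          X.presheaf.germ U z hz a ∈ IsLocalRing.maximalIdeal (X.presheaf.stalk z) := by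
      rintro y _ rfl _ _ _
      rfl
    rw [h3 _ _ hpq (hxU p) (hxU q), h2, map_sub, map_sub, AlgHom.commutes, AlgHom.commutes,
      Algebra.algebraMap_self_apply, sub_self] at h1
    exact sub_eq_zero.mp (h1.mp rfl)
  have hxV (p) : x p ∈ V := hgV <| by
    rw [Scheme.mem_basicOpen _ _ _ (hxU p)]
    by_contra h
    exact hχg p ((hx p g).mp h)
  let l : Fin n := ⟨n - 1, by omega⟩
  let i₀ : Fin n := ⟨0, by omega⟩
  -- Here `n ≥ 2`, because `n ≥ 2 d` and `d > 0`.
  let i₁ : Fin n := ⟨1, by omega⟩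
  have hcard : Fintype.card (X.functionField →ₐ[F] AlgebraicClosure F) =
    Module.finrank F X.functionField := AlgHom.card F X.functionField (AlgebraicClosure F)
  obtain ⟨σ₀⟩ : Nonempty (X.functionField →ₐ[F] AlgebraicClosure F) :=
    Fintype.card_pos_iff.mp (hcard ▸ hd)
  obtain ⟨p, hp, hpl, hpA⟩ := exists_injective_of_card_le
    (A := ({i₀, i₁} : Finset (Fin n)) ×ˢ
      (Finset.univ : Finset (X.functionField →ₐ[F] AlgebraicClosure F))) (a := (i₁, σ₀))
    (by simp) (by
      rw [Finset.card_product, Finset.card_univ, hcard]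
      exact (Nat.mul_le_mul_right _ Finset.card_le_two).trans hle) (by
      rw [Fintype.card_prod, hcard, Fintype.card_fin]
      exact Nat.le_mul_of_pos_right _ hd) l
  obtain ⟨s, hs, hsl⟩ := hsep (fun j ↦ x (p j)) (hxinj.comp hp) (fun j ↦ ⟨hxV _, hxc _⟩) l
    (show n - 1 + 1 = n by omega)
  obtain ⟨a, ha⟩ := (he (𝟙 U)).2 (Q.presheaf.map (homOfLE le_top : U ⟶ ⊤).op s)
  have ha' : Q.presheaf.map (homOfLE le_top : U ⟶ ⊤).op s = a • e := by
    rw [← ha]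
    exact congrArg (a • ·) (ConcreteCategory.congr_hom (Q.presheaf.map_id (op U)) e)
  have hχa (q) : valueAt Q (x q) s = 0 ↔ χ q a = 0 :=
    (he.valueAt_eq_zero_iff (hxU q) s a ha').trans (hx q a)
  obtain ⟨r, r', hr', hrr⟩ := H s a ha'
  obtain ⟨b, hb⟩ := hsum a r r' hr' hrr
  have hzero (q) (hq : q.1 = i₀ ∨ q.1 = i₁) (hq' : q ≠ (i₁, σ₀)) : χ q a = 0 := by
    obtain ⟨j, rfl⟩ := hpA q (by simpa using hq)
    exact (hχa _).mp (hs j fun h ↦ hq' (h ▸ hpl))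
  have hb₀ : b = 0 := by
    rw [← hb i₀]
    refine Finset.sum_eq_zero fun σ _ ↦ ?_
    rw [hzero (i₀, σ) (Or.inl rfl) (fun h ↦ absurd (congrArg (fun q ↦ (q.1 : ℕ)) h)
      (by simp [i₀, i₁])),
      mul_zero]
  have hb₁ := hb i₁
  rw [Finset.sum_eq_single σ₀ (fun σ _ hσ ↦ by
    rw [hzero (i₁, σ) (Or.inr rfl) (fun h ↦ hσ (congrArg Prod.snd h)), mul_zero])
    (fun h ↦ absurd (Finset.mem_univ _) h), hb₀] at hb₁
  refine hsl ((hχa _).mpr ?_)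
  rw [hpl]
  exact (mul_eq_zero.mp hb₁).resolve_left (hw _)

theorem lt_two_mul_finrank_of_ruling {Q : X.Modules} (hQ : IsInvertible Q) {i : ℕ}
    (φ : Q ⟶ modTorsion (differentialForms (X ↘ Spec (CommRingCat.of k)) i)) [Mono φ]
    {F : Type u} [Field F] [Algebra F X.functionField] [FiniteDimensional F X.functionField]
    [Algebra.IsSeparable F X.functionField] {R : Type u} [CommRing R] [IsDomain R] [Algebra k R]
    [Algebra.FiniteType k R] (ψ : R[X] →+* F) (hψ : Function.Injective ψ)
    (hψF : ∀ x, ∃ f g, x = ψ f / ψ g)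
    (hψk : ∀ c, algebraMap F X.functionField (ψ (algebraMap k _ c)) =
      algebraMap k X.functionField c)
    {n : ℕ} (hn : SeparatesGeneralPoints Q n) : n < 2 * Module.finrank F X.functionField := by
  let _ : Algebra R[X] F := ψ.toAlgebra
  let _ : Algebra k F := (ψ.comp (algebraMap k R[X])).toAlgebra
  have : IsScalarTower k R[X] F := .of_algebraMap_eq fun _ ↦ rfl
  have : IsScalarTower k F X.functionField := .of_algebraMap_eq fun c ↦ (hψk c).symm
  have : FaithfulSMul R[X] F := (faithfulSMul_iff_algebraMap_injective _ _).mpr hψ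
  have : IsFractionRing R[X] F := IsFractionRing.of_field R[X] F fun x ↦ by
    obtain ⟨f, g, h⟩ := hψF x
    exact ⟨f, g, h⟩
  let _ : Algebra R F := (ψ.comp C).toAlgebra
  have : IsScalarTower R R[X] F := .of_algebraMap_eq fun _ ↦ rfl
  have : FaithfulSMul R F := (faithfulSMul_iff_algebraMap_injective _ _).mpr
    (hψ.comp C_injective)
  let K := FractionRing R
  let _ : Algebra K F := FractionRing.liftAlgebra R F
  have : IsScalarTower R K F := inferInstance
  let _ : Algebra K X.functionField := ((algebraMap F X.functionField).comp (algebraMap K F)).toAlgebra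
  have : IsScalarTower K F X.functionField := .of_algebraMap_eq fun _ ↦ rfl
  have : IsScalarTower k K X.functionField := .of_algebraMap_eq fun c ↦ by
    rw [IsScalarTower.algebraMap_apply k R K, IsScalarTower.algebraMap_apply K F X.functionField,
      ← IsScalarTower.algebraMap_apply R K F, ← hψk]
    rfl
  have : Algebra.EssFiniteType k K := .comp k R K
  obtain ⟨U, hU, _, e, he, c, hc, H⟩ := exists_coefficient_of_ruling
    (transcendental_of_isFractionRing (R := R) (K := K) (F := F))
    (exists_eq_aeval_div_aeval (R := R) (K := K)) hQ φ
  refine lt_two_mul_finrank (k := k) (F := F) (R := R) hU he hc (fun s a ha ↦ ?_) hn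
  obtain ⟨κ, hκ⟩ := H s a ha
  obtain ⟨r, r', hr', rfl⟩ := IsFractionRing.div_surjective (A := R) κ
  refine ⟨r, r', nonZeroDivisors.ne_zero hr', ?_⟩
  have hr0 : algebraMap R F r' ≠ 0 := (map_ne_zero_iff _ (FaithfulSMul.algebraMap_injective R F)).mpr
    (nonZeroDivisors.ne_zero hr')
  rw [hκ, map_div₀, ← IsScalarTower.algebraMap_apply, ← IsScalarTower.algebraMap_apply]
  exact div_mul_cancel₀ _ hr0

end Separation

end SepRuled

theorem proposition2p6 {k : Type u} [Field k] [IsAlgClosed k] {X : Scheme.{u}} [IsIntegral X]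
    (sX : X ⟶ Spec (CommRingCat.of k)) [IsProper sX]
    (Q : X.Modules) (hQ : SepRuled.IsInvertible Q)
    (i : ℕ) (hi : 0 < i)
    (φ : Q ⟶ SepRuled.modTorsion (SepRuled.differentialForms sX i)) (hφ : Mono φ)
    (n : ℕ) (hn : 0 < n) (hsep : SepRuled.SeparatesGeneralPoints Q n) :
    ((n / 2 : ℕ) : ℕ∞) < SepRuled.snr sX := by
  let _ : X.Over (Spec (CommRingCat.of k)) := ⟨sX⟩
  have : IsProper (X ↘ Spec (CommRingCat.of k)) := ‹IsProper sX›
  let φ' : Q ⟶ SepRuled.modTorsion (SepRuled.differentialForms (X ↘ Spec (CommRingCat.of k)) i) := φ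
  have : Mono φ' := hφ
  have key (d : ℕ) (hd : SepRuled.HasSeparableMapToRuled sX d) : n / 2 + 1 ≤ d := by
    obtain ⟨W, sW, _, f, _, -, hW, hf, hfin, hfsep, rfl⟩ := hd
    let _ : W.Over (Spec (CommRingCat.of k)) := ⟨sW⟩
    obtain ⟨R, _, _, _, _, ψ, hψ, hψF, hψk⟩ := SepRuled.exists_ruling (k := k) (W := W) hW
    let _ : Algebra W.functionField X.functionField := (SepRuled.functionFieldMap f).hom.toAlgebra
    have := SepRuled.lt_two_mul_finrank_of_ruling hQ φ' ψ hψ hψF (fun c ↦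
      (congrArg _ (hψk c)).trans
        (RingHom.congr_fun (SepRuled.functionFieldMap_comp_algebraMap f hf) c)) hsep
    omega
  -- A uniform lower bound for all degrees also covers the case where no such map exists and the
  -- infimum is infinite.
  refine lt_of_lt_of_le (b := ((n / 2 + 1 : ℕ) : ℕ∞)) (by exact_mod_cast Nat.lt_succ_self _) ?_
  exact le_iInf₂ fun d hd ↦ by exact_mod_cast key d hd
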